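/- **Setting.** A planar periodic framework $(G,\Gamma,p,\pi)$ consists of a connected simple graph $G=(V,E)$, an action of a free abelian group $\Gamma$ of rank two on $G$ with finitely many vertex orbits ($n$ of them) and edge orbits ($m$ of them), a placement $p:V\to\mathbb R^2$ with $p(u)\ne p(v)$ for every edge $\{u,v\}$, and a homomorphism $\pi:\Gamma\to\mathbb R^2$ onto a lattice of rank two with $p(\gamma v)=p(v)+\pi(\gamma)$. It is *non-crossing* if the closed segments of any two distinct edges are disjoint except for a common endpoint. Its faces are the connected components of the complement of the union of its edge segments. A non-crossing framework is a *periodic pseudo-triangulation* if every face is bounded by a simple closed polygon of the framework with exactly three internal angles smaller than $\pi$, and if the framework is pointed, i.e. at each vertex all incident edge vectors lie in an open half-plane. A *periodic displacement* is a pair $(p',\pi')$, $p':V\to\mathbb R^2$, $\pi':\Gamma\to\mathbb R^2$ a homomorphism, with $p'(\gamma v)=p'(v)+\pi'(\gamma)$. It changes the distance between $u$ and $v$ infinitesimally by $\delta_{uv}=(p(v)-p(u))\cdot(p'(v)-p'(u))$ (half the derivative of the squared distance). The rigidity matrix maps a displacement to the family $(\delta_\beta)_{\beta\in E/\Gamma}$.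 Its kernel is the space of *infinitesimal periodic motions*; the kernel of its transpose is the space of *periodic stresses*, families $s=(s_\beta)_{\beta\in E/\Gamma}$ of stress factors. A displacement is *trivial* if it is induced by an infinitesimal isometry of the plane. The framework is *infinitesimally rigid* if all its infinitesimal periodic motions are trivial, and *minimally rigid* if moreover $m=2n+1$. *Inserting* a pair $\{a,b\}$ with $p(a)\neq p(b)$ means adding to $E$ the orbit $\Gamma\{a,b\}$, with $p$ and $\pi$ unchanged. The distance between $a$ and $b$ *varies infinitesimally* if $\delta_{ab}\ne0$ for some infinitesimal periodic motion of the given framework. **Statement.** Let $(G,\Gamma,p,\pi)$ be a periodic pseudo-triangulation. 1. Let $a,b$ be vertices whose distance varies infinitesimally, and suppose that the framework obtained by inserting $\{a,b\}$ is non-crossing. Then this framework is minimally rigid. 2. Let $\{a,b\}$ and $\{c,d\}$ be pairs of vertices whose distances both vary infinitesimally, lying in different $\Gamma$-orbits, and suppose that the framework obtained by inserting both of them is non-crossing. Then the space of periodic stresses of the latter framework is one-dimensional, and every nonzero periodic stress has (nonzero) stress factors of opposite signs on the two inserted edge orbits. 3. Let $\{a,b\}$ and $\{c,d\}$ be pairs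 of vertices whose distances both vary infinitesimally, and suppose that the framework obtained by inserting both of them is non-crossing. Then, under every non-trivial infinitesimal periodic motion of the pseudo-triangulation, either both distances expand ($\delta_{ab}>0$ and $\delta_{cd}>0$) or both contract ($\delta_{ab}<0$ and $\delta_{cd}<0$). -/

import Mathlib

open Set Filter Topology

noncomputable section

namespace PeriodicRigidity

/-- The Euclidean plane. -/
abbrev Plane : Type := EuclideanSpace ℝ (Fin 2)

/-- Counter-clockwise rotation by a right angle, `(x, y) ↦ (-y, x)`. -/
def perp (w : Plane) : Plane := !₂[-(w 1), w 0]

/-- The determinant of the pair of plane vectors `w, z`. -/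
def det2 (w z : Plane) : ℝ := w 0 * z 1 - w 1 * z 0

section Orbits

variable (Γ : Type*) {V : Type*} [AddCommGroup Γ] [AddAction Γ V]

/-- The translate of an unordered pair of vertices by an element of the periodicity group. -/
def shift (g : Γ) (e : Sym2 V) : Sym2 V := Sym2.map (fun v => g +ᵥ v) e

theorem shift_zero (e : Sym2 V) : shift Γ (0 : Γ) e = e := by
  induction e with
  | h u v => simp [shift]

theorem shift_shift (g g' : Γ) (e : Sym2 V) : shift Γ g (shift Γ g' e) = shift Γ (g + g') e := by
  induction e with
  | h u v => simp [shift, add_vadd]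

/-- Two edges of `G` are equivalent if some element of `Γ` carries one to the other. -/
def edgeSetoid (G : SimpleGraph V) : Setoid G.edgeSet where
  r e f := ∃ g : Γ, shift Γ g e.1 = f.1
  iseqv :=
    { refl := fun e => ⟨0, shift_zero Γ e.1⟩
      symm := by
        rintro e f ⟨g, h⟩
        exact ⟨-g, by rw [← h, shift_shift, neg_add_cancel, shift_zero]⟩
      trans := by
        rintro e f k ⟨g, h⟩ ⟨g', h'⟩
        exact ⟨g' + g, by rw [← shift_shift, h, h']⟩ }

/-- The set `E / Γ` of edge orbits. -/
abbrev EdgeOrbit (G : SimpleGraph V) : Type _ := Quotient (edgeSetoid Γ G)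

/-- The set `V / Γ` of vertex orbits. -/
abbrev VertexOrbit (V : Type*) [AddAction Γ V] : Type _ := AddAction.orbitRel.Quotient Γ V

end Orbits

/-- A planar periodic framework `(G, Γ, p, π)`: a connected simple graph on `V`, invariant under the
action of the abelian group `Γ` (written additively), with finitely many vertex and edge orbits,
a placement `p` of its vertices in the plane that separates the ends of every edge,
and a representation `π` of `Γ` by a lattice of translations of rank two, such that
`p (γ v) = p v + π γ`. The field `lattice` says that `Γ` is free abelian of rank two and that `π`
takes a basis of `Γ` to a basis of the plane; so `π` is injective with a rank two lattice as its
image, and `Γ` acts without fixed vertices or edges. -/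
structure PeriodicFramework (V Γ : Type*) [AddCommGroup Γ] [AddAction Γ V] where
  graph : SimpleGraph V
  connected : graph.Connected
  adj_vadd : ∀ (g : Γ) (u v : V), graph.Adj u v → graph.Adj (g +ᵥ u) (g +ᵥ v)
  finite_vertexOrbit : Finite (VertexOrbit Γ V)
  finite_edgeOrbit : Finite (EdgeOrbit Γ graph)
  placement : V → Plane
  placement_ne : ∀ u v, graph.Adj u v → placement u ≠ placement v
  period : Γ →+ Plane
  lattice : ∃ b : Module.Basis (Fin 2) ℤ Γ, LinearIndependent ℝ (fun i => period (b i))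
  placement_vadd : ∀ (g : Γ) (v : V), placement (g +ᵥ v) = placement v + period g

namespace PeriodicFramework

variable {V Γ : Type*} [AddCommGroup Γ] [AddAction Γ V] (F : PeriodicFramework V Γ)

instance : Finite (EdgeOrbit Γ F.graph) := F.finite_edgeOrbit

instance : Fintype (EdgeOrbit Γ F.graph) := Fintype.ofFinite _

/-! ### Non-crossing frameworks, faces, pseudo-triangulations -/

/-- Two different edges have disjoint closed segments, except for the image of a common end. -/
def NonCrossing : Prop :=
  ∀ a b c d : V, F.graph.Adj a b → F.graph.Adj c d → s(a, b) ≠ s(c, d) →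
    segment ℝ (F.placement a) (F.placement b) ∩ segment ℝ (F.placement c) (F.placement d) ⊆
      F.placement '' ({a, b} ∩ {c, d})

/-- The subset of the plane covered by the framework. (Every vertex is an end of some edge.) -/
def realization : Set Plane :=
  {x | ∃ u v, F.graph.Adj u v ∧ x ∈ segment ℝ (F.placement u) (F.placement v)}

/-- A face is a connected component of the complement of the framework. -/
def IsFace (U : Set Plane) : Prop :=
  ∃ x ∈ F.realizationᶜ, U = connectedComponentIn F.realizationᶜ x

/-- `c` is the boundary polygon of `U`, listed counter-clockwise: a closed cycle of at least three
distinct vertices of the framework, consecutive ones joined by edges, whose segments make up the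
frontier of `U`, with `U` lying immediately to the left of each of the directed sides. -/
structure IsBoundaryPolygon (U : Set Plane) (k : ℕ) (c : ZMod k → V) : Prop where
  three_le : 3 ≤ k
  injective : Function.Injective c
  adj : ∀ i, F.graph.Adj (c i) (c (i + 1))
  frontier_eq : frontier U =
    ⋃ i, segment ℝ (F.placement (c i)) (F.placement (c (i + 1)))
  left : ∀ i, ∀ y ∈ openSegment ℝ (F.placement (c i)) (F.placement (c (i + 1))),
    ∀ᶠ t : ℝ in 𝓝[>] 0, y + t • perp (F.placement (c (i + 1)) - F.placement (c i)) ∈ U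

/-- The positions on a polygon listed counter-clockwise at which the internal angle is smaller
than `π`, that is, at which the polygon makes a left turn. -/
def corners (k : ℕ) (c : ZMod k → V) : Set (ZMod k) :=
  {i | 0 < det2 (F.placement (c i) - F.placement (c (i - 1)))
    (F.placement (c (i + 1)) - F.placement (c i))}

/-- The face `U` is a pseudo-triangle: it is bounded by a simple closed polygon with exactly three
internal angles smaller than `π`. -/
def IsPseudoTriangle (U : Set Plane) : Prop :=
  ∃ (k : ℕ) (c : ZMod k → V), F.IsBoundaryPolygon U k c ∧ (F.corners k c).ncard = 3

/-- The edges at `v` all lie strictly on one side of some line through `v`. -/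
def PointedAt (v : V) : Prop :=
  ∃ w : Plane, ∀ u, F.graph.Adj v u → 0 < inner ℝ w (F.placement u - F.placement v)

/-- Periodic pointed pseudo-triangulations. -/
structure IsPseudoTriangulation : Prop where
  nonCrossing : F.NonCrossing
  pseudoTriangle : ∀ U, F.IsFace U → F.IsPseudoTriangle U
  pointed : ∀ v, F.PointedAt v

/-! ### Infinitesimal periodic motions and periodic stresses -/

variable (V Γ) in
/-- Infinitesimal variations `(p', π')` of the placement and of the periods that preserve the
periodicity, `p' (γ v) = p' v + π' γ`. In terms of vertex representatives and generators of `Γ`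
this is the space `(ℝ²)ⁿ × ℝ^{2 × 2}` of dimension `2 n + 4`. -/
def displacements : Submodule ℝ ((V → Plane) × (Γ →+ Plane)) where
  carrier := {x | ∀ (g : Γ) (v : V), x.1 (g +ᵥ v) = x.1 v + x.2 g}
  add_mem' := by
    intro x y hx hy g v
    simp only [Prod.fst_add, Prod.snd_add, Pi.add_apply, AddMonoidHom.add_apply, hx g v, hy g v]
    abel
  zero_mem' := by
    intro g v
    simp
  smul_mem' := by
    intro r x hx g v
    simp only [Prod.smul_fst, Prod.smul_snd, Pi.smul_apply, hx g v, smul_add]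
    rfl

/-- The infinitesimal variation of the distance between `u` and `v`, as half the derivative of the
squared distance: positive for an expansion, negative for a contraction. -/
def stretch (x : displacements V Γ) (u v : V) : ℝ :=
  inner ℝ (F.placement v - F.placement u) (x.1.1 v - x.1.1 u)

theorem stretch_comm (x : displacements V Γ) (u v : V) : F.stretch x u v = F.stretch x v u := by
  unfold stretch
  rw [← neg_sub (F.placement u) (F.placement v), ← neg_sub (x.1.1 u) (x.1.1 v), inner_neg_neg]

theorem stretch_vadd (x : displacements V Γ) (g : Γ) (u v : V) :
    F.stretch x (g +ᵥ u) (g +ᵥ v) = F.stretch x u v := by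
  unfold stretch
  rw [F.placement_vadd, F.placement_vadd, x.2 g u, x.2 g v, add_sub_add_right_eq_sub,
    add_sub_add_right_eq_sub]

/-- The variation of the length of an unordered pair. -/
def stretchSym (x : displacements V Γ) : Sym2 V → ℝ :=
  Sym2.lift ⟨F.stretch x, F.stretch_comm x⟩

theorem stretchSym_shift (x : displacements V Γ) (g : Γ) (e : Sym2 V) :
    F.stretchSym x (shift Γ g e) = F.stretchSym x e := by
  induction e with
  | h u v => exact F.stretch_vadd x g u v

/-- The row of the rigidity matrix at an edge orbit, applied to a displacement. -/
def rigidityRow (x : displacements V Γ) : EdgeOrbit Γ F.graph → ℝ :=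
  Quotient.lift (fun e : F.graph.edgeSet => F.stretchSym x e.1) (by
    rintro e f ⟨g, h⟩
    change F.stretchSym x e.1 = F.stretchSym x f.1
    rw [← h, F.stretchSym_shift x g e.1])

/-- The rigidity matrix, as a linear map: half the differential of the squared lengths of
representatives of the edge orbits. -/
def rigidityMap : displacements V Γ →ₗ[ℝ] (EdgeOrbit Γ F.graph → ℝ) where
  toFun := F.rigidityRow
  map_add' := by
    intro x y
    ext β
    induction β using Quotient.inductionOn with
    | h e =>
      obtain ⟨e, he⟩ := e
      induction e with
      | h u v =>
        change F.stretch (x + y) u v = F.stretch x u v + F.stretch y u v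
        simp only [stretch, Submodule.coe_add, Prod.fst_add, Pi.add_apply, add_sub_add_comm,
          inner_add_right]
  map_smul' := by
    intro r x
    ext β
    induction β using Quotient.inductionOn with
    | h e =>
      obtain ⟨e, he⟩ := e
      induction e with
      | h u v =>
        change F.stretch (r • x) u v = r * F.stretch x u v
        simp only [stretch, Submodule.coe_smul, Prod.smul_fst, Pi.smul_apply, ← smul_sub,
          inner_smul_right]

/-- Infinitesimal periodic motions: the kernel of the rigidity matrix. -/
def infinitesimalMotions : Submodule ℝ (displacements V Γ) := LinearMap.ker F.rigidityMap

/-- The displacement is induced by an infinitesimal isometry `q ↦ t + ω q^⊥` of the plane. -/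
def IsTrivial (x : displacements V Γ) : Prop :=
  ∃ (t : Plane) (ω : ℝ), (∀ v, x.1.1 v = t + ω • perp (F.placement v)) ∧
    ∀ g, x.1.2 g = ω • perp (F.period g)

/-- Every infinitesimal periodic motion is trivial. -/
def InfinitesimallyRigid : Prop := ∀ x ∈ F.infinitesimalMotions, F.IsTrivial x

/-- Infinitesimally rigid with `m = 2 n + 1` edge orbits, `n` being the number of vertex orbits. -/
def MinimallyRigid : Prop :=
  F.InfinitesimallyRigid ∧ Nat.card (EdgeOrbit Γ F.graph) = 2 * Nat.card (VertexOrbit Γ V) + 1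

/-- Periodic stresses: the kernel of the transposed rigidity matrix, that is, the families of stress
factors on the edge orbits that are orthogonal to the image of the rigidity matrix. -/
def periodicStresses : Submodule ℝ (EdgeOrbit Γ F.graph → ℝ) where
  carrier := {s | ∀ x, ∑ β, s β * F.rigidityMap x β = 0}
  add_mem' := by
    intro s s' hs hs' x
    simp only [Pi.add_apply, add_mul, Finset.sum_add_distrib, hs x, hs' x, add_zero]
  zero_mem' := by
    intro x
    simp
  smul_mem' := by
    intro r s hs x
    simp only [Pi.smul_apply, smul_eq_mul, mul_assoc, ← Finset.mul_sum, hs x, mul_zero]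

/-- The distance between `a` and `b` varies infinitesimally under some infinitesimal periodic
motion of the framework. -/
def DistanceVaries (a b : V) : Prop := ∃ x ∈ F.infinitesimalMotions, F.stretch x a b ≠ 0

/-! ### Insertion of an edge orbit -/

/-- The orbit of a pair of vertices. -/
def pairOrbit (Γ : Type*) {V : Type*} [AddCommGroup Γ] [AddAction Γ V] (a b : V) : Set (Sym2 V) :=
  {e | ∃ g : Γ, e = s(g +ᵥ a, g +ᵥ b)}

/-- The framework with the edge `{a, b}` and all its translates inserted. -/
def insertEdge (a b : V) (hab : F.placement a ≠ F.placement b) : PeriodicFramework V Γ where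
  graph := F.graph ⊔ SimpleGraph.fromEdgeSet (pairOrbit Γ a b)
  connected := F.connected.mono le_sup_left
  adj_vadd := by
    intro g u v h
    rw [SimpleGraph.sup_adj, SimpleGraph.fromEdgeSet_adj] at h ⊢
    rcases h with h | ⟨⟨g', h⟩, hne⟩
    · exact Or.inl (F.adj_vadd g u v h)
    · refine Or.inr ⟨⟨g + g', ?_⟩, fun h' => hne (vadd_left_cancel g h')⟩
      have := congrArg (shift Γ g) h
      simpa [shift, add_vadd] using this
  finite_vertexOrbit := F.finite_vertexOrbit
  finite_edgeOrbit := by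
    have hadj : (F.graph ⊔ SimpleGraph.fromEdgeSet (pairOrbit Γ a b)).Adj a b := by
      rw [SimpleGraph.sup_adj, SimpleGraph.fromEdgeSet_adj]
      exact Or.inr ⟨⟨0, by simp⟩, fun h => hab (congrArg _ h)⟩
    let f : EdgeOrbit Γ F.graph ⊕ Unit →
        EdgeOrbit Γ (F.graph ⊔ SimpleGraph.fromEdgeSet (pairOrbit Γ a b)) :=
      Sum.elim
        (Quotient.map
          (fun e => ⟨e.1, SimpleGraph.edgeSet_mono le_sup_left e.2⟩)
          (fun _ _ h => h))
        (fun _ => Quotient.mk _ ⟨s(a, b), hadj⟩)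
    refine Finite.of_surjective f ?_
    intro β
    induction β using Quotient.inductionOn with
    | h e =>
      obtain ⟨e, he⟩ := e
      by_cases h : e ∈ F.graph.edgeSet
      · exact ⟨Sum.inl (Quotient.mk _ ⟨e, h⟩), rfl⟩
      · refine ⟨Sum.inr (), Quotient.sound ?_⟩
        rw [SimpleGraph.edgeSet_sup, SimpleGraph.edgeSet_fromEdgeSet] at he
        rcases he with he | ⟨⟨g, hg⟩, _⟩
        · exact absurd he h
        · exact ⟨g, hg.symm⟩
  placement := F.placement
  placement_ne := by
    intro u v h
    rw [SimpleGraph.sup_adj, SimpleGraph.fromEdgeSet_adj] at h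
    rcases h with h | ⟨⟨g, h⟩, _⟩
    · exact F.placement_ne u v h
    · rcases Sym2.eq_iff.1 h with ⟨rfl, rfl⟩ | ⟨rfl, rfl⟩
      · simpa [F.placement_vadd] using hab
      · simpa [F.placement_vadd] using hab.symm
  period := F.period
  lattice := F.lattice
  placement_vadd := F.placement_vadd

theorem insertEdge_adj (a b : V) (hab : F.placement a ≠ F.placement b) :
    (F.insertEdge a b hab).graph.Adj a b := by
  change (F.graph ⊔ SimpleGraph.fromEdgeSet (pairOrbit Γ a b)).Adj a b
  rw [SimpleGraph.sup_adj, SimpleGraph.fromEdgeSet_adj]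
  exact Or.inr ⟨⟨0, by simp⟩, fun h => hab (congrArg _ h)⟩

/-- The framework with the orbits of both edges `{a, b}` and `{c, d}` inserted. -/
def insertTwo (a b c d : V) (hab : F.placement a ≠ F.placement b)
    (hcd : F.placement c ≠ F.placement d) : PeriodicFramework V Γ :=
  (F.insertEdge a b hab).insertEdge c d hcd

/-- The orbit of the first inserted edge. -/
def firstOrbit (a b c d : V) (hab : F.placement a ≠ F.placement b)
    (hcd : F.placement c ≠ F.placement d) : EdgeOrbit Γ (F.insertTwo a b c d hab hcd).graph :=
  Quotient.mk _ ⟨s(a, b), Or.inl (F.insertEdge_adj a b hab)⟩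

/-- The orbit of the second inserted edge. -/
def secondOrbit (a b c d : V) (hab : F.placement a ≠ F.placement b)
    (hcd : F.placement c ≠ F.placement d) : EdgeOrbit Γ (F.insertTwo a b c d hab hcd).graph :=
  Quotient.mk _ ⟨s(c, d), (F.insertEdge a b hab).insertEdge_adj c d hcd⟩

end PeriodicFramework

end PeriodicRigidity

end

/-! Motions are paired with piecewise affine lifts, in the spirit of the Maxwell correspondence, on
the quotient by the periods. Let n, m, f count the orbits of vertices, edges and faces.

Counting. The faces are the cycles of the walk `nxt` on directed edges. There are 2m angles; each
face has three corners, and pointedness gives each vertex exactly one reflex angle and no straight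
one, so 2m = 3f + n (`card_eq`). The turning angles of a face add up to at most 2π, which gives f ≤
n (`card_faceOrbit_le`) and hence m ≤ 2n.

Lifts. `liftMap` takes a gradient on each face and a height at each vertex to their mismatch along
directed edges; its values have zero sum around every face. A periodic height that is affine on all
faces is constant (`eq_of_affine`): the faces with the reflex angles at the maxima and at the minima
are flat, and a closest pair of points between these two families cannot exist, since a reflex angle
always allows a closer approach. By the count, the range of `liftMap` has codimension at most one
among functions with zero sum around each face (`finrank_ker_le`). The angular velocities of the
edges under a motion define a functional that kills this range (`spinFunctional_liftMap`). If a
combination of two such functionals kills all functions with zero face sums, then the combined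
angular velocity is the same for all edges. So motions modulo trivial ones have dimension at most
one (`exists_combination_isTrivial`).

Ranks. If some distance varies, the rigidity matrix has rank at least 2n; with m ≤ 2n it is
surjective and m = 2n (`rigidityMap_surjective`). A motion keeping a varying distance is trivial.
Minimal rigidity and the dimension of the stress space follow by counting.

Signs. A non-crossing inserted edge is a chord of one face (`exists_isChord`). Two elements of the
space of functions with zero face sums are compared modulo lifts: the mismatch `baseO` coming from
half the squared distance to an origin, and a unit crease along the chord. Some combination of them
is a lift, and pairing it with a motion relates `expansion`, which does not depend on the chord, to
the stretch of the chord. When the chord varies, the lift can be normalised to a periodic Y such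
that Y plus half the squared distance is affine on the faces, up to a crease of size t along the
chord. At a minimum of Y the reflex angle would have to be a corner unless the chord cuts it, and
when it does t is negative (`crease_neg`). So the expansion is a negative multiple of the stretch
for every chord, and all stretches have the same sign. A stress pairs to zero with the motion, which
leaves only the two inserted terms and forces opposite signs. -/

noncomputable section
namespace PeriodicRigidity

/-! ### Plane vectors -/

theorem inner_eq (x y : Plane) : inner ℝ x y = x 0 * y 0 + x 1 * y 1 := by
  simp [PiLp.inner_apply, Fin.sum_univ_two, mul_comm]

theorem plane_ext {x y : Plane} (h0 : x 0 = y 0) (h1 : x 1 = y 1) : x = y := by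
  ext i; fin_cases i <;> assumption

@[simp] theorem perp_zero_coord (w : Plane) : perp w 0 = -w 1 := rfl
@[simp] theorem perp_one_coord (w : Plane) : perp w 1 = w 0 := rfl

theorem inner_perp (x y : Plane) : inner ℝ (perp x) y = det2 x y := by
  rw [inner_eq]; simp [det2]; ring

theorem perp_add (x y : Plane) : perp (x + y) = perp x + perp y := by
  apply plane_ext <;> simp; ring

theorem perp_smul (r : ℝ) (x : Plane) : perp (r • x) = r • perp x := by
  apply plane_ext <;> simp

theorem perp_neg (x : Plane) : perp (-x) = -perp x := by
  apply plane_ext <;> simp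

theorem perp_sub (x y : Plane) : perp (x - y) = perp x - perp y := by
  rw [sub_eq_add_neg, perp_add, perp_neg, sub_eq_add_neg]

theorem perp_perp (x : Plane) : perp (perp x) = -x := by
  apply plane_ext <;> simp

theorem perp_zero : perp 0 = 0 := by apply plane_ext <;> simp

theorem norm_perp (x : Plane) : ‖perp x‖ = ‖x‖ := by
  simp [EuclideanSpace.norm_eq, Fin.sum_univ_two, add_comm]

theorem normSq_eq (x : Plane) : ‖x‖ ^ 2 = x 0 ^ 2 + x 1 ^ 2 := by
  rw [← real_inner_self_eq_norm_sq, inner_eq]; ring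

theorem sq_pos_of_ne {x : Plane} (hx : x ≠ 0) : 0 < x 0 ^ 2 + x 1 ^ 2 := by
  rw [← normSq_eq]; positivity

theorem det2_self (x : Plane) : det2 x x = 0 := by simp [det2]; ring
theorem det2_swap (x y : Plane) : det2 x y = -det2 y x := by simp [det2]; ring
theorem det2_add_right (x y z : Plane) : det2 x (y + z) = det2 x y + det2 x z := by
  simp [det2]; ring
theorem det2_smul_right (r : ℝ) (x y : Plane) : det2 x (r • y) = r * det2 x y := by
  simp [det2]; ring
theorem det2_neg_right (x y : Plane) : det2 x (-y) = -det2 x y := by simp [det2]; ring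
theorem det2_neg_left (x y : Plane) : det2 (-x) y = -det2 x y := by simp [det2]; ring
theorem det2_perp_self (x : Plane) : det2 x (perp x) = ‖x‖ ^ 2 := by
  rw [normSq_eq]; simp [det2]; ring

/-- Vectors with vanishing determinant are parallel. -/
theorem exists_smul_of_det2_eq_zero {x y : Plane} (hx : x ≠ 0) (h : det2 x y = 0) :
    ∃ r : ℝ, y = r • x := by
  have hp := sq_pos_of_ne hx
  refine ⟨inner ℝ x y / (x 0 ^ 2 + x 1 ^ 2), ?_⟩
  simp only [det2] at h
  apply plane_ext
  · simp [inner_eq]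
    field_simp
    linear_combination -(x 1) * h
  · simp [inner_eq]
    field_simp
    linear_combination (x 0) * h

end PeriodicRigidity
end

/-! ### Discreteness: free lattice action, orbits of directed edges, local finiteness. -/

noncomputable section
namespace PeriodicRigidity
namespace PeriodicFramework

variable {V Γ : Type*} [AddCommGroup Γ] [AddAction Γ V] (F : PeriodicFramework V Γ)

/-! ### The lattice of periods -/

/-- In the basis of the plane given by the periods, the coordinates of a period are integers, and
they are bounded by a multiple of the norm. All local finiteness of the framework rests on this. -/
theorem finite_period_le (R : ℝ) : {g : Γ | ‖F.period g‖ ≤ R}.Finite := by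
  obtain ⟨b, hb⟩ := F.lattice
  let B : Module.Basis (Fin 2) ℝ Plane :=
    basisOfLinearIndependentOfCardEqFinrank hb (by simp)
  have hB : ∀ i, B i = F.period (b i) := fun i => by simp [B]
  have hrepr : ∀ g i, B.repr (F.period g) i = (b.repr g i : ℝ) := by
    intro g i
    have h1 : F.period g = ∑ j, (b.repr g j : ℝ) • B j := by
      conv_lhs => rw [← b.sum_repr g]
      rw [map_sum]
      refine Finset.sum_congr rfl fun j _ => ?_
      rw [map_zsmul, hB, Int.cast_smul_eq_zsmul]
    rw [h1, B.repr_sum_self]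
  have hbd : ∀ i, ∃ C : ℝ, ∀ x : Plane, |B.repr x i| ≤ C * ‖x‖ := by
    intro i
    let l : Plane →ₗ[ℝ] ℝ := B.coord i
    refine ⟨‖LinearMap.toContinuousLinearMap l‖, fun x => ?_⟩
    exact (LinearMap.toContinuousLinearMap l).le_opNorm x
  choose C hC using hbd
  have hfin : (Set.univ.pi fun i : Fin 2 =>
      Set.Icc (-⌈|C i| * |R|⌉) ⌈|C i| * |R|⌉).Finite :=
    Set.Finite.pi fun i => Set.finite_Icc _ _
  refine Set.Finite.of_finite_image (f := fun g => fun i => b.repr g i) (hfin.subset ?_) ?_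
  · rintro _ ⟨g, hg, rfl⟩ i -
    have h1 : |(b.repr g i : ℝ)| ≤ |C i| * |R| := by
      rw [← hrepr]
      refine (hC i _).trans ?_
      gcongr
      · exact le_abs_self _
      · exact le_trans hg (le_abs_self _)
    have h2 := abs_le.1 h1
    constructor
    · have : (-⌈|C i| * |R|⌉ : ℝ) ≤ (b.repr g i : ℝ) := by
        have := Int.le_ceil (|C i| * |R|)
        linarith [h2.1]
      exact_mod_cast this
    · have : (b.repr g i : ℝ) ≤ (⌈|C i| * |R|⌉ : ℝ) := h2.2.trans (Int.le_ceil _)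
      exact_mod_cast this
  · intro g _ g' _ h
    apply b.repr.injective
    ext i
    exact congrFun h i

theorem period_injective : Function.Injective F.period := by
  obtain ⟨b, hb⟩ := F.lattice
  rw [injective_iff_map_eq_zero]
  intro g hg
  have h1 : ∑ j, (b.repr g j : ℝ) • F.period (b j) = 0 := by
    rw [← hg]
    conv_rhs => rw [← b.sum_repr g]
    rw [map_sum]
    exact Finset.sum_congr rfl fun j _ => by rw [map_zsmul, Int.cast_smul_eq_zsmul]
  have h2 := Fintype.linearIndependent_iff.1 hb _ h1
  apply b.repr.injective
  ext i
  simpa using h2 i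

theorem period_ne_zero {g : Γ} (hg : g ≠ 0) : F.period g ≠ 0 := by
  rw [← map_zero F.period]
  exact fun h => hg (F.period_injective h)

theorem exists_ne_zero (F : PeriodicFramework V Γ) : ∃ g : Γ, g ≠ 0 := by
  obtain ⟨b, -⟩ := F.lattice
  exact ⟨b 0, b.ne_zero 0⟩

theorem vadd_eq_self (F : PeriodicFramework V Γ) {g : Γ} {v : V} (h : g +ᵥ v = v) : g = 0 := by
  by_contra hg
  have := F.placement_vadd g v
  rw [h] at this
  exact F.period_ne_zero hg (by simpa using this)

theorem vadd_left_injective (F : PeriodicFramework V Γ) {g g' : Γ} {v : V} (h : g +ᵥ v = g' +ᵥ v) : g = g' := by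
  have h1 : (-g' + g) +ᵥ v = v := by rw [add_vadd, h, ← add_vadd, neg_add_cancel, zero_vadd]
  have := F.vadd_eq_self h1
  exact (neg_add_eq_zero.1 this).symm

theorem nsmul_injective (F : PeriodicFramework V Γ) {g : Γ} (hg : g ≠ 0) : Function.Injective fun n : ℕ => n • g := by
  intro n m h
  have h1 : (n : ℝ) • F.period g = (m : ℝ) • F.period g := by
    have := congrArg F.period h
    simpa [map_nsmul, Nat.cast_smul_eq_nsmul] using this
  have := smul_left_injective ℝ (F.period_ne_zero hg) h1
  exact_mod_cast this

theorem exists_adj (v : V) : ∃ u, F.graph.Adj v u := by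
  obtain ⟨g, hg⟩ := F.exists_ne_zero
  have : Nontrivial V := ⟨⟨g +ᵥ v, v, fun h => hg (F.vadd_eq_self h)⟩⟩
  exact F.connected.preconnected.exists_adj_of_nontrivial v

/-! ### Darts -/

instance dartAction : AddAction Γ F.graph.Dart where
  vadd g d := ⟨(g +ᵥ d.fst, g +ᵥ d.snd), F.adj_vadd g _ _ d.adj⟩
  zero_vadd d := by
    apply SimpleGraph.Dart.ext
    exact Prod.ext (zero_vadd Γ d.fst) (zero_vadd Γ d.snd)
  add_vadd g h d := by
    apply SimpleGraph.Dart.ext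
    exact Prod.ext (add_vadd g h d.fst) (add_vadd g h d.snd)

@[simp] theorem vadd_fst (g : Γ) (d : F.graph.Dart) : (g +ᵥ d).fst = g +ᵥ d.fst := rfl
@[simp] theorem vadd_snd (g : Γ) (d : F.graph.Dart) : (g +ᵥ d).snd = g +ᵥ d.snd := rfl
theorem vadd_symm (g : Γ) (d : F.graph.Dart) : (g +ᵥ d).symm = g +ᵥ d.symm := rfl

theorem dart_ext {d d' : F.graph.Dart} (h1 : d.fst = d'.fst) (h2 : d.snd = d'.snd) : d = d' :=
  SimpleGraph.Dart.ext _ _ (Prod.ext h1 h2)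

/-- The orbits of directed edges. -/
abbrev DartOrbit : Type _ := AddAction.orbitRel.Quotient Γ F.graph.Dart

/-- The orbit of a directed edge. -/
def dmk (d : F.graph.Dart) : F.DartOrbit := Quotient.mk _ d

theorem dmk_eq {d d' : F.graph.Dart} : F.dmk d = F.dmk d' ↔ ∃ g : Γ, g +ᵥ d' = d := by
  unfold dmk
  rw [Quotient.eq]
  exact AddAction.orbitRel_apply

theorem dmk_vadd (g : Γ) (d : F.graph.Dart) : F.dmk (g +ᵥ d) = F.dmk d :=
  F.dmk_eq.2 ⟨g, rfl⟩

theorem dmk_surj (q : F.DartOrbit) : ∃ d, F.dmk d = q := Quotient.exists_rep q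

theorem exists_edgeRep (β : EdgeOrbit Γ F.graph) :
    ∃ d : F.graph.Dart, (Quotient.mk _ ⟨d.edge, d.edge_mem⟩ : EdgeOrbit Γ F.graph) = β := by
  induction β using Quotient.inductionOn with
  | h e =>
    obtain ⟨e, he⟩ := e
    induction e with
    | h u v => exact ⟨⟨(u, v), he⟩, rfl⟩

/-- A directed edge in a given orbit of edges. -/
def edgeRep (β : EdgeOrbit Γ F.graph) : F.graph.Dart := (F.exists_edgeRep β).choose

theorem edgeRep_spec (β : EdgeOrbit Γ F.graph) :
    (Quotient.mk _ ⟨(F.edgeRep β).edge, (F.edgeRep β).edge_mem⟩ : EdgeOrbit Γ F.graph) = β :=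
  (F.exists_edgeRep β).choose_spec

theorem exists_edgeRep_dart (d : F.graph.Dart) :
    ∃ g : Γ, d = g +ᵥ F.edgeRep (Quotient.mk _ ⟨d.edge, d.edge_mem⟩) ∨
      d = g +ᵥ (F.edgeRep (Quotient.mk _ ⟨d.edge, d.edge_mem⟩)).symm := by
  obtain ⟨g, hg⟩ := Quotient.exact (F.edgeRep_spec (Quotient.mk _ ⟨d.edge, d.edge_mem⟩))
  refine ⟨g, ?_⟩
  set r := F.edgeRep (Quotient.mk _ ⟨d.edge, d.edge_mem⟩)
  have h1 : (g +ᵥ r).edge = d.edge := hg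
  rcases SimpleGraph.dart_edge_eq_iff _ _ |>.1 h1 with h | h
  · exact Or.inl h.symm
  · right
    rw [← F.vadd_symm, h, SimpleGraph.Dart.symm_symm]

/-- Every orbit of edges consists of two orbits of directed edges. -/
def dartOrbitOf (x : EdgeOrbit Γ F.graph × Bool) : F.DartOrbit :=
  F.dmk (if x.2 then (F.edgeRep x.1).symm else F.edgeRep x.1)

/-- A translation reversing an edge would exchange its ends, so its double would fix a vertex;
freeness makes it zero. -/
theorem dmk_symm_ne (d : F.graph.Dart) : F.dmk d.symm ≠ F.dmk d := by
  intro h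
  obtain ⟨g, hg⟩ := F.dmk_eq.1 h
  have h1 : g +ᵥ d.fst = d.snd := congrArg (fun x => x.fst) hg
  have h2 : g +ᵥ d.snd = d.fst := congrArg (fun x => x.snd) hg
  have h3 : (2 • g) +ᵥ d.fst = d.fst := by rw [two_nsmul, add_vadd, h1, h2]
  have h4 : g = 0 := by
    by_contra hg
    have := F.nsmul_injective hg (a₁ := 2) (a₂ := 0) (by simpa using F.vadd_eq_self h3)
    omega
  rw [h4, zero_vadd] at h1
  exact d.fst_ne_snd h1

theorem edgeOrbit_mk_eq_of_dmk {d d' : F.graph.Dart} (h : F.dmk d = F.dmk d') :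
    (Quotient.mk _ ⟨d.edge, d.edge_mem⟩ : EdgeOrbit Γ F.graph) =
      Quotient.mk _ ⟨d'.edge, d'.edge_mem⟩ := by
  obtain ⟨g, rfl⟩ := F.dmk_eq.1 h
  exact (Quotient.sound ⟨g, rfl⟩ : (Quotient.mk _ (⟨d'.edge, d'.edge_mem⟩ : F.graph.edgeSet) :
    EdgeOrbit Γ F.graph) = _).symm

theorem dartOrbitOf_bijective : Function.Bijective F.dartOrbitOf := by
  constructor
  · rintro ⟨β, x⟩ ⟨β', x'⟩ h
    have key : ∀ (β : EdgeOrbit Γ F.graph) (x : Bool),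
        (Quotient.mk _ ⟨(if x then (F.edgeRep β).symm else F.edgeRep β).edge,
          SimpleGraph.Dart.edge_mem _⟩ : EdgeOrbit Γ F.graph) = β := by
      intro β x
      cases x
      · exact F.edgeRep_spec β
      · conv_rhs => rw [← F.edgeRep_spec β]
        congr 2
        exact SimpleGraph.Dart.edge_symm _
    have h1 : β = β' := by
      rw [← key β x, ← key β' x']
      exact F.edgeOrbit_mk_eq_of_dmk h
    subst h1
    cases x <;> cases x' <;> simp only [dartOrbitOf] at h ⊢
    · exact absurd h.symm (F.dmk_symm_ne _)
    · exact absurd h (F.dmk_symm_ne _)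
  · intro q
    obtain ⟨d, rfl⟩ := F.dmk_surj q
    obtain ⟨g, h | h⟩ := F.exists_edgeRep_dart d
    · refine ⟨(Quotient.mk _ ⟨d.edge, d.edge_mem⟩, false), ?_⟩
      conv_rhs => rw [h]
      exact (F.dmk_vadd _ _).symm
    · refine ⟨(Quotient.mk _ ⟨d.edge, d.edge_mem⟩, true), ?_⟩
      conv_rhs => rw [h]
      exact (F.dmk_vadd _ _).symm

instance : Finite F.DartOrbit := Finite.of_surjective _ F.dartOrbitOf_bijective.2
instance : Fintype F.DartOrbit := Fintype.ofFinite _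

theorem card_dartOrbit : Fintype.card F.DartOrbit = 2 * Nat.card (EdgeOrbit Γ F.graph) := by
  rw [← Nat.card_eq_fintype_card, ← Nat.card_eq_of_bijective _ F.dartOrbitOf_bijective,
    Nat.card_prod, mul_comm]
  simp

/-! ### Local finiteness -/

/-- The closed segment of a directed edge. -/
def seg (d : F.graph.Dart) : Set Plane :=
  segment ℝ (F.placement d.fst) (F.placement d.snd)

theorem seg_symm (d : F.graph.Dart) : F.seg d.symm = F.seg d := segment_symm _ _ _

theorem mem_realization {x : Plane} : x ∈ F.realization ↔ ∃ d, x ∈ F.seg d :=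
  ⟨fun ⟨u, v, h, hx⟩ => ⟨⟨(u, v), h⟩, hx⟩, fun ⟨d, hx⟩ => ⟨d.fst, d.snd, d.adj, hx⟩⟩

theorem seg_subset_realization (d : F.graph.Dart) : F.seg d ⊆ F.realization :=
  fun _ hx => F.mem_realization.2 ⟨d, hx⟩

/-- Representatives of the finitely many orbits have segments in a common disc, so only boundedly
long periods can bring one of them into the given disc. -/
theorem finite_darts_meeting (R : ℝ) :
    {d : F.graph.Dart | (F.seg d ∩ Metric.closedBall 0 R).Nonempty}.Finite := by
  let rep : F.DartOrbit → F.graph.Dart := fun q => (F.dmk_surj q).choose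
  have hrep : ∀ q, F.dmk (rep q) = q := fun q => (F.dmk_surj q).choose_spec
  obtain ⟨C, hC⟩ : ∃ C : ℝ, ∀ q, ∀ x ∈ F.seg (rep q), ‖x‖ ≤ C := by
    have : ∀ q, ∃ C : ℝ, ∀ x ∈ F.seg (rep q), ‖x‖ ≤ C := by
      intro q
      have hb : Bornology.IsBounded (F.seg (rep q)) := by
        unfold seg
        rw [segment_eq_image_lineMap]
        exact (isCompact_Icc.image (AffineMap.lineMap_continuous)).isBounded
      exact hb.exists_norm_le
    choose C hC using this
    obtain ⟨M, hM⟩ := (Set.finite_range C).bddAbove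
    exact ⟨M, fun q x hx => (hC q x hx).trans (hM ⟨q, rfl⟩)⟩
  refine (((F.finite_period_le (R + C)).prod (Set.finite_univ (α := F.DartOrbit))).image
    (fun x => x.1 +ᵥ rep x.2)).subset ?_
  rintro d ⟨x, hx, hxR⟩
  obtain ⟨g, hg⟩ := F.dmk_eq.1 (hrep (F.dmk d)).symm
  refine ⟨(g, F.dmk d), ⟨?_, trivial⟩, hg⟩
  have hx' : x - F.period g ∈ F.seg (rep (F.dmk d)) := by
    rw [← hg] at hx
    simp only [seg, vadd_fst, vadd_snd, F.placement_vadd] at hx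
    have := (mem_segment_translate ℝ (F.period g) (x := x - F.period g)
      (b := F.placement (rep (F.dmk d)).fst) (c := F.placement (rep (F.dmk d)).snd)).1
    apply this
    simpa [add_comm] using hx
  have h1 := hC _ _ hx'
  have h2 : ‖x‖ ≤ R := by simpa using hxR
  have h3 : ‖F.period g‖ ≤ ‖x‖ + ‖x - F.period g‖ := by
    have := norm_sub_le x (x - F.period g)
    simpa using this
  exact h3.trans (by linarith)

theorem isClosed_seg (d : F.graph.Dart) : IsClosed (F.seg d) := by
  unfold seg
  rw [segment_eq_image_lineMap]
  exact (isCompact_Icc.image (AffineMap.lineMap_continuous)).isClosed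

theorem isClosed_biUnion_seg (S : Set F.graph.Dart) : IsClosed (⋃ d ∈ S, F.seg d) := by
  rw [Set.biUnion_eq_iUnion]
  refine LocallyFinite.isClosed_iUnion ?_ fun d => F.isClosed_seg d.1
  intro x
  refine ⟨Metric.ball x 1, Metric.ball_mem_nhds x one_pos, ?_⟩
  have := F.finite_darts_meeting (‖x‖ + 1)
  refine Set.Finite.of_finite_image (f := Subtype.val) (this.subset ?_) Subtype.val_injective.injOn
  rintro _ ⟨d, ⟨y, hy, hyx⟩, rfl⟩
  refine ⟨y, hy, ?_⟩
  have h1 : dist y x < 1 := hyx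
  rw [mem_closedBall_zero_iff]
  have := norm_sub_norm_le y x
  rw [dist_eq_norm] at h1
  linarith

theorem isClosed_realization : IsClosed F.realization := by
  have : F.realization = ⋃ d ∈ (Set.univ : Set F.graph.Dart), F.seg d := by
    ext x; simp [F.mem_realization]
  rw [this]
  exact F.isClosed_biUnion_seg _

theorem isOpen_compl_realization : IsOpen F.realizationᶜ := F.isClosed_realization.isOpen_compl

theorem placement_mem_seg_left (d : F.graph.Dart) : F.placement d.fst ∈ F.seg d :=
  left_mem_segment _ _ _

theorem finite_neighbors (v : V) : {u | F.graph.Adj v u}.Finite := by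
  have h := F.finite_darts_meeting ‖F.placement v‖
  refine (h.image fun d => d.snd).subset fun u hu => ⟨⟨(v, u), hu⟩, ⟨F.placement v, ?_, ?_⟩, rfl⟩
  · exact left_mem_segment _ _ _
  · simp

/-- The vector of a directed edge. -/
def vec (d : F.graph.Dart) : Plane := F.placement d.snd - F.placement d.fst

@[simp] theorem vec_symm (d : F.graph.Dart) : F.vec d.symm = -F.vec d := by simp [vec]

@[simp] theorem vec_vadd (g : Γ) (d : F.graph.Dart) : F.vec (g +ᵥ d) = F.vec d := by
  simp [vec, F.placement_vadd]

theorem vec_ne_zero (d : F.graph.Dart) : F.vec d ≠ 0 :=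
  sub_ne_zero.2 (F.placement_ne _ _ d.adj).symm

theorem realization_vadd (g : Γ) {x : Plane} :
    x + F.period g ∈ F.realization ↔ x ∈ F.realization := by
  have key : ∀ (g : Γ) (x : Plane), x ∈ F.realization → x + F.period g ∈ F.realization := by
    rintro g x ⟨u, v, h, hx⟩
    refine ⟨g +ᵥ u, g +ᵥ v, F.adj_vadd g u v h, ?_⟩
    rw [F.placement_vadd, F.placement_vadd]
    have := (mem_segment_translate ℝ (F.period g)).2 hx
    simpa [add_comm] using this
  refine ⟨fun h => ?_, key g x⟩
  have := key (-g) _ h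
  simpa using this

end PeriodicFramework
end PeriodicRigidity
end

/-! ### Local planar structure: angles, rotation at a vertex, faces beside an edge. -/

noncomputable section
namespace PeriodicRigidity

/-! ### Angles -/

/-- Counter-clockwise rotation by the angle `φ`. -/
def rotv (φ : ℝ) (b : Plane) : Plane := Real.cos φ • b + Real.sin φ • perp b

theorem rotv_rotv (φ ψ : ℝ) (b : Plane) : rotv φ (rotv ψ b) = rotv (φ + ψ) b := by
  simp only [rotv, Real.cos_add, Real.sin_add]
  apply plane_ext <;> simp <;> ring

theorem rotv_smul (φ r : ℝ) (b : Plane) : rotv φ (r • b) = r • rotv φ b := by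
  simp only [rotv, perp_smul, smul_add, smul_comm r]

theorem rotv_two_pi (b : Plane) : rotv (2 * Real.pi) b = b := by simp [rotv]

theorem det2_rotv (φ : ℝ) (b : Plane) : det2 b (rotv φ b) = Real.sin φ * ‖b‖ ^ 2 := by
  rw [rotv, det2_add_right, det2_smul_right, det2_smul_right, det2_self, det2_perp_self]; ring

theorem inner_rotv (φ : ℝ) (b : Plane) : inner ℝ b (rotv φ b) = Real.cos φ * ‖b‖ ^ 2 := by
  rw [normSq_eq]; simp [rotv, inner_eq]; ring

theorem norm_rotv (φ : ℝ) (b : Plane) : ‖rotv φ b‖ = ‖b‖ := by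
  rw [← sq_eq_sq₀ (norm_nonneg _) (norm_nonneg _), normSq_eq, normSq_eq]
  simp [rotv]
  linear_combination (b 0 ^ 2 + b 1 ^ 2) * Real.sin_sq_add_cos_sq φ

theorem continuous_rotv (b : Plane) : Continuous fun φ => rotv φ b := by
  unfold rotv; fun_prop

theorem exists_ang {b x : Plane} (hb : b ≠ 0) (hx : x ≠ 0) :
    ∃ φ ∈ Set.Ioc 0 (2 * Real.pi), ∃ r > (0 : ℝ), x = r • rotv φ b := by
  -- In complex terms this is the conjugate of `b` times `x`, whose argument is the wanted angle up
  -- to a full turn; nonpositive arguments are shifted by 2π below.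
  let z : ℂ := ⟨inner ℝ b x, det2 b x⟩
  have hb' := sq_pos_of_ne hb
  have hz : z ≠ 0 := by
    intro h
    have h1 : inner ℝ b x = 0 := congrArg Complex.re h
    have h2 : det2 b x = 0 := congrArg Complex.im h
    obtain ⟨r, rfl⟩ := exists_smul_of_det2_eq_zero hb h2
    rw [inner_smul_right, real_inner_self_eq_norm_sq] at h1
    rcases mul_eq_zero.1 h1 with h | h
    · simp [h] at hx
    · exact hb (by simpa using h)
  have hnz : 0 < ‖z‖ := norm_pos_iff.2 hz
  have h1 : ‖z‖ * Real.cos z.arg = inner ℝ b x := Complex.norm_mul_cos_arg z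
  have h2 : ‖z‖ * Real.sin z.arg = det2 b x := Complex.norm_mul_sin_arg z
  have key : x = (‖z‖ / (b 0 ^ 2 + b 1 ^ 2)) • rotv z.arg b := by
    rw [inner_eq] at h1
    rw [det2] at h2
    apply plane_ext
    · simp [rotv]
      field_simp
      linear_combination -(b 0) * h1 + (b 1) * h2
    · simp [rotv]
      field_simp
      linear_combination -(b 1) * h1 - (b 0) * h2
  have hpos : 0 < ‖z‖ / (b 0 ^ 2 + b 1 ^ 2) := by positivity
  by_cases h0 : 0 < z.arg
  · exact ⟨z.arg, ⟨h0, by linarith [Complex.arg_le_pi z, Real.pi_pos]⟩, _, hpos, key⟩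
  · refine ⟨z.arg + 2 * Real.pi, ⟨by linarith [Complex.neg_pi_lt_arg z, Real.pi_pos], by linarith⟩,
      _, hpos, ?_⟩
    rwa [← rotv_rotv, rotv_two_pi]

theorem ang_unique {b : Plane} (hb : b ≠ 0) {φ ψ r s : ℝ} (hφ : φ ∈ Set.Ioc 0 (2 * Real.pi))
    (hψ : ψ ∈ Set.Ioc 0 (2 * Real.pi)) (hr : 0 < r) (hs : 0 < s)
    (h : r • rotv φ b = s • rotv ψ b) : φ = ψ := by
  have hb' : 0 < ‖b‖ := norm_pos_iff.2 hb
  have hrs : r = s := by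
    have := congrArg norm h
    rw [norm_smul, norm_smul, norm_rotv, norm_rotv, Real.norm_of_nonneg hr.le,
      Real.norm_of_nonneg hs.le] at this
    exact mul_right_cancel₀ hb'.ne' this
  subst hrs
  have h1 : rotv φ b = rotv ψ b := smul_right_injective _ hr.ne' h
  have hs : Real.sin φ = Real.sin ψ := by
    have := congrArg (det2 b) h1
    rw [det2_rotv, det2_rotv] at this
    exact mul_right_cancel₀ (by positivity) this
  have hc : Real.cos φ = Real.cos ψ := by
    have := congrArg (inner ℝ b) h1
    rw [inner_rotv, inner_rotv] at this
    exact mul_right_cancel₀ (by positivity) this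
  have h2 : Real.cos (φ - ψ) = 1 := by
    rw [Real.cos_sub, hs, hc]; nlinarith [Real.sin_sq_add_cos_sq ψ]
  have h3 := (Real.cos_eq_one_iff_of_lt_of_lt (by linarith [hφ.1, hψ.2])
    (by linarith [hφ.2, hψ.1])).1 h2
  linarith

open Classical in
/-- The angle in `(0, 2π]` of the counter-clockwise rotation that takes the direction of `b` to the
direction of `x`. -/
def ang (b x : Plane) : ℝ := if h : b ≠ 0 ∧ x ≠ 0 then (exists_ang h.1 h.2).choose else 0

theorem ang_mem {b x : Plane} (hb : b ≠ 0) (hx : x ≠ 0) : ang b x ∈ Set.Ioc 0 (2 * Real.pi) := by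
  rw [ang, dif_pos ⟨hb, hx⟩]
  exact (exists_ang hb hx).choose_spec.1

theorem ang_spec {b x : Plane} (hb : b ≠ 0) (hx : x ≠ 0) : ∃ r > (0 : ℝ), x = r • rotv (ang b x) b := by
  rw [ang, dif_pos ⟨hb, hx⟩]
  exact (exists_ang hb hx).choose_spec.2

theorem ang_eq {b x : Plane} (hb : b ≠ 0) {φ r : ℝ} (hφ : φ ∈ Set.Ioc 0 (2 * Real.pi)) (hr : 0 < r)
    (h : x = r • rotv φ b) : ang b x = φ := by
  have hx : x ≠ 0 := by
    rintro rfl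
    have := congrArg norm h
    rw [norm_smul, norm_rotv, norm_zero, Real.norm_of_nonneg hr.le] at this
    have := norm_pos_iff.2 hb
    nlinarith
  obtain ⟨s, hs, h'⟩ := ang_spec hb hx
  exact ang_unique hb (ang_mem hb hx) hφ hs hr (h'.symm.trans h)

theorem ang_add {b x y : Plane} (hb : b ≠ 0) (hx : x ≠ 0) (hy : y ≠ 0) :
    ang b y = ang b x + ang x y ∨ ang b y = ang b x + ang x y - 2 * Real.pi := by
  obtain ⟨r, hr, h1⟩ := ang_spec hb hx
  obtain ⟨s, hs, h2⟩ := ang_spec hx hy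
  have h1' := ang_mem hb hx
  have h2' := ang_mem hx hy
  have h3 : y = (s * r) • rotv (ang b x + ang x y) b := by
    conv_lhs => rw [h2]
    conv_lhs => rw [show rotv (ang x y) x = rotv (ang x y) (r • rotv (ang b x) b) by rw [← h1]]
    rw [rotv_smul, rotv_rotv, smul_smul, add_comm]
  by_cases h : ang b x + ang x y ≤ 2 * Real.pi
  · exact Or.inl (ang_eq hb ⟨add_pos h1'.1 h2'.1, h⟩ (mul_pos hs hr) h3)
  · refine Or.inr (ang_eq hb ⟨by linarith, by linarith [h1'.2, h2'.2]⟩ (mul_pos hs hr) ?_)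
    refine h3.trans ?_
    conv_lhs => rw [show ang b x + ang x y = (ang b x + ang x y - 2 * Real.pi) + 2 * Real.pi by ring,
      ← rotv_rotv, rotv_two_pi]

/-- The full turn, rather than zero, puts an edge last in its own counter-clockwise order, so that
`rot` returns the edge itself only when there is no other. -/
theorem ang_self {b : Plane} (hb : b ≠ 0) : ang b b = 2 * Real.pi :=
  ang_eq hb ⟨by positivity, le_rfl⟩ one_pos (by rw [rotv_two_pi, one_smul])

theorem det2_pos_iff_ang {b x : Plane} (hb : b ≠ 0) (hx : x ≠ 0) :
    0 < det2 b x ↔ ang b x < Real.pi := by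
  obtain ⟨r, hr, h⟩ := ang_spec hb hx
  have hm := ang_mem hb hx
  have hb' : 0 < ‖b‖ := norm_pos_iff.2 hb
  have h1 : det2 b x = r * (Real.sin (ang b x) * ‖b‖ ^ 2) := by
    conv_lhs => rw [h, det2_smul_right, det2_rotv]
  rw [h1]
  constructor
  · intro h2
    by_contra h3
    have h4 : Real.sin (ang b x) ≤ 0 := by
      rw [show ang b x = (ang b x - Real.pi) + Real.pi by ring, Real.sin_add_pi, neg_nonpos]
      exact Real.sin_nonneg_of_nonneg_of_le_pi (by linarith) (by linarith [hm.2])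
    have : r * (Real.sin (ang b x) * ‖b‖ ^ 2) ≤ 0 :=
      mul_nonpos_of_nonneg_of_nonpos hr.le (mul_nonpos_of_nonpos_of_nonneg h4 (by positivity))
    linarith
  · intro h2
    have := Real.sin_pos_of_pos_of_lt_pi hm.1 h2
    positivity

theorem pi_lt_ang_of_det2_neg {b x : Plane} (hb : b ≠ 0) (hx : x ≠ 0) (h : det2 b x < 0) :
    Real.pi < ang b x := by
  by_contra h1
  rcases (not_lt.1 h1).lt_or_eq with h2 | h2
  · linarith [(det2_pos_iff_ang hb hx).2 h2]
  · obtain ⟨r, hr, h3⟩ := ang_spec hb hx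
    rw [h3, det2_smul_right, det2_rotv, h2, Real.sin_pi] at h
    simp at h

namespace PeriodicFramework

variable {V Γ : Type*} [AddCommGroup Γ] [AddAction Γ V] (F : PeriodicFramework V Γ)

/-! ### Neighbourhoods of vertices and edges -/

variable {F} in
theorem NonCrossing.seg_inter (hF : F.NonCrossing) {d d' : F.graph.Dart} (h : d.edge ≠ d'.edge)
    {x : Plane} (hx : x ∈ F.seg d) (hx' : x ∈ F.seg d') :
    ∃ w, (w = d.fst ∨ w = d.snd) ∧ (w = d'.fst ∨ w = d'.snd) ∧ F.placement w = x := by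
  obtain ⟨w, ⟨h1, h2⟩, h3⟩ := hF d.fst d.snd d'.fst d'.snd d.adj d'.adj h ⟨hx, hx'⟩
  exact ⟨w, h1, h2, h3⟩

variable {F} in
-- Edges at two vertices in the same position meet there, so they share an end placed at that point;
-- any such end either identifies the two vertices or gives an edge of length zero.
theorem NonCrossing.placement_injective (hF : F.NonCrossing) : Function.Injective F.placement := by
  intro u v huv
  obtain ⟨a, ha⟩ := F.exists_adj u
  obtain ⟨b, hb⟩ := F.exists_adj v
  by_contra hne
  by_cases hab : F.graph.Adj u v
  · exact F.placement_ne _ _ hab huv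
  have hedge : s(u, a) ≠ s(v, b) := by
    rw [Ne, Sym2.eq_iff]
    rintro (⟨h, -⟩ | ⟨h, h'⟩)
    · exact hne h
    · subst h h'; exact hab ha
  obtain ⟨w, ⟨h1, h2⟩, h3⟩ := hF u a v b ha hb hedge
    ⟨left_mem_segment ℝ _ _, by rw [huv]; exact left_mem_segment ℝ _ _⟩
  rcases h1 with rfl | rfl
  · rcases h2 with rfl | rfl
    · exact hne rfl
    · exact hab hb.symm
  · exact F.placement_ne _ _ ha h3.symm

theorem mem_seg_iff {d : F.graph.Dart} {x : Plane} :
    x ∈ F.seg d ↔ ∃ s ∈ Set.Icc (0 : ℝ) 1, x = F.placement d.fst + s • F.vec d := by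
  rw [seg, segment_eq_image']
  exact ⟨fun ⟨s, hs, h⟩ => ⟨s, hs, h.symm⟩, fun ⟨s, hs, h⟩ => ⟨s, hs, h.symm⟩⟩

/-- The open segment of a directed edge. -/
def oseg (d : F.graph.Dart) : Set Plane :=
  openSegment ℝ (F.placement d.fst) (F.placement d.snd)

theorem mem_oseg_iff {d : F.graph.Dart} {x : Plane} :
    x ∈ F.oseg d ↔ ∃ s ∈ Set.Ioo (0 : ℝ) 1, x = F.placement d.fst + s • F.vec d := by
  rw [oseg, openSegment_eq_image']
  exact ⟨fun ⟨s, hs, h⟩ => ⟨s, hs, h.symm⟩, fun ⟨s, hs, h⟩ => ⟨s, hs, h.symm⟩⟩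

theorem oseg_subset_seg (d : F.graph.Dart) : F.oseg d ⊆ F.seg d := openSegment_subset_segment _ _ _

theorem oseg_symm (d : F.graph.Dart) : F.oseg d.symm = F.oseg d := openSegment_symm _ _ _

theorem mem_seg_cases {d : F.graph.Dart} {x : Plane} (hx : x ∈ F.seg d) :
    x = F.placement d.fst ∨ x = F.placement d.snd ∨ x ∈ F.oseg d := by
  obtain ⟨s, ⟨h0, h1⟩, rfl⟩ := F.mem_seg_iff.1 hx
  rcases h0.eq_or_lt with rfl | h0
  · left; simp
  rcases h1.eq_or_lt with rfl | h1
  · right; left; simp [vec]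
  · exact Or.inr (Or.inr (F.mem_oseg_iff.2 ⟨s, ⟨h0, h1⟩, rfl⟩))

variable {F} in
-- Distinct edges meet only at common ends, and an open segment contains neither of its ends.
theorem NonCrossing.edge_eq_of_mem_oseg (hF : F.NonCrossing) {d d' : F.graph.Dart} {x : Plane}
    (hx : x ∈ F.oseg d) (hx' : x ∈ F.seg d') : d'.edge = d.edge := by
  by_contra h
  obtain ⟨w, -, h2, h3⟩ := hF.seg_inter h hx' (F.oseg_subset_seg d hx)
  obtain ⟨s, ⟨h0, h1⟩, rfl⟩ := F.mem_oseg_iff.1 hx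
  rcases h2 with rfl | rfl
  · have : s • F.vec d = 0 := by simpa using h3
    rcases smul_eq_zero.1 this with h | h
    · exact h0.ne' h
    · exact F.vec_ne_zero d h
  · have : (1 - s) • F.vec d = 0 := by
      have h4 : F.vec d = s • F.vec d := by
        conv_lhs => rw [vec, h3]
        simp
      rw [sub_smul, one_smul, ← h4, sub_self]
    rcases smul_eq_zero.1 this with h | h
    · linarith
    · exact F.vec_ne_zero d h

variable {F} in
theorem NonCrossing.placement_mem_seg (hF : F.NonCrossing) {d : F.graph.Dart} {v : V}
    (h : F.placement v ∈ F.seg d) : v = d.fst ∨ v = d.snd := by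
  rcases F.mem_seg_cases h with h | h | h
  · exact Or.inl (hF.placement_injective h)
  · exact Or.inr (hF.placement_injective h)
  · obtain ⟨u, hu⟩ := F.exists_adj v
    have := hF.edge_eq_of_mem_oseg (d' := ⟨(v, u), hu⟩) h (left_mem_segment _ _ _)
    rcases SimpleGraph.dart_edge_eq_iff _ _ |>.1 this with h | h
    · left; rw [← h]
    · right; rw [← SimpleGraph.Dart.symm_symm d, ← h]; rfl

/-- The directed edges that start at `v`. -/
def outDarts (v : V) : Set F.graph.Dart := {d | d.fst = v}

theorem finite_outDarts (v : V) : (F.outDarts v).Finite := by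
  refine Set.Finite.of_finite_image (f := fun d => d.snd) ((F.finite_neighbors v).subset ?_) ?_
  · rintro _ ⟨d, rfl, rfl⟩; exact d.adj
  · intro d hd d' hd' h
    exact F.dart_ext (hd.trans hd'.symm) h

variable {F} in
theorem NonCrossing.eq_of_parallel (hF : F.NonCrossing) {d d' : F.graph.Dart}
    (h : d.fst = d'.fst) {r : ℝ} (hr : 0 < r) (hv : F.vec d' = r • F.vec d) : d = d' := by
  -- The parameter is small enough for the point to lie on both segments, whichever is longer.
  have hx : F.placement d.fst + (min 1 r / 2) • F.vec d ∈ F.oseg d :=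
    F.mem_oseg_iff.2 ⟨_, ⟨by positivity, by linarith [min_le_left 1 r]⟩, rfl⟩
  have hx' : F.placement d.fst + (min 1 r / 2) • F.vec d ∈ F.seg d' := by
    refine F.mem_seg_iff.2 ⟨min 1 r / 2 / r, ⟨by positivity, ?_⟩, ?_⟩
    · rw [div_le_one hr]; linarith [min_le_right 1 r, (lt_min one_pos hr)]
    · rw [h, hv, smul_smul, div_mul_cancel₀ _ hr.ne']
  have := hF.edge_eq_of_mem_oseg hx hx'
  rcases SimpleGraph.dart_edge_eq_iff _ _ |>.1 this with h1 | h1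
  · exact h1.symm
  · exact absurd (by rw [h, h1]; rfl) d.fst_ne_snd

variable {F} in
/-- Near a vertex the framework consists of the edges at this vertex. -/
theorem NonCrossing.exists_vertex_nhd (hF : F.NonCrossing) (v : V) :
    ∃ ε > 0, ∀ y ∈ Metric.ball (F.placement v) ε, y ∈ F.realization →
      ∃ d ∈ F.outDarts v, ∃ s ∈ Set.Icc (0 : ℝ) 1, y = F.placement v + s • F.vec d := by
  let S : Set F.graph.Dart := {d | d.fst ≠ v ∧ d.snd ≠ v}
  have hS : F.placement v ∈ (⋃ d ∈ S, F.seg d)ᶜ := by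
    simp only [mem_compl_iff, mem_iUnion, not_exists]
    intro d hd h
    rcases hF.placement_mem_seg h with h | h
    · exact hd.1 h.symm
    · exact hd.2 h.symm
  obtain ⟨ε, hε, h⟩ := Metric.isOpen_iff.1 (F.isClosed_biUnion_seg S).isOpen_compl _ hS
  refine ⟨ε, hε, fun y hy hyR => ?_⟩
  obtain ⟨d, hd⟩ := F.mem_realization.1 hyR
  have hdS : d ∉ S := fun hdS => h hy (mem_biUnion hdS hd)
  rw [mem_ofPred_eq, not_and_or, not_not, not_not] at hdS
  rcases hdS with h1 | h1
  · obtain ⟨s, hs, hy⟩ := F.mem_seg_iff.1 hd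
    exact ⟨d, h1, s, hs, by rw [← h1]; exact hy⟩
  · rw [← F.seg_symm] at hd
    obtain ⟨s, hs, hy⟩ := F.mem_seg_iff.1 hd
    exact ⟨d.symm, h1, s, hs, by rw [← h1]; exact hy⟩

variable {F} in
/-- Near the points of a compact part of an open edge the framework consists of this edge. -/
theorem NonCrossing.exists_edge_nhd (hF : F.NonCrossing) (d : F.graph.Dart) {K : Set Plane}
    (hK : IsCompact K) (hKd : K ⊆ F.oseg d) :
    ∃ ε > 0, ∀ x ∈ K, ∀ y ∈ Metric.ball x ε, y ∈ F.realization → y ∈ F.seg d := by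
  let S : Set F.graph.Dart := {d' | d'.edge ≠ d.edge}
  have hS : Disjoint K (⋃ d' ∈ S, F.seg d') := by
    rw [Set.disjoint_left]
    intro x hx h
    simp only [mem_iUnion] at h
    obtain ⟨d', hd', h⟩ := h
    exact hd' (hF.edge_eq_of_mem_oseg (hKd hx) h)
  obtain ⟨ε, hε, h⟩ := hS.exists_thickenings hK (F.isClosed_biUnion_seg S)
  refine ⟨ε, hε, fun x hx y hy hyR => ?_⟩
  obtain ⟨d', hd'⟩ := F.mem_realization.1 hyR
  by_cases hdS : d' ∈ S
  · exfalso
    refine Set.disjoint_left.1 h (Metric.mem_thickening_iff.2 ⟨x, hx, hy⟩) ?_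
    exact Metric.self_subset_thickening hε _ (mem_biUnion hdS hd')
  · rw [mem_ofPred_eq, not_not] at hdS
    rcases SimpleGraph.dart_edge_eq_iff _ _ |>.1 hdS with h1 | h1
    · rwa [h1] at hd'
    · rwa [h1, F.seg_symm] at hd'

theorem det2_of_mem_seg {d : F.graph.Dart} {x y : Plane} (hx : x ∈ F.seg d) (hy : y ∈ F.seg d) :
    det2 (F.vec d) (y - x) = 0 := by
  obtain ⟨s, -, rfl⟩ := F.mem_seg_iff.1 hx
  obtain ⟨t, -, rfl⟩ := F.mem_seg_iff.1 hy
  rw [add_sub_add_left_eq_sub, ← sub_smul, det2_smul_right, det2_self, mul_zero]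

/-! ### The rotation at a vertex -/

theorem exists_rot (d : F.graph.Dart) : ∃ d' ∈ F.outDarts d.fst, ∀ d'' ∈ F.outDarts d.fst,
    ang (F.vec d) (F.vec d') ≤ ang (F.vec d) (F.vec d'') :=
  Set.exists_min_image _ _ (F.finite_outDarts _) ⟨d, rfl⟩

/-- The next edge at the start of `d`, counter-clockwise. -/
def rot (d : F.graph.Dart) : F.graph.Dart := (F.exists_rot d).choose

@[simp] theorem rot_fst (d : F.graph.Dart) : (F.rot d).fst = d.fst := (F.exists_rot d).choose_spec.1

theorem ang_rot_le {d d' : F.graph.Dart} (h : d'.fst = d.fst) :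
    ang (F.vec d) (F.vec (F.rot d)) ≤ ang (F.vec d) (F.vec d') :=
  (F.exists_rot d).choose_spec.2 d' h

variable {F} in
theorem NonCrossing.eq_of_ang_eq (hF : F.NonCrossing) {d₁ d₂ : F.graph.Dart}
    (h : d₁.fst = d₂.fst) {b : Plane} (hb : b ≠ 0)
    (ha : ang b (F.vec d₁) = ang b (F.vec d₂)) : d₁ = d₂ := by
  obtain ⟨r, hr, h1⟩ := ang_spec hb (F.vec_ne_zero d₁)
  obtain ⟨s, hs, h2⟩ := ang_spec hb (F.vec_ne_zero d₂)
  refine hF.eq_of_parallel h (r := s / r) (by positivity) ?_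
  conv_rhs => rw [h1]
  rw [h2, ha, smul_smul, div_mul_cancel₀ _ hr.ne']

theorem ang_lt_two_pi_of_ne (hF : F.NonCrossing) {d d' : F.graph.Dart} (h : d'.fst = d.fst)
    (hne : d' ≠ d) : ang (F.vec d) (F.vec d') < 2 * Real.pi := by
  refine lt_of_le_of_ne (ang_mem (F.vec_ne_zero d) (F.vec_ne_zero d')).2 fun h1 => hne ?_
  exact hF.eq_of_ang_eq h (F.vec_ne_zero d) (h1.trans (ang_self (F.vec_ne_zero d)).symm)

theorem rot_ne_self (hF : F.NonCrossing) {d d' : F.graph.Dart} (h : d'.fst = d.fst)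
    (hne : d' ≠ d) : F.rot d ≠ d := by
  intro h1
  have h2 := F.ang_rot_le h
  rw [h1, ang_self (F.vec_ne_zero d)] at h2
  linarith [F.ang_lt_two_pi_of_ne hF h hne]

/-- For two edges with a common successor, the sweep from each to the successor is at most the sweep
to the other edge. The sweeps between the two edges add up to 2π, and this contradicts the
additivity of angles. -/
theorem rot_injective (hF : F.NonCrossing) : Function.Injective F.rot := by
  intro d d' h
  by_contra hne
  have hf : d.fst = d'.fst := by rw [← F.rot_fst d, h, F.rot_fst]
  have h1 := F.ang_rot_le hf.symm
  have h2 := F.ang_rot_le hf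
  rw [← h] at h2
  set u := F.rot d
  have n1 := F.vec_ne_zero d
  have n2 := F.vec_ne_zero d'
  have n3 := F.vec_ne_zero u
  have l1 := F.ang_lt_two_pi_of_ne hF hf.symm (Ne.symm hne)
  have l2 := F.ang_lt_two_pi_of_ne hF hf hne
  have m1 := ang_mem n1 n2
  have m2 := ang_mem n2 n1
  have m3 := ang_mem n2 n3
  have m4 := ang_mem n1 n3
  have hsum : ang (F.vec d) (F.vec d') + ang (F.vec d') (F.vec d) = 2 * Real.pi := by
    have := ang_add n1 n2 n1
    rw [ang_self n1] at this
    rcases this with h | h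
    · exact h.symm
    · linarith
  rcases ang_add n1 n2 n3 with h3 | h3
  · have h5 := m3.1
    linarith
  · have h6 : ang (F.vec d') (F.vec u) = ang (F.vec d') (F.vec d) := by linarith [m4.1]
    rw [h6] at h3
    linarith [m4.1]

theorem rot_bijective (hF : F.NonCrossing) : Function.Bijective F.rot := by
  refine ⟨F.rot_injective hF, fun d => ?_⟩
  have hfin := (F.finite_outDarts d.fst).to_subtype
  have hm : Set.MapsTo F.rot (F.outDarts d.fst) (F.outDarts d.fst) :=
    fun d' hd' => (F.rot_fst d').trans hd'
  have hs : Function.Surjective (hm.restrict F.rot _ _) :=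
    Finite.surjective_of_injective (hm.restrict_inj.2 (F.rot_injective hF).injOn)
  obtain ⟨⟨d', _⟩, h'⟩ := hs ⟨d, rfl⟩
  exact ⟨d', congrArg Subtype.val h'⟩

/-- `rot` is a choice of a minimiser, so equivariance needs uniqueness: edges at a vertex with the
same angle coincide. -/
theorem rot_vadd (hF : F.NonCrossing) (g : Γ) (d : F.graph.Dart) : F.rot (g +ᵥ d) = g +ᵥ F.rot d := by
  have key : ∀ (g : Γ) (d : F.graph.Dart),
      ang (F.vec d) (F.vec (F.rot d)) ≤ ang (F.vec (g +ᵥ d)) (F.vec (F.rot (g +ᵥ d))) := by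
    intro g d
    have := F.ang_rot_le (d := d) (d' := -g +ᵥ F.rot (g +ᵥ d)) (by simp [← add_vadd])
    simpa using this
  refine hF.eq_of_ang_eq (by simp) (F.vec_ne_zero d) ?_
  apply le_antisymm
  · have := key (-g) (g +ᵥ d)
    simpa [← add_vadd] using this
  · simpa using key g d

/-- If some edge makes a left turn with `d` then so does the next one. -/
theorem det2_rot_pos {d d' : F.graph.Dart} (h : d'.fst = d.fst)
    (hd : 0 < det2 (F.vec d) (F.vec d')) : 0 < det2 (F.vec d) (F.vec (F.rot d)) := by
  rw [det2_pos_iff_ang (F.vec_ne_zero _) (F.vec_ne_zero _)] at hd ⊢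
  exact (F.ang_rot_le h).trans_lt hd

end PeriodicFramework
end PeriodicRigidity
end

noncomputable section
namespace PeriodicRigidity
namespace PeriodicFramework

variable {V Γ : Type*} [AddCommGroup Γ] [AddAction Γ V] (F : PeriodicFramework V Γ)

/-! ### Faces -/

variable {F} in
theorem IsFace.subset {U : Set Plane} (hU : F.IsFace U) : U ⊆ F.realizationᶜ := by
  obtain ⟨x, -, rfl⟩ := hU
  exact connectedComponentIn_subset _ _

variable {F} in
theorem IsFace.isOpen {U : Set Plane} (hU : F.IsFace U) : IsOpen U := by
  obtain ⟨x, -, rfl⟩ := hU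
  exact F.isOpen_compl_realization.connectedComponentIn

variable {F} in
theorem IsFace.isPreconnected {U : Set Plane} (hU : F.IsFace U) : IsPreconnected U := by
  obtain ⟨x, -, rfl⟩ := hU
  exact isPreconnected_connectedComponentIn

variable {F} in
theorem IsFace.nonempty {U : Set Plane} (hU : F.IsFace U) : U.Nonempty := by
  obtain ⟨x, hx, rfl⟩ := hU
  exact ⟨x, mem_connectedComponentIn hx⟩

variable {F} in
theorem IsFace.eq_component {U : Set Plane} (hU : F.IsFace U) {y : Plane} (hy : y ∈ U) :
    U = connectedComponentIn F.realizationᶜ y := by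
  obtain ⟨x, hx, rfl⟩ := hU
  exact connectedComponentIn_eq hy

variable {F} in
theorem IsFace.subset_of_isPreconnected {U S : Set Plane} (hU : F.IsFace U)
    (hS : IsPreconnected S) (hSR : S ⊆ F.realizationᶜ) {y : Plane} (hyU : y ∈ U) (hyS : y ∈ S) :
    S ⊆ U := by
  rw [hU.eq_component hyU]
  exact hS.subset_connectedComponentIn hyS hSR

variable {F} in
theorem IsFace.eq_of_mem {U U' : Set Plane} (hU : F.IsFace U) (hU' : F.IsFace U') {y : Plane}
    (hy : y ∈ U) (hy' : y ∈ U') : U = U' := by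
  rw [hU.eq_component hy, hU'.eq_component hy']

theorem isFace_component {x : Plane} (hx : x ∉ F.realization) :
    F.IsFace (connectedComponentIn F.realizationᶜ x) := ⟨x, hx, rfl⟩

variable {F} in
theorem IsFace.frontier_subset {U : Set Plane} (hU : F.IsFace U) :
    frontier U ⊆ F.realization := by
  intro x hx
  by_contra hxR
  have hC := F.isFace_component hxR
  have hxC : x ∈ connectedComponentIn F.realizationᶜ x := mem_connectedComponentIn hxR
  obtain ⟨y, hyC, hyU⟩ := mem_closure_iff.1 hx.1 _ hC.isOpen hxC
  have := hU.eq_of_mem hC hyU hyC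
  rw [this, hC.isOpen.frontier_eq] at hx
  exact hx.2 hxC

/-- Near a compact part of an open edge only this edge is present, and a nonzero normal offset
leaves its line. -/
theorem exists_strip (hF : F.NonCrossing) (d : F.graph.Dart) {x y : Plane} (hx : x ∈ F.oseg d)
    (hy : y ∈ F.oseg d) : ∃ τ > (0 : ℝ), ∀ z ∈ segment ℝ x y, ∀ t ∈ Set.Ioo 0 τ,
      z + t • perp (F.vec d) ∉ F.realization := by
  have hK : IsCompact (segment ℝ x y) := by
    rw [segment_eq_image_lineMap]
    exact isCompact_Icc.image AffineMap.lineMap_continuous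
  have hKd : segment ℝ x y ⊆ F.oseg d := (convex_openSegment _ _).segment_subset hx hy
  obtain ⟨ε, hε, h⟩ := hF.exists_edge_nhd d hK hKd
  have hn : 0 < ‖perp (F.vec d)‖ := by rw [norm_perp]; exact norm_pos_iff.2 (F.vec_ne_zero d)
  refine ⟨ε / ‖perp (F.vec d)‖, by positivity, fun z hz t ht hR => ?_⟩
  have h1 := h z hz (z + t • perp (F.vec d)) (by
    rw [Metric.mem_ball, dist_eq_norm, add_sub_cancel_left, norm_smul, Real.norm_of_nonneg ht.1.le]
    exact (lt_div_iff₀ hn).1 ht.2) hR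
  have h2 := F.det2_of_mem_seg (F.oseg_subset_seg d (hKd hz)) h1
  rw [add_sub_cancel_left, det2_smul_right, det2_perp_self] at h2
  have := norm_pos_iff.2 (F.vec_ne_zero d)
  have := ht.1
  exact absurd h2 (by positivity)

/-- The midpoint of an edge. -/
def mid (d : F.graph.Dart) : Plane := F.placement d.fst + (1 / 2 : ℝ) • F.vec d

theorem mid_mem (d : F.graph.Dart) : F.mid d ∈ F.oseg d :=
  F.mem_oseg_iff.2 ⟨1 / 2, ⟨by norm_num, by norm_num⟩, rfl⟩

/-- Thin strips along the edge connect, off the framework, the points just to the left of the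
midpoint with those just to the left of any other inner point. -/
theorem exists_leftFace (hF : F.NonCrossing) (d : F.graph.Dart) :
    ∃ U, F.IsFace U ∧ ∀ x ∈ F.oseg d, ∀ᶠ t : ℝ in 𝓝[>] 0, x + t • perp (F.vec d) ∈ U := by
  obtain ⟨τ, hτ, h⟩ := F.exists_strip hF d (F.mid_mem d) (F.mid_mem d)
  have h0 := h _ (left_mem_segment ℝ _ _) (τ / 2) ⟨by positivity, by linarith⟩
  refine ⟨_, F.isFace_component h0, fun x hx => ?_⟩
  obtain ⟨σ, hσ, h'⟩ := F.exists_strip hF d (F.mid_mem d) hx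
  have hpath : ∀ ρ : ℝ, IsPreconnected ((fun p : Plane × ℝ => p.1 + p.2 • perp (F.vec d)) ''
      (segment ℝ (F.mid d) x ×ˢ Set.Ioo 0 ρ)) := fun ρ =>
    ((convex_segment _ _).isPreconnected.prod isPreconnected_Ioo).image _ (by fun_prop)
  have hpath2 : IsPreconnected ((fun t : ℝ => F.mid d + t • perp (F.vec d)) '' Set.Ioo 0 τ) :=
    isPreconnected_Ioo.image _ (by fun_prop)
  have hm : 0 < min τ σ := lt_min hτ hσ
  have hC := F.isFace_component h0
  have h1 := hC.subset_of_isPreconnected hpath2 (by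
    rintro _ ⟨t, ht, rfl⟩
    exact h _ (left_mem_segment ℝ _ _) t ht) (mem_connectedComponentIn h0)
    ⟨τ / 2, ⟨by positivity, by linarith⟩, rfl⟩
  have h2 := hC.subset_of_isPreconnected (hpath σ) (by
    rintro _ ⟨⟨z, t⟩, ⟨hz, ht⟩, rfl⟩
    exact h' _ hz t ht) (h1 ⟨min τ σ / 2, ⟨by positivity, by linarith [min_le_left τ σ]⟩, rfl⟩)
    ⟨(F.mid d, min τ σ / 2), ⟨left_mem_segment ℝ _ _, by positivity,
      by linarith [min_le_right τ σ]⟩, rfl⟩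
  filter_upwards [Ioo_mem_nhdsGT hσ] with t ht
  exact h2 ⟨(x, t), ⟨right_mem_segment ℝ _ _, ht⟩, rfl⟩

open Classical in
/-- The face immediately to the left of a directed edge. -/
def leftFace (d : F.graph.Dart) : Set Plane :=
  if hF : F.NonCrossing then (F.exists_leftFace hF d).choose else ∅

theorem isFace_leftFace (hF : F.NonCrossing) (d : F.graph.Dart) : F.IsFace (F.leftFace d) := by
  rw [leftFace, dif_pos hF]; exact (F.exists_leftFace hF d).choose_spec.1

theorem eventually_leftFace (hF : F.NonCrossing) (d : F.graph.Dart) {x : Plane}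
    (hx : x ∈ F.oseg d) : ∀ᶠ t : ℝ in 𝓝[>] 0, x + t • perp (F.vec d) ∈ F.leftFace d := by
  rw [leftFace, dif_pos hF]; exact (F.exists_leftFace hF d).choose_spec.2 x hx

theorem leftFace_eq_of_frequently (hF : F.NonCrossing) {d : F.graph.Dart} {x : Plane}
    (hx : x ∈ F.oseg d) {U : Set Plane} (hU : F.IsFace U)
    (h : ∃ᶠ t : ℝ in 𝓝[>] 0, x + t • perp (F.vec d) ∈ U) : F.leftFace d = U := by
  obtain ⟨t, h1, h2⟩ := (h.and_eventually (F.eventually_leftFace hF d hx)).exists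
  exact (F.isFace_leftFace hF d).eq_of_mem hU h2 h1

theorem oseg_subset_frontier (hF : F.NonCrossing) (d : F.graph.Dart) :
    F.oseg d ⊆ frontier (F.leftFace d) := by
  intro x hx
  have hU := F.isFace_leftFace hF d
  rw [hU.isOpen.frontier_eq]
  refine ⟨?_, fun h => hU.subset h (F.seg_subset_realization d (F.oseg_subset_seg d hx))⟩
  have hlim : Tendsto (fun t : ℝ => x + t • perp (F.vec d)) (𝓝[>] 0) (𝓝 x) := by
    have : Tendsto (fun t : ℝ => x + t • perp (F.vec d)) (𝓝 0) (𝓝 (x + (0 : ℝ) • perp (F.vec d))) :=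
      Continuous.tendsto (by fun_prop) 0
    simp only [zero_smul, add_zero] at this
    exact this.mono_left nhdsWithin_le_nhds
  exact mem_closure_of_tendsto hlim (F.eventually_leftFace hF d hx)

/-- The open sector between an edge and the next one, near their common end, lies in the face on
the left of the first edge and on the right of the second. -/
theorem exists_sector (hF : F.NonCrossing) (v : V) :
    ∃ ε > (0 : ℝ), (∀ y ∈ Metric.ball (F.placement v) ε, y ∈ F.realization →
      ∃ d ∈ F.outDarts v, ∃ s ∈ Set.Icc (0 : ℝ) 1, y = F.placement v + s • F.vec d) ∧
      ∀ d : F.graph.Dart, d.fst = v → ∀ r > (0 : ℝ), r * ‖F.vec d‖ < ε →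
      ∀ φ ∈ Set.Ioo 0 (ang (F.vec d) (F.vec (F.rot d))),
      F.placement v + r • rotv φ (F.vec d) ∈ F.leftFace d ∧
      F.placement v + r • rotv φ (F.vec d) ∈ F.leftFace (F.rot d).symm := by
  obtain ⟨ε, hε, hnhd⟩ := hF.exists_vertex_nhd v
  refine ⟨ε, hε, hnhd, fun d hd => ?_⟩
  set A := ang (F.vec d) (F.vec (F.rot d)) with hA
  have hd0 := F.vec_ne_zero d
  have hdn : 0 < ‖F.vec d‖ := norm_pos_iff.2 hd0
  have hAm : A ∈ Set.Ioc 0 (2 * Real.pi) := ang_mem hd0 (F.vec_ne_zero _)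
  set ε' := ε / ‖F.vec d‖
  have hε' : 0 < ε' := by positivity
  have hlt : ∀ r : ℝ, r * ‖F.vec d‖ < ε ↔ r < ε' := fun r => (lt_div_iff₀ hdn).symm
  let f : ℝ × ℝ → Plane := fun p => F.placement v + p.1 • rotv p.2 (F.vec d)
  have hfc : Continuous f := by
    have := (continuous_rotv (F.vec d)).comp (continuous_snd (X := ℝ) (Y := ℝ))
    exact continuous_const.add (continuous_fst.smul this)
  let S := f '' (Set.Ioo 0 ε' ×ˢ Set.Ioo 0 A)
  have hS : IsPreconnected S :=
    (isPreconnected_Ioo.prod isPreconnected_Ioo).image _ hfc.continuousOn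
  -- A framework point in the open sector would lie on an edge at `v` reached from `d` before the
  -- next one.
  have hSR : S ⊆ F.realizationᶜ := by
    rintro _ ⟨⟨r, φ⟩, ⟨hr, hφ⟩, rfl⟩ hR
    obtain ⟨d', hd', s, hs, h⟩ := hnhd _ (by
      simp only [f]
      rw [Metric.mem_ball, dist_eq_norm, add_sub_cancel_left, norm_smul, norm_rotv,
        Real.norm_of_nonneg hr.1.le]
      exact (hlt r).2 hr.2) hR
    simp only [f, add_right_inj] at h
    rcases hs.1.eq_or_lt with rfl | hs0
    · have := congrArg norm h
      rw [norm_smul, norm_rotv, zero_smul, norm_zero, Real.norm_of_nonneg hr.1.le] at this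
      have := mul_pos hr.1 hdn
      linarith
    · have h1 : F.vec d' = (r / s) • rotv φ (F.vec d) := by
        rw [div_eq_inv_mul, mul_smul, h, smul_smul, inv_mul_cancel₀ hs0.ne', one_smul]
      have h2 := ang_eq hd0 ⟨hφ.1, hφ.2.le.trans hAm.2⟩ (div_pos hr.1 hs0) h1
      have h3 := F.ang_rot_le (d := d) (d' := d') (hd'.trans hd.symm)
      linarith [hφ.2]
  -- points close to the edge
  set ρ := min 1 ε' / 2
  have hρ : 0 < ρ := by positivity
  have hρ1 : ρ < 1 := by have := min_le_left 1 ε'; simp only [ρ]; linarith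
  have hρε : ρ < ε' := by have := min_le_right 1 ε'; simp only [ρ]; linarith [lt_min one_pos hε']
  -- Polar coordinates of a point at parameter `ρ` along the edge with normal offset `t`; as `t`
  -- tends to zero it enters the sector near its first side.
  have harc : ∀ t : ℝ, 0 < t → ∃ φ r : ℝ, φ = Real.arctan (t / ρ) ∧ r = ρ / Real.cos φ ∧
      ρ • F.vec d + t • perp (F.vec d) = r • rotv φ (F.vec d) := by
    intro t ht
    refine ⟨_, _, rfl, rfl, ?_⟩
    have hc := Real.cos_arctan_pos (t / ρ)
    have htan := Real.tan_arctan (t / ρ)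
    rw [Real.tan_eq_sin_div_cos, div_eq_div_iff hc.ne' hρ.ne'] at htan
    rw [rotv, smul_add, smul_smul, smul_smul, div_mul_cancel₀ _ hc.ne']
    congr 2
    field_simp
    linarith
  have hlim : Tendsto (fun t : ℝ => Real.arctan (t / ρ)) (𝓝[>] 0) (𝓝 0) := by
    have : Tendsto (fun t : ℝ => Real.arctan (t / ρ)) (𝓝 0) (𝓝 (Real.arctan (0 / ρ))) :=
      Continuous.tendsto (by fun_prop) 0
    rw [zero_div, Real.arctan_zero] at this
    exact this.mono_left nhdsWithin_le_nhds
  have hlim2 : Tendsto (fun t : ℝ => ρ / Real.cos (Real.arctan (t / ρ))) (𝓝[>] 0) (𝓝 ρ) := by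
    have h1 : Tendsto (fun t : ℝ => Real.cos (Real.arctan (t / ρ))) (𝓝[>] 0) (𝓝 (Real.cos 0)) :=
      (Real.continuous_cos.tendsto 0).comp hlim
    rw [Real.cos_zero] at h1
    have h2 := (tendsto_const_nhds (x := ρ)).div h1 one_ne_zero
    rw [div_one] at h2
    exact h2
  have hev : ∀ᶠ t : ℝ in 𝓝[>] 0, 0 < t ∧ Real.arctan (t / ρ) < A ∧
      ρ / Real.cos (Real.arctan (t / ρ)) < ε' :=
    (eventually_mem_nhdsWithin (a := (0 : ℝ)) (s := Set.Ioi 0)).and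
      ((hlim.eventually (gt_mem_nhds hAm.1)).and (hlim2.eventually (gt_mem_nhds hρε)))
  have hpos : ∀ t : ℝ, 0 < t → 0 < Real.arctan (t / ρ) ∧
      0 < ρ / Real.cos (Real.arctan (t / ρ)) := fun t ht =>
    ⟨Real.arctan_pos.2 (by positivity), div_pos hρ (Real.cos_arctan_pos _)⟩
  have hS1 : S ⊆ F.leftFace d := by
    have hx : F.placement v + ρ • F.vec d ∈ F.oseg d :=
      F.mem_oseg_iff.2 ⟨ρ, ⟨hρ, hρ1⟩, by rw [hd]⟩
    obtain ⟨t, h1, ht, hta, htr⟩ := ((F.eventually_leftFace hF d hx).and hev).exists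
    obtain ⟨φ, r, rfl, rfl, h⟩ := harc t ht
    rw [add_assoc, h] at h1
    exact (F.isFace_leftFace hF d).subset_of_isPreconnected hS hSR h1
      ⟨(_, _), ⟨⟨(hpos t ht).2, htr⟩, (hpos t ht).1, hta⟩, rfl⟩
  have hS2 : S ⊆ F.leftFace (F.rot d).symm := by
    obtain ⟨k, hk, hu⟩ := ang_spec hd0 (F.vec_ne_zero (F.rot d))
    rw [← hA] at hu
    -- shrink so that the point lies on the open edge
    obtain ⟨c, hc0, hc1, hc2⟩ : ∃ c : ℝ, 0 < c ∧ c * k < ε' ∧ c < 1 := by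
      refine ⟨min 1 (ε' / k) / 2, by positivity, ?_, ?_⟩
      · have h1 := min_le_right 1 (ε' / k)
        have h2 : min 1 (ε' / k) / 2 < ε' / k := by
          have : 0 < ε' / k := by positivity
          linarith
        exact (lt_div_iff₀ hk).1 h2
      · have := min_le_left 1 (ε' / k); linarith
    have hx : F.placement v + c • F.vec (F.rot d) ∈ F.oseg (F.rot d).symm := by
      rw [F.oseg_symm]
      exact F.mem_oseg_iff.2 ⟨c, ⟨hc0, hc2⟩, by rw [F.rot_fst, hd]⟩
    set w := F.vec (F.rot d) with hw
    -- The same computation at the other side of the sector: the offset of the reversed next edge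
    -- decreases the angle from `A`.
    have harc' : ∀ t : ℝ, 0 < t → c • w + t • perp (-w) =
        (c / Real.cos (Real.arctan (t / c)) * k) •
          rotv (A - Real.arctan (t / c)) (F.vec d) := by
      intro t ht
      have hc := Real.cos_arctan_pos (t / c)
      have htan := Real.tan_arctan (t / c)
      rw [Real.tan_eq_sin_div_cos, div_eq_div_iff hc.ne' hc0.ne'] at htan
      have h1 : rotv (A - Real.arctan (t / c)) (F.vec d) =
          k⁻¹ • rotv (-Real.arctan (t / c)) w := by
        rw [hu, rotv_smul, rotv_rotv, smul_smul, inv_mul_cancel₀ hk.ne', one_smul]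
        congr 1; ring
      rw [h1, smul_smul, mul_assoc, mul_inv_cancel₀ hk.ne', mul_one, rotv, Real.cos_neg,
        Real.sin_neg, smul_add, smul_smul, smul_smul, div_mul_cancel₀ _ hc.ne', perp_neg, smul_neg,
        ← neg_smul]
      congr 2
      field_simp
      linarith
    have hlim' : Tendsto (fun t : ℝ => Real.arctan (t / c)) (𝓝[>] 0) (𝓝 0) := by
      have : Tendsto (fun t : ℝ => Real.arctan (t / c)) (𝓝 0) (𝓝 (Real.arctan (0 / c))) :=
        Continuous.tendsto (by fun_prop) 0
      rw [zero_div, Real.arctan_zero] at this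
      exact this.mono_left nhdsWithin_le_nhds
    have hlim2' : Tendsto (fun t : ℝ => c / Real.cos (Real.arctan (t / c)) * k) (𝓝[>] 0)
        (𝓝 (c * k)) := by
      have h1 : Tendsto (fun t : ℝ => Real.cos (Real.arctan (t / c))) (𝓝[>] 0) (𝓝 (Real.cos 0)) :=
        (Real.continuous_cos.tendsto 0).comp hlim'
      rw [Real.cos_zero] at h1
      have h2 := ((tendsto_const_nhds (x := c)).div h1 one_ne_zero).mul_const k
      rw [div_one] at h2
      exact h2
    have hev' : ∀ᶠ t : ℝ in 𝓝[>] 0, 0 < t ∧ Real.arctan (t / c) < A ∧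
        c / Real.cos (Real.arctan (t / c)) * k < ε' :=
      (eventually_mem_nhdsWithin (a := (0 : ℝ)) (s := Set.Ioi 0)).and
        ((hlim'.eventually (gt_mem_nhds hAm.1)).and (hlim2'.eventually (gt_mem_nhds hc1)))
    obtain ⟨t, h1, ht, hta, htr⟩ := ((F.eventually_leftFace hF _ hx).and hev').exists
    rw [vec_symm, ← hw, add_assoc, harc' t ht] at h1
    have hpos' : 0 < Real.arctan (t / c) := Real.arctan_pos.2 (by positivity)
    have hpos2 : 0 < c / Real.cos (Real.arctan (t / c)) * k :=
      mul_pos (div_pos hc0 (Real.cos_arctan_pos _)) hk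
    exact (F.isFace_leftFace hF _).subset_of_isPreconnected hS hSR h1
      ⟨(_, _), ⟨⟨hpos2, htr⟩, by linarith, by linarith⟩, rfl⟩
  intro r hr hrε φ hφ
  have hmem : F.placement v + r • rotv φ (F.vec d) ∈ S :=
    ⟨(r, φ), ⟨⟨hr, (hlt r).1 hrε⟩, hφ⟩, rfl⟩
  exact ⟨hS1 hmem, hS2 hmem⟩

/-- Both faces contain the open sector between the two edges. This is what makes `nxt` walk around a
single face. -/
theorem leftFace_rot_symm (hF : F.NonCrossing) (d : F.graph.Dart) :
    F.leftFace (F.rot d).symm = F.leftFace d := by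
  obtain ⟨ε, hε, -, h⟩ := F.exists_sector hF d.fst
  have hdn : 0 < ‖F.vec d‖ := norm_pos_iff.2 (F.vec_ne_zero d)
  have hA := (ang_mem (F.vec_ne_zero d) (F.vec_ne_zero (F.rot d))).1
  have h1 := h d rfl (ε / ‖F.vec d‖ / 2) (by positivity) (by field_simp; linarith)
    (ang (F.vec d) (F.vec (F.rot d)) / 2) ⟨by linarith, by linarith⟩
  exact (F.isFace_leftFace hF _).eq_of_mem (F.isFace_leftFace hF _) h1.2 h1.1

/-- A reflex angle contains the direction opposite to the sum of its sides. -/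
theorem eventually_reflex (hF : F.NonCrossing) {d : F.graph.Dart}
    (h : det2 (F.vec d) (F.vec (F.rot d)) < 0) : ∀ᶠ t : ℝ in 𝓝[>] 0,
      F.placement d.fst + t • (-(F.vec d + F.vec (F.rot d))) ∈ F.leftFace d := by
  obtain ⟨ε, hε, -, hs⟩ := F.exists_sector hF d.fst
  have hd0 := F.vec_ne_zero d
  have hdn : 0 < ‖F.vec d‖ := norm_pos_iff.2 hd0
  set q := -(F.vec d + F.vec (F.rot d)) with hq
  have hdet : 0 < det2 (F.vec d) q := by
    rw [hq, det2_neg_right, det2_add_right, det2_self]; linarith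
  have hq0 : q ≠ 0 := by intro h; rw [h] at hdet; simp [det2] at hdet
  obtain ⟨k, hk, hqk⟩ := ang_spec hd0 hq0
  have h1 := (det2_pos_iff_ang hd0 hq0).1 hdet
  have h2 := pi_lt_ang_of_det2_neg hd0 (F.vec_ne_zero _) h
  have h3 := (ang_mem hd0 hq0).1
  have hpos : 0 < ε / (k * ‖F.vec d‖) := by positivity
  filter_upwards [Ioo_mem_nhdsGT hpos] with t ht
  rw [hqk, smul_smul]
  refine (hs d rfl (t * k) (mul_pos ht.1 hk) ?_ _ ⟨h3, by linarith⟩).1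
  have := (lt_div_iff₀ (by positivity)).1 ht.2
  linarith

/-- Near a point of the framework, every point off the framework lies in the face on the left of an
edge through the given point. -/
theorem exists_nhd_leftFace (hF : F.NonCrossing) {x : Plane} (hx : x ∈ F.realization) :
    ∃ ε > (0 : ℝ), ∀ y ∈ Metric.ball x ε, y ∉ F.realization →
      ∃ d, x ∈ F.seg d ∧ y ∈ F.leftFace d := by
  obtain ⟨d, hd⟩ := F.mem_realization.1 hx
  have hvert : ∀ v, ∃ ε > (0 : ℝ), ∀ y ∈ Metric.ball (F.placement v) ε, y ∉ F.realization →
      ∃ d : F.graph.Dart, F.placement v ∈ F.seg d ∧ y ∈ F.leftFace d := by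
    intro v
    obtain ⟨ε, hε, -, hs⟩ := F.exists_sector hF v
    obtain ⟨u, hu⟩ := F.exists_adj v
    -- Within the length of the shortest edge at `v`, a point in the direction of an edge lies on
    -- that edge.
    obtain ⟨η, hη, hηs⟩ : ∃ η > (0 : ℝ), ∀ d ∈ F.outDarts v, η ≤ ‖F.vec d‖ := by
      obtain ⟨d, -, h⟩ := Set.exists_min_image _ (fun d => ‖F.vec d‖) (F.finite_outDarts v)
        ⟨⟨(v, u), hu⟩, rfl⟩
      exact ⟨‖F.vec d‖, norm_pos_iff.2 (F.vec_ne_zero d), h⟩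
    refine ⟨min ε η, lt_min hε hη, fun y hy hyR => ?_⟩
    have hy1 : dist y (F.placement v) < ε := lt_of_lt_of_le hy (min_le_left _ _)
    have hy2 : dist y (F.placement v) < η := lt_of_lt_of_le hy (min_le_right _ _)
    rw [dist_eq_norm] at hy1 hy2
    set q := y - F.placement v with hq
    have hyq : y = F.placement v + q := by rw [hq]; abel
    have hq0 : q ≠ 0 := by
      intro h
      rw [hyq, h, add_zero] at hyR
      exact hyR (F.seg_subset_realization ⟨(v, u), hu⟩ (left_mem_segment _ _ _))
    -- The edge last passed before reaching the direction of `q` counter-clockwise: the next edge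
    -- comes strictly later, so `q` lies in the sector of this edge.
    obtain ⟨d, hd, hmin⟩ := Set.exists_min_image _ (fun d => ang (F.vec d) q)
      (F.finite_outDarts v) ⟨⟨(v, u), hu⟩, rfl⟩
    have hd' : d.fst = v := hd
    have hd0 := F.vec_ne_zero d
    have hu0 := F.vec_ne_zero (F.rot d)
    obtain ⟨k, hk, hqk⟩ := ang_spec hd0 hq0
    refine ⟨d, by rw [← hd']; exact left_mem_segment _ _ _, ?_⟩
    rw [hyq, hqk]
    have hkn : k * ‖F.vec d‖ = ‖q‖ := by
      conv_rhs => rw [hqk, norm_smul, norm_rotv, Real.norm_of_nonneg hk.le]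
    refine (hs d hd' k hk (by rw [hkn]; exact hy1) _ ⟨(ang_mem hd0 hq0).1, ?_⟩).1
    by_contra hle
    rw [not_lt] at hle
    have hmin' := hmin (F.rot d) ((F.rot_fst d).trans hd')
    have hm1 := ang_mem hd0 hu0
    have hm2 := ang_mem hu0 hq0
    rcases ang_add hd0 hu0 hq0 with h | h
    · linarith [hm1.1]
    · have heq : ang (F.vec d) (F.vec (F.rot d)) = ang (F.vec d) q := by linarith [hm2.2]
      obtain ⟨l, hl, hul⟩ := ang_spec hd0 hu0
      rw [heq] at hul
      have hqu : q = (k / l) • F.vec (F.rot d) := by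
        rw [hul, smul_smul, div_mul_cancel₀ _ hl.ne', ← hqk]
      have hfst : F.placement (F.rot d).fst = F.placement v := by rw [F.rot_fst, hd']
      refine hyR (F.seg_subset_realization (F.rot d) (F.mem_seg_iff.2 ⟨k / l, ⟨by positivity, ?_⟩,
        by rw [hfst, ← hqu]; exact hyq⟩))
      have h1 : ‖q‖ < ‖F.vec (F.rot d)‖ :=
        hy2.trans_le (hηs _ ((F.rot_fst d).trans hd'))
      rw [hqu, norm_smul, Real.norm_of_nonneg (by positivity)] at h1
      by_contra h2
      have := norm_nonneg (F.vec (F.rot d))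
      nlinarith
  rcases F.mem_seg_cases hd with rfl | rfl | hxo
  · exact hvert _
  · exact hvert _
  · obtain ⟨ε, hε, h⟩ := hF.exists_edge_nhd d isCompact_singleton (singleton_subset_iff.2 hxo)
    obtain ⟨s, ⟨hs0, hs1⟩, hxs⟩ := F.mem_oseg_iff.1 hxo
    have hdn : 0 < ‖F.vec d‖ := norm_pos_iff.2 (F.vec_ne_zero d)
    -- The distance from `x` to the nearer end; a point of the line of the edge within this distance
    -- belongs to the edge.
    set δ := min s (1 - s) * ‖F.vec d‖ with hδdef
    have hδ : 0 < δ := mul_pos (lt_min hs0 (by linarith)) hdn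
    -- The half-disc on one side of the edge is convex and free of the framework, so it lies in one
    -- face.
    have key : ∀ d' : F.graph.Dart, d'.edge = d.edge → ∀ y ∈ Metric.ball x (min ε δ),
        0 < det2 (F.vec d') (y - x) → y ∈ F.leftFace d' := by
      intro d' hd' y hy hdet
      have hseg : F.seg d' = F.seg d := by
        rcases SimpleGraph.dart_edge_eq_iff _ _ |>.1 hd' with rfl | rfl
        · rfl
        · exact F.seg_symm d
      have hxo' : x ∈ F.oseg d' := by
        rcases SimpleGraph.dart_edge_eq_iff _ _ |>.1 hd' with rfl | rfl
        · exact hxo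
        · rwa [F.oseg_symm]
      have hconv : Convex ℝ (Metric.ball x (min ε δ) ∩ {y | 0 < det2 (F.vec d') (y - x)}) := by
        refine (convex_ball _ _).inter ?_
        intro y hy z hz a b ha hb hab
        have hy' : 0 < det2 (F.vec d') (y - x) := hy
        have hz' : 0 < det2 (F.vec d') (z - x) := hz
        show 0 < det2 (F.vec d') (a • y + b • z - x)
        have : a • y + b • z - x = a • (y - x) + b • (z - x) := by
          have : x = (a + b) • x := by rw [hab, one_smul]
          conv_lhs => rw [this]
          module
        rw [this, det2_add_right, det2_smul_right, det2_smul_right]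
        rcases ha.eq_or_lt with rfl | ha'
        · have : b = 1 := by linarith
          subst this; linarith
        · have := mul_pos ha' hy'
          have := mul_nonneg hb hz'.le
          linarith
      have hsub : Metric.ball x (min ε δ) ∩ {y | 0 < det2 (F.vec d') (y - x)} ⊆ F.realizationᶜ := by
        rintro z ⟨hz1, hz2⟩ hzR
        have h1 := h x rfl z (Metric.ball_subset_ball (min_le_left _ _) hz1) hzR
        rw [← hseg] at h1
        have h2 := F.det2_of_mem_seg (F.oseg_subset_seg _ hxo') h1
        exact (ne_of_gt hz2) h2
      have hd'n : 0 < ‖perp (F.vec d')‖ := by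
        rw [norm_perp]; exact norm_pos_iff.2 (F.vec_ne_zero d')
      have hpos : 0 < min ε δ / ‖perp (F.vec d')‖ := by positivity
      obtain ⟨t, ht1, ht2⟩ :=
        ((F.eventually_leftFace hF d' hxo').and (Ioo_mem_nhdsGT hpos)).exists
      refine (F.isFace_leftFace hF d').subset_of_isPreconnected hconv.isPreconnected hsub ht1
        ⟨?_, ?_⟩ ⟨hy, hdet⟩
      · rw [Metric.mem_ball, dist_eq_norm, add_sub_cancel_left, norm_smul,
          Real.norm_of_nonneg ht2.1.le]
        exact (lt_div_iff₀ hd'n).1 ht2.2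
      · show 0 < det2 (F.vec d') (x + t • perp (F.vec d') - x)
        rw [add_sub_cancel_left, det2_smul_right, det2_perp_self]
        have := norm_pos_iff.2 (F.vec_ne_zero d')
        have := ht2.1
        positivity
    refine ⟨min ε δ, lt_min hε hδ, fun y hy hyR => ?_⟩
    rcases lt_trichotomy (det2 (F.vec d) (y - x)) 0 with hlt | heq | hgt
    · refine ⟨d.symm, by rw [F.seg_symm]; exact hd, key d.symm (SimpleGraph.Dart.edge_symm d) y hy ?_⟩
      rw [F.vec_symm, det2_neg_left]; linarith
    · exfalso
      obtain ⟨r, hr⟩ := exists_smul_of_det2_eq_zero (F.vec_ne_zero d) heq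
      refine hyR (F.seg_subset_realization d (F.mem_seg_iff.2 ⟨s + r, ?_, ?_⟩))
      · have h1 : ‖y - x‖ < δ := by
          rw [← dist_eq_norm]; exact lt_of_lt_of_le hy (min_le_right _ _)
        rw [hr, norm_smul, Real.norm_eq_abs, hδdef] at h1
        have h2 := abs_lt.1 (lt_of_mul_lt_mul_right h1 hdn.le)
        have h3 := min_le_left s (1 - s)
        have h4 := min_le_right s (1 - s)
        exact ⟨by linarith, by linarith⟩
      · rw [add_smul, ← add_assoc, ← hxs, ← hr]; abel
    · exact ⟨d, hd, key d rfl y hy hgt⟩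

/-- The frontier of a face is covered by the edges that have it on their left. -/
theorem exists_dart_of_mem_frontier (hF : F.NonCrossing) {U : Set Plane} (hU : F.IsFace U)
    {x : Plane} (hx : x ∈ frontier U) : ∃ d, F.leftFace d = U ∧ x ∈ F.seg d := by
  obtain ⟨ε, hε, h⟩ := F.exists_nhd_leftFace hF (hU.frontier_subset hx)
  obtain ⟨y, hy1, hy2⟩ := mem_closure_iff.1 hx.1 _ Metric.isOpen_ball (Metric.mem_ball_self hε)
  obtain ⟨d, hd, hyd⟩ := h y hy1 (hU.subset hy2)
  exact ⟨d, (F.isFace_leftFace hF d).eq_of_mem hU hyd hy2, hd⟩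

/-- A linear functional takes its largest values on a bounded face near the vertices. -/
theorem exists_vertex_inner_ge (hF : F.NonCrossing) {U : Set Plane} (hU : F.IsFace U)
    (hb : Bornology.IsBounded U) {w : Plane} (hw : w ≠ 0) {x : Plane} (hx : x ∈ closure U) :
    ∃ d, F.leftFace d = U ∧
      (inner ℝ w x ≤ inner ℝ w (F.placement d.fst) ∨ inner ℝ w x ≤ inner ℝ w (F.placement d.snd)) := by
  have hc : IsCompact (closure U) := hb.isCompact_closure
  obtain ⟨z, hz, hmax⟩ := hc.exists_isMaxOn ⟨x, hx⟩
    (f := fun y => inner ℝ w y) (by fun_prop)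
  have hzf : z ∈ frontier U := by
    rw [hU.isOpen.frontier_eq]
    refine ⟨hz, fun hzU => ?_⟩
    have hlim : Tendsto (fun t : ℝ => z + t • w) (𝓝[>] 0) (𝓝 z) := by
      have : Tendsto (fun t : ℝ => z + t • w) (𝓝 0) (𝓝 (z + (0 : ℝ) • w)) :=
        Continuous.tendsto (by fun_prop) 0
      simp only [zero_smul, add_zero] at this
      exact this.mono_left nhdsWithin_le_nhds
    obtain ⟨t, ht, ht0⟩ := ((hlim.eventually (hU.isOpen.mem_nhds hzU)).and
      (eventually_mem_nhdsWithin (a := (0 : ℝ)) (s := Set.Ioi 0))).exists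
    have h1 : inner ℝ w (z + t • w) ≤ inner ℝ w z := hmax (subset_closure ht)
    rw [inner_add_right, inner_smul_right, real_inner_self_eq_norm_sq] at h1
    have := norm_pos_iff.2 hw
    have : 0 < t * ‖w‖ ^ 2 := mul_pos ht0 (by positivity)
    linarith
  obtain ⟨d, hd, hzd⟩ := F.exists_dart_of_mem_frontier hF hU hzf
  refine ⟨d, hd, ?_⟩
  have h1 : inner ℝ w x ≤ inner ℝ w z := hmax hx
  obtain ⟨s, ⟨hs0, hs1⟩, rfl⟩ := F.mem_seg_iff.1 hzd
  rw [inner_add_right, inner_smul_right, vec, inner_sub_right] at h1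
  by_contra hcon
  rw [not_or, not_le, not_le] at hcon
  rcases hs1.eq_or_lt with rfl | hs1
  · linarith [hcon.2]
  · have h2 := mul_pos (sub_pos.2 hs1) (sub_pos.2 hcon.1)
    have h3 := mul_nonneg hs0 (sub_pos.2 hcon.2).le
    nlinarith

end PeriodicFramework
end PeriodicRigidity
end

noncomputable section
namespace PeriodicRigidity

/-! ### Closed polygons separate the two sides of an edge -/

/-- The identification of the plane with the complex numbers. -/
def toC (w : Plane) : ℂ := ⟨w 0, w 1⟩

theorem toC_smul (r : ℝ) (x : Plane) : toC (r • x) = r * toC x := by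
  apply Complex.ext <;> simp [toC]

theorem toC_injective : Function.Injective toC := fun _ _ h =>
  plane_ext (congrArg Complex.re h) (congrArg Complex.im h)

theorem toC_eq_zero {x : Plane} : toC x = 0 ↔ x = 0 := by
  rw [← toC_injective.eq_iff]
  have : toC 0 = 0 := by apply Complex.ext <;> simp [toC]
  rw [this]

theorem continuous_toC : Continuous toC := by
  have : toC = fun w : Plane => ((w 0 : ℝ) : ℂ) + (w 1 : ℝ) * Complex.I := by
    ext w; apply Complex.ext <;> simp [toC]
  rw [this]
  fun_prop

/-- The angle under which the segment from `a` to `b` is seen from `x`. -/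
def viewAngle (a b x : Plane) : ℝ := Complex.arg (toC (b - x) / toC (a - x))

/-- A nonpositive real quotient means that `a` and `b` are seen from `x` in opposite directions, or
that `x = b`; solving for `x` then exhibits it as a point of the segment. -/
theorem view_mem_slitPlane {a b x : Plane} (hx : x ∉ segment ℝ a b) :
    toC (b - x) / toC (a - x) ∈ Complex.slitPlane := by
  by_contra h
  rw [Complex.mem_slitPlane_iff, not_or, not_lt, not_not] at h
  obtain ⟨hre, him⟩ := h
  set z := toC (b - x) / toC (a - x) with hz
  have hax : toC (a - x) ≠ 0 := by
    rw [Ne, toC_eq_zero, sub_eq_zero]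
    rintro rfl
    exact hx (left_mem_segment _ _ _)
  have hzr : z = (z.re : ℂ) := Complex.ext rfl (by simpa using him)
  have h1 : b - x = z.re • (a - x) := by
    apply toC_injective
    rw [toC_smul, ← hzr, hz, div_mul_cancel₀ _ hax]
  refine hx ⟨-z.re / (1 - z.re), 1 / (1 - z.re), div_nonneg (by linarith) (by linarith),
    div_nonneg zero_le_one (by linarith), ?_, ?_⟩
  · rw [← add_div]; exact (div_eq_one_iff_eq (by linarith)).2 (by ring)
  · have h2 : b = z.re • a + (1 - z.re) • x := by
      have : b = (b - x) + x := by abel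
      rw [this, h1]; module
    have h3 : (1 - z.re) ≠ 0 := by linarith
    rw [h2, smul_add, smul_smul, smul_smul, ← add_assoc, ← add_smul]
    have h4 : -z.re / (1 - z.re) + 1 / (1 - z.re) * z.re = 0 := by ring
    rw [h4, zero_smul, zero_add, one_div, inv_mul_cancel₀ h3, one_smul]

theorem continuousAt_viewAngle {a b x : Plane} (hx : x ∉ segment ℝ a b) :
    ContinuousAt (viewAngle a b) x := by
  have h := Complex.continuousAt_arg (view_mem_slitPlane hx)
  have h2 : ContinuousAt (fun y => toC (b - y) / toC (a - y)) x := by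
    refine ContinuousAt.div ?_ ?_ ?_
    · exact (continuous_toC.comp (continuous_const.sub continuous_id)).continuousAt
    · exact (continuous_toC.comp (continuous_const.sub continuous_id)).continuousAt
    · rw [Ne, toC_eq_zero, sub_eq_zero]
      rintro rfl
      exact hx (left_mem_segment _ _ _)
  exact ContinuousAt.comp (f := fun y => toC (b - y) / toC (a - y)) (x := x) h h2

theorem viewAngle_coe {a b x : Plane} (ha : x ≠ a) (hb : x ≠ b) :
    (viewAngle a b x : Real.Angle) =
      (Complex.arg (toC (b - x)) : Real.Angle) - Complex.arg (toC (a - x)) := by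
  refine Complex.arg_div_coe_angle ?_ ?_
  · rw [Ne, toC_eq_zero, sub_eq_zero]; exact hb.symm
  · rw [Ne, toC_eq_zero, sub_eq_zero]; exact ha.symm

/-- Modulo 2π each view angle is a difference of arguments, and these telescope around the closed
polygon. The sum is 2π times a winding number. -/
theorem sum_viewAngle_mem {q : ℕ → Plane} {N : ℕ} (hq : q N = q 0) {x : Plane}
    (hx : ∀ n < N, x ∉ segment ℝ (q n) (q (n + 1))) :
    ∑ n ∈ Finset.range N, viewAngle (q n) (q (n + 1)) x ∈ AddSubgroup.zmultiples (2 * Real.pi) := by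
  have h1 : ((∑ n ∈ Finset.range N, viewAngle (q n) (q (n + 1)) x : ℝ) : Real.Angle) = 0 := by
    have : ((∑ n ∈ Finset.range N, viewAngle (q n) (q (n + 1)) x : ℝ) : Real.Angle) =
        ∑ n ∈ Finset.range N, ((Complex.arg (toC (q (n + 1) - x)) : Real.Angle) -
          Complex.arg (toC (q n - x))) := by
      rw [← Real.Angle.coe_coeHom, map_sum]
      refine Finset.sum_congr rfl fun n hn => ?_
      have := hx n (Finset.mem_range.1 hn)
      refine viewAngle_coe ?_ ?_
      · rintro rfl; exact this (left_mem_segment _ _ _)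
      · rintro rfl; exact this (right_mem_segment _ _ _)
    rw [this, Finset.sum_range_sub (fun n => (Complex.arg (toC (q n - x)) : Real.Angle)), hq,
      sub_self]
  exact (QuotientAddGroup.eq_zero_iff _).1 h1

/-- A connected set that avoids a closed polygon does not come close to an inner point of an edge
of the polygon on both sides of this edge. -/
theorem not_both_sides {q : ℕ → Plane} {N : ℕ} (hq : q (N + 1) = q 0) {x : Plane}
    (hx : x ∈ openSegment ℝ (q 0) (q 1)) (hne : q 0 ≠ q 1)
    (hxo : ∀ n < N, x ∉ segment ℝ (q (n + 1)) (q (n + 1 + 1))) {S : Set Plane}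
    (hS : IsPreconnected S) (hSq : ∀ y ∈ S, ∀ n < N + 1, y ∉ segment ℝ (q n) (q (n + 1)))
    (h1 : ∃ᶠ t : ℝ in 𝓝[>] 0, x + t • perp (q 1 - q 0) ∈ S)
    (h2 : ∃ᶠ t : ℝ in 𝓝[>] 0, x - t • perp (q 1 - q 0) ∈ S) : False := by
  set f : Plane → ℝ := fun y => ∑ n ∈ Finset.range (N + 1), viewAngle (q n) (q (n + 1)) y with hf
  set g : Plane → ℝ := fun y => ∑ n ∈ Finset.range N, viewAngle (q (n + 1)) (q (n + 1 + 1)) y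
    with hg
  have hfg : ∀ y, f y = g y + viewAngle (q 0) (q 1) y := fun y => by
    simp only [hf, hg, Finset.sum_range_succ' _ N, zero_add]
  -- The winding number is continuous off the polygon with values in a discrete group, hence
  -- constant on a connected set.
  have hconst : ∀ y ∈ S, ∀ z ∈ S, f y = f z := by
    intro y hy z hz
    refine hS.constant_of_mapsTo (T := (AddSubgroup.zmultiples (2 * Real.pi) : Set ℝ)) ?_ ?_ ?_ hy hz
    · rw [isDiscrete_iff_discreteTopology]
      exact inferInstanceAs (DiscreteTopology (AddSubgroup.zmultiples (2 * Real.pi)))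
    · intro w hw
      have : ContinuousAt f w := tendsto_finsetSum _ fun n hn =>
        continuousAt_viewAngle (hSq w hw n (Finset.mem_range.1 hn))
      exact this.continuousWithinAt
    · intro w hw
      exact sum_viewAngle_mem hq (hSq w hw)
  have hgc : ContinuousAt g x := tendsto_finsetSum _ fun n hn =>
    continuousAt_viewAngle (hxo n (Finset.mem_range.1 hn))
  set e := q 1 - q 0 with he
  have he0 : e ≠ 0 := sub_ne_zero.2 hne.symm
  rw [openSegment_eq_image'] at hx
  obtain ⟨s, ⟨hs0, hs1⟩, hxs⟩ := hx
  simp only [← he] at hxs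
  -- In the frame of the edge the quotient is ((t² − s(1 − s)) + it) / (s² + t²): close to the edge
  -- its real part is negative and its imaginary part has the sign of `t`.
  have hview : ∀ t : ℝ, 0 < t ^ 2 → t ^ 2 < s * (1 - s) →
      (toC (q 1 - (x + t • perp e)) / toC (q 0 - (x + t • perp e))).re < 0 ∧
      0 < t * (toC (q 1 - (x + t • perp e)) / toC (q 0 - (x + t • perp e))).im := by
    intro t ht0 ht
    have hz : toC (q 1 - (x + t • perp e)) / toC (q 0 - (x + t • perp e)) =
        ⟨(t ^ 2 - s * (1 - s)) / (s ^ 2 + t ^ 2), t / (s ^ 2 + t ^ 2)⟩ := by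
      have hd : toC (q 0 - (x + t • perp e)) ≠ 0 := by
        rw [Ne, toC_eq_zero]
        intro h
        have h3 : s • e + t • perp e = 0 := by
          rw [← neg_eq_zero, ← h, ← hxs]; module
        have h4 : det2 e (s • e + t • perp e) = 0 := by rw [h3]; simp [det2]
        rw [det2_add_right, det2_smul_right, det2_smul_right, det2_self, det2_perp_self, mul_zero,
          zero_add] at h4
        have := norm_pos_iff.2 he0
        rcases mul_eq_zero.1 h4 with h5 | h5
        · rw [h5] at ht0; norm_num at ht0
        · exact absurd h5 (by positivity)
      rw [div_eq_iff hd]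
      have hq1 : q 1 = q 0 + e := by rw [he]; abel
      have hst : s ^ 2 + t ^ 2 ≠ 0 := by positivity
      rw [hq1, ← hxs]
      apply Complex.ext
      · simp [toC]
        field_simp
        ring
      · simp [toC]
        field_simp
        ring
    rw [hz]
    have hst : 0 < s ^ 2 + t ^ 2 := by positivity
    refine ⟨div_neg_of_neg_of_pos (by linarith) hst, ?_⟩
    show 0 < t * (t / (s ^ 2 + t ^ 2))
    rw [← mul_div_assoc, ← sq]
    positivity
  have hss : 0 < s * (1 - s) := mul_pos hs0 (by linarith)
  have hsmall : ∀ σ : ℝ, Tendsto (fun t : ℝ => x + (σ * t) • perp e) (𝓝[>] 0) (𝓝 x) := by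
    intro σ
    have : Tendsto (fun t : ℝ => x + (σ * t) • perp e) (𝓝 0) (𝓝 (x + (σ * 0) • perp e)) :=
      Continuous.tendsto (by fun_prop) 0
    simp only [mul_zero, zero_smul, add_zero] at this
    exact this.mono_left nhdsWithin_le_nhds
  -- The other sides together change by less than π/2 across `x`, which cannot compensate the jump
  -- of more than π in the view angle of the first side.
  have hgs : ∀ σ : ℝ, ∀ᶠ t : ℝ in 𝓝[>] 0, |g (x + (σ * t) • perp e) - g x| < Real.pi / 4 := by
    intro σ
    have := (hgc.tendsto.comp (hsmall σ)).eventually (Metric.ball_mem_nhds _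
      (by positivity : 0 < Real.pi / 4))
    filter_upwards [this] with t ht
    rw [← Real.dist_eq]
    exact ht
  have hts : ∀ᶠ t : ℝ in 𝓝[>] 0, 0 < t ∧ t ^ 2 < s * (1 - s) := by
    refine eventually_mem_nhdsWithin.and ?_
    have : Tendsto (fun t : ℝ => t ^ 2) (𝓝[>] 0) (𝓝 0) := by
      have : Tendsto (fun t : ℝ => t ^ 2) (𝓝 0) (𝓝 (0 ^ 2)) := Continuous.tendsto (by fun_prop) 0
      simp only [ne_eq, OfNat.ofNat_ne_zero, not_false_eq_true, zero_pow] at this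
      exact this.mono_left nhdsWithin_le_nhds
    exact this.eventually (gt_mem_nhds hss)
  obtain ⟨t, htS, ht1, htpos, ht2⟩ := (h1.and_eventually ((hgs 1).and hts)).exists
  obtain ⟨u, huS, hu1, hupos, hu2⟩ := (h2.and_eventually ((hgs (-1)).and hts)).exists
  rw [one_mul] at ht1
  have hum : x - u • perp e = x + (-u) • perp e := by module
  rw [neg_one_mul] at hu1
  rw [hum] at huS
  have e1 := hconst _ htS _ huS
  rw [hfg, hfg] at e1
  obtain ⟨r1, i1⟩ := hview t (by positivity) ht2
  obtain ⟨r2, i2⟩ := hview (-u) (by rw [neg_sq]; positivity) (by rw [neg_sq]; exact hu2)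
  have i1' := (mul_pos_iff_of_pos_left htpos).1 i1
  have i2' : (toC (q 1 - (x + (-u) • perp e)) / toC (q 0 - (x + (-u) • perp e))).im < 0 := by
    nlinarith
  have a1 : Real.pi / 2 < viewAngle (q 0) (q 1) (x + t • perp e) := by
    unfold viewAngle
    by_contra h
    rcases Complex.arg_le_pi_div_two_iff.1 (not_lt.1 h) with h | h <;> linarith
  have a2 : viewAngle (q 0) (q 1) (x + (-u) • perp e) < -(Real.pi / 2) := by
    unfold viewAngle
    by_contra h
    rcases Complex.neg_pi_div_two_le_arg_iff.1 (not_lt.1 h) with h | h <;> linarith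
  have b1 := abs_lt.1 ht1
  have b2 := abs_lt.1 hu1
  linarith [Real.pi_pos]

end PeriodicRigidity
end

/-! ### Combinatorics of the faces: boundary cycles, corners, and the bound m ≤ 2n. -/

noncomputable section
namespace PeriodicRigidity
namespace PeriodicFramework

variable {V Γ : Type*} [AddCommGroup Γ] [AddAction Γ V] (F : PeriodicFramework V Γ)

/-! ### Walking around the faces -/

/-- The rotation at the vertices as a permutation of the directed edges. -/
def rotEquiv (hF : F.NonCrossing) : Equiv.Perm F.graph.Dart :=
  Equiv.ofBijective F.rot (F.rot_bijective hF)

/-- The next directed edge on the boundary of the face on the left. -/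
def nxt (hF : F.NonCrossing) : Equiv.Perm F.graph.Dart where
  toFun d := (F.rotEquiv hF).symm d.symm
  invFun d := (F.rot d).symm
  left_inv d := by
    have : F.rot ((F.rotEquiv hF).symm d.symm) = d.symm := (F.rotEquiv hF).apply_symm_apply _
    simp only [this, SimpleGraph.Dart.symm_symm]
  right_inv d := by
    simp only [SimpleGraph.Dart.symm_symm]
    exact (F.rotEquiv hF).symm_apply_apply d

theorem rot_nxt (hF : F.NonCrossing) (d : F.graph.Dart) : F.rot (F.nxt hF d) = d.symm :=
  (F.rotEquiv hF).apply_symm_apply _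

theorem nxt_rot_symm (hF : F.NonCrossing) (d : F.graph.Dart) : F.nxt hF (F.rot d).symm = d :=
  (F.nxt hF).apply_symm_apply d

@[simp] theorem nxt_fst (hF : F.NonCrossing) (d : F.graph.Dart) : (F.nxt hF d).fst = d.snd := by
  rw [← F.rot_fst (F.nxt hF d), F.rot_nxt]; rfl

theorem leftFace_nxt (hF : F.NonCrossing) (d : F.graph.Dart) :
    F.leftFace (F.nxt hF d) = F.leftFace d := by
  rw [← F.leftFace_rot_symm hF, F.rot_nxt, SimpleGraph.Dart.symm_symm]

theorem nxt_vadd (hF : F.NonCrossing) (g : Γ) (d : F.graph.Dart) :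
    F.nxt hF (g +ᵥ d) = g +ᵥ F.nxt hF d := by
  apply F.rot_injective hF
  rw [F.rot_nxt, F.rot_vadd hF, F.rot_nxt, F.vadd_symm]

theorem leftFace_iterate (hF : F.NonCrossing) (d : F.graph.Dart) (n : ℕ) :
    F.leftFace ((F.nxt hF)^[n] d) = F.leftFace d := by
  induction n with
  | zero => rfl
  | succ n ih => rw [Function.iterate_succ_apply', F.leftFace_nxt, ih]

theorem isFace_translate (g : Γ) {U : Set Plane} (hU : F.IsFace U) :
    F.IsFace ((fun x => x + F.period g) '' U) := by
  obtain ⟨x, hx, rfl⟩ := hU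
  refine ⟨x + F.period g, fun h => hx ((F.realization_vadd g).1 h), ?_⟩
  have := (Homeomorph.addRight (F.period g)).image_connectedComponentIn hx
  simp only [Homeomorph.coe_addRight] at this
  rw [this]
  congr 1
  ext y
  constructor
  · rintro ⟨z, hz, rfl⟩ h
    exact hz ((F.realization_vadd g).1 h)
  · intro hy
    exact ⟨y - F.period g, fun h => hy (by simpa using (F.realization_vadd g).2 h), by simp⟩

theorem leftFace_vadd (hF : F.NonCrossing) (g : Γ) (d : F.graph.Dart) :
    F.leftFace (g +ᵥ d) = (fun x => x + F.period g) '' F.leftFace d := by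
  have hx : F.mid d + F.period g ∈ F.oseg (g +ᵥ d) := by
    refine F.mem_oseg_iff.2 ⟨1 / 2, ⟨by norm_num, by norm_num⟩, ?_⟩
    rw [vec_vadd, vadd_fst, F.placement_vadd, mid]; abel
  refine F.leftFace_eq_of_frequently hF hx (F.isFace_translate g (F.isFace_leftFace hF d)) ?_
  refine Filter.Eventually.frequently ?_
  filter_upwards [F.eventually_leftFace hF d (F.mid_mem d)] with t ht
  exact ⟨_, ht, by simp only [vec_vadd]; module⟩

/-- The end of `d` is a corner of the face on the left of `d`. -/
def IsCorner (hF : F.NonCrossing) (d : F.graph.Dart) : Prop :=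
  0 < det2 (F.vec d) (F.vec (F.nxt hF d))

theorem isCorner_iff (hF : F.NonCrossing) (d : F.graph.Dart) :
    F.IsCorner hF d ↔ 0 < det2 (F.vec (F.nxt hF d)) (F.vec (F.rot (F.nxt hF d))) := by
  rw [IsCorner, F.rot_nxt, vec_symm, det2_neg_right, det2_swap]

variable {F}

/-- The walk around the face on the left of a directed edge. -/
structure FaceCycle (hF : F.NonCrossing) (d : F.graph.Dart) (k : ℕ) : Prop where
  three_le : 3 ≤ k
  closed : (F.nxt hF)^[k] d = d
  fst_inj : ∀ i < k, ∀ j < k, ((F.nxt hF)^[i] d).fst = ((F.nxt hF)^[j] d).fst → i = j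
  exists_index : ∀ d', F.leftFace d' = F.leftFace d → ∃ i < k, d' = (F.nxt hF)^[i] d

theorem IsBoundaryPolygon.leftFace_eq (hF : F.NonCrossing) {U : Set Plane} (hU : F.IsFace U)
    {k : ℕ} {c : ZMod k → V} (hc : F.IsBoundaryPolygon U k c) (l : ZMod k) :
    F.leftFace ⟨(c l, c (l + 1)), hc.adj l⟩ = U := by
  set d : F.graph.Dart := ⟨(c l, c (l + 1)), hc.adj l⟩
  exact F.leftFace_eq_of_frequently hF (F.mid_mem d) hU (hc.left l _ (F.mid_mem d)).frequently

/-- The midpoint of the edge lies on the frontier, so the edge is a side of the polygon up to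
direction. The wrong direction would put the connected face on both sides of a side of a closed
polygon. -/
theorem IsBoundaryPolygon.eq_of_leftFace (hF : F.NonCrossing) {U : Set Plane} (hU : F.IsFace U)
    {k : ℕ} {c : ZMod k → V} (hc : F.IsBoundaryPolygon U k c) {d : F.graph.Dart}
    (hd : F.leftFace d = U) : ∃ l, d = ⟨(c l, c (l + 1)), hc.adj l⟩ := by
  have h3 := hc.three_le
  let cd : ZMod k → F.graph.Dart := fun l => ⟨(c l, c (l + 1)), hc.adj l⟩
  have hm := F.oseg_subset_frontier hF d (F.mid_mem d)
  rw [hd, hc.frontier_eq] at hm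
  obtain ⟨l, hl⟩ := mem_iUnion.1 hm
  have hedge := hF.edge_eq_of_mem_oseg (d' := cd l) (F.mid_mem d) hl
  rcases SimpleGraph.dart_edge_eq_iff _ _ |>.1 hedge with h | h
  · exact ⟨l, h.symm⟩
  exfalso
  have hds : d = (cd l).symm := by rw [h, SimpleGraph.Dart.symm_symm]
  let q : ℕ → Plane := fun n => F.placement (c (l + n))
  obtain ⟨N, rfl⟩ : ∃ N, k = N + 1 := ⟨k - 1, by omega⟩
  have hq0 : q 0 = F.placement (c l) := by simp [q]
  have hq1 : q 1 = F.placement (c (l + 1)) := by simp [q]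
  have hx : F.mid (cd l) ∈ F.oseg (cd l) := F.mid_mem _
  have hseg : ∀ n : ℕ, segment ℝ (q n) (q (n + 1)) = F.seg (cd (l + n)) := by
    intro n
    simp [q, seg, cd, add_assoc]
  refine not_both_sides (q := q) (N := N) ?_ (x := F.mid (cd l)) ?_ ?_ ?_ hU.isPreconnected ?_ ?_ ?_
  · simp only [q]
    congr 2
    have : ((N + 1 : ℕ) : ZMod (N + 1)) = 0 := ZMod.natCast_self _
    rw [this]; simp
  · rw [hq0, hq1]; exact hx
  · rw [hq0, hq1]; exact F.placement_ne _ _ (hc.adj l)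
  · intro n hn hmem
    rw [hseg] at hmem
    have he := hF.edge_eq_of_mem_oseg hx hmem
    -- A later side could coincide with the given one in the same direction only if 0 < n + 1 < k
    -- vanished modulo k, and in reverse only if 2 did; at least three vertices exclude both.
    have hcast : ∀ j : ℕ, 0 < j → j < N + 1 → (j : ZMod (N + 1)) ≠ 0 := by
      intro j hj0 hj h
      rw [ZMod.natCast_eq_zero_iff] at h
      exact absurd (Nat.le_of_dvd hj0 h) (by omega)
    rcases SimpleGraph.dart_edge_eq_iff _ _ |>.1 he with h | h
    · have h1 : c (l + (n + 1 : ℕ)) = c l := congrArg (fun d => d.fst) h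
      have h2 := hc.injective h1
      exact hcast (n + 1) (by omega) (by omega) (by simpa using h2)
    · have h1 : c (l + (n + 1 : ℕ)) = c (l + 1) := congrArg (fun d => d.fst) h
      have h2 : c (l + (n + 1 : ℕ) + 1) = c l := congrArg (fun d => d.snd) h
      have h3' := hc.injective h1
      have h4 := hc.injective h2
      rw [h3', add_assoc] at h4
      have h5 : ((2 : ℕ) : ZMod (N + 1)) = 0 := by
        have : (1 : ZMod (N + 1)) + 1 = 0 := by simpa using h4
        push_cast
        rw [← this]; norm_num
      exact hcast 2 (by omega) (by omega) h5
  · intro y hy n _ hmem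
    rw [hseg] at hmem
    exact hU.subset hy (F.seg_subset_realization _ hmem)
  · rw [hq0, hq1]
    exact (hc.left l _ hx).frequently
  · rw [hq0, hq1]
    refine Filter.Eventually.frequently ?_
    have hx' : F.mid (cd l) ∈ F.oseg (cd l).symm := by rw [F.oseg_symm]; exact hx
    have := F.eventually_leftFace hF _ hx'
    rw [← hds, hd, hds] at this
    filter_upwards [this] with t ht
    rw [vec_symm, perp_neg, smul_neg, ← sub_eq_add_neg] at ht
    exact ht

/-- The successor has the same face on its left, hence is a side; as the vertices of the polygon are
distinct, its starting point determines which one. -/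
theorem IsBoundaryPolygon.nxt_eq (hF : F.NonCrossing) {U : Set Plane} (hU : F.IsFace U)
    {k : ℕ} {c : ZMod k → V} (hc : F.IsBoundaryPolygon U k c) (l : ZMod k) :
    F.nxt hF ⟨(c l, c (l + 1)), hc.adj l⟩ = ⟨(c (l + 1), c (l + 1 + 1)), hc.adj (l + 1)⟩ := by
  have h1 := hc.leftFace_eq hF hU l
  rw [← F.leftFace_nxt hF] at h1
  obtain ⟨l', hl'⟩ := hc.eq_of_leftFace hF hU h1
  have h2 := F.nxt_fst hF ⟨(c l, c (l + 1)), hc.adj l⟩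
  rw [hl'] at h2 ⊢
  have h3 : l' = l + 1 := hc.injective h2
  subst h3; rfl

open Classical in
-- The walk `nxt` follows the boundary polygon of the face, so the topological definition of
-- pseudo-triangle becomes a statement about one finite cycle of directed edges.
theorem IsPseudoTriangulation.exists_faceCycle (hP : F.IsPseudoTriangulation) (d : F.graph.Dart) :
    ∃ k, FaceCycle hP.nonCrossing d k ∧
      ((Finset.range k).filter
        fun i => F.IsCorner hP.nonCrossing ((F.nxt hP.nonCrossing)^[i] d)).card = 3 := by
  have hF := hP.nonCrossing
  have hU := F.isFace_leftFace hF d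
  obtain ⟨k, c, hc, hcor⟩ := hP.pseudoTriangle _ hU
  have h3 := hc.three_le
  have : NeZero k := ⟨by omega⟩
  let cd : ZMod k → F.graph.Dart := fun l => ⟨(c l, c (l + 1)), hc.adj l⟩
  have hnxt : ∀ l, F.nxt hF (cd l) = cd (l + 1) := hc.nxt_eq hF hU
  obtain ⟨l₀, hl₀⟩ : ∃ l, d = cd l := hc.eq_of_leftFace hF hU rfl
  have hit : ∀ n : ℕ, (F.nxt hF)^[n] d = cd (l₀ + n) := by
    intro n
    induction n with
    | zero => simp [hl₀]
    | succ n ih => rw [Function.iterate_succ_apply', ih, hnxt, add_assoc]; push_cast; rfl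
  have hinj : ∀ i < k, ∀ j < k, (i : ZMod k) = j → i = j := by
    intro i hi j hj h
    have := congrArg ZMod.val h
    rwa [ZMod.val_cast_of_lt hi, ZMod.val_cast_of_lt hj] at this
  refine ⟨k, ⟨h3, ?_, ?_, ?_⟩, ?_⟩
  · rw [hit, ZMod.natCast_self, add_zero, hl₀]
  · intro i hi j hj h
    rw [hit, hit] at h
    exact hinj i hi j hj (add_left_cancel (hc.injective h))
  · intro d' hd'
    obtain ⟨l, hl⟩ := hc.eq_of_leftFace hF hU hd'
    refine ⟨(l - l₀).val, ZMod.val_lt _, ?_⟩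
    rw [hit, ZMod.natCast_zmod_val, add_sub_cancel]
    exact hl
  -- The shift by one: the polygon records a turn at its vertex, the walk at the edge that arrives
  -- there.
  · rw [← hcor, Set.ncard_eq_toFinset_card', ← Finset.card_image_of_injOn
      (f := fun n : ℕ => l₀ + n + 1)]
    · congr 1
      ext l
      rw [Set.mem_toFinset]
      simp only [Finset.mem_image, Finset.mem_filter, Finset.mem_range, corners, Set.mem_ofPred_eq]
      have hcorner : ∀ n : ℕ, F.IsCorner hF ((F.nxt hF)^[n] d) ↔
          0 < det2 (F.vec (cd (l₀ + n))) (F.vec (cd (l₀ + n + 1))) := by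
        intro n; rw [IsCorner, hit, hnxt]
      constructor
      · rintro ⟨n, ⟨_, h⟩, rfl⟩
        rw [hcorner] at h
        simpa [vec, cd] using h
      · intro h
        refine ⟨(l - 1 - l₀).val, ⟨ZMod.val_lt _, ?_⟩, ?_⟩
        · rw [hcorner, ZMod.natCast_zmod_val]
          simpa [vec, cd] using h
        · rw [ZMod.natCast_zmod_val]; ring
    · intro i hi j hj h
      simp only [Finset.coe_filter, Finset.mem_range, Set.mem_ofPred_eq] at hi hj
      exact hinj i hi.1 j hj.1 (by simpa using h)

theorem FaceCycle.iterate_inj {hF : F.NonCrossing} {d : F.graph.Dart} {k : ℕ}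
    (h : FaceCycle hF d k) {i j : ℕ} (hi : i < k) (hj : j < k)
    (hij : (F.nxt hF)^[i] d = (F.nxt hF)^[j] d) : i = j := h.fst_inj i hi j hj (by rw [hij])

namespace IsPseudoTriangulation

/-- Otherwise the multiples of `g` would carry `d` to infinitely many edges of one finite boundary
cycle. -/
theorem eq_zero_of_leftFace_vadd (hP : F.IsPseudoTriangulation) {d : F.graph.Dart} {g : Γ}
    (h : F.leftFace (g +ᵥ d) = F.leftFace d) : g = 0 := by
  by_contra hg
  have hF := hP.nonCrossing
  obtain ⟨k, hk, -⟩ := hP.exists_faceCycle d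
  have h1 : ∀ n : ℕ, F.leftFace ((n • g) +ᵥ d) = F.leftFace d := by
    intro n
    induction n with
    | zero => rw [zero_smul, zero_vadd]
    | succ n ih =>
      rw [succ_nsmul, add_vadd, F.leftFace_vadd hF, h, ← F.leftFace_vadd hF, ih]
  have h2 : ∀ n : ℕ, ∃ i < k, (n • g) +ᵥ d = (F.nxt hF)^[i] d := fun n => hk.exists_index _ (h1 n)
  choose f hf hfe using h2
  have hinj : Function.Injective fun n => (⟨f n, hf n⟩ : Fin k) := by
    intro n m hnm
    have h3 : f n = f m := congrArg Fin.val hnm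
    have h4 : (n • g) +ᵥ d = (m • g) +ᵥ d := by rw [hfe, hfe, h3]
    have h5 : (n • g) +ᵥ d.fst = (m • g) +ᵥ d.fst := congrArg (fun d => d.fst) h4
    exact F.nsmul_injective hg (F.vadd_left_injective h5)
  exact not_injective_infinite_finite _ hinj

theorem isPreconnected_compl_closedBall (R : ℝ) (hR : 0 ≤ R) :
    IsPreconnected {x : Plane | R < ‖x‖} := by
  let e : Plane := !₂[1, 0]
  have he : ‖e‖ = 1 := by
    rw [← sq_eq_sq₀ (norm_nonneg _) zero_le_one, normSq_eq]; simp [e]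
  have he0 : e ≠ 0 := by rw [← norm_pos_iff, he]; exact one_pos
  have h : {x : Plane | R < ‖x‖} =
      (fun p : ℝ × ℝ => p.1 • rotv p.2 e) '' (Set.Ioi R ×ˢ Set.univ) := by
    ext x
    constructor
    · intro hx
      have hx' : R < ‖x‖ := hx
      have hx0 : x ≠ 0 := norm_pos_iff.1 (hR.trans_lt hx')
      obtain ⟨r, hr, h⟩ := ang_spec he0 hx0
      have : ‖x‖ = r := by
        conv_lhs => rw [h, norm_smul, norm_rotv, he, mul_one, Real.norm_of_nonneg hr.le]
      exact ⟨(r, ang e x), ⟨by rw [← this]; exact hx, trivial⟩, h.symm⟩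
    · rintro ⟨⟨r, φ⟩, ⟨hr, -⟩, rfl⟩
      have hr' : R < r := hr
      show R < ‖r • rotv φ e‖
      rw [norm_smul, norm_rotv, he, mul_one, Real.norm_of_nonneg (hR.trans hr'.le)]
      exact hr'
  rw [h]
  refine (isPreconnected_Ioi.prod isPreconnected_univ).image _ ?_
  exact (continuous_fst.smul ((continuous_rotv e).comp continuous_snd)).continuousOn

/-- The frontier is a finite union of segments. An unbounded face would contain the exterior of a
disc, hence meet and equal its translates, which only the zero period allows. -/
theorem isBounded_leftFace (hP : F.IsPseudoTriangulation) (d : F.graph.Dart) : Bornology.IsBounded (F.leftFace d) := by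
  have hF := hP.nonCrossing
  obtain ⟨k, hk, -⟩ := hP.exists_faceCycle d
  have hU := F.isFace_leftFace hF d
  have hfr : Bornology.IsBounded (frontier (F.leftFace d)) := by
    have : frontier (F.leftFace d) ⊆ ⋃ i ∈ Finset.range k, F.seg ((F.nxt hF)^[i] d) := by
      intro x hx
      obtain ⟨d', hd', hxd⟩ := F.exists_dart_of_mem_frontier hF hU hx
      obtain ⟨i, hi, rfl⟩ := hk.exists_index d' hd'
      exact mem_biUnion (Finset.mem_coe.2 (Finset.mem_range.2 hi)) hxd
    refine Bornology.IsBounded.subset ?_ this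
    refine (Bornology.isBounded_biUnion_finset _).2 fun i _ => ?_
    unfold seg
    rw [segment_eq_image_lineMap]
    exact (isCompact_Icc.image (AffineMap.lineMap_continuous)).isBounded
  obtain ⟨R, hR⟩ := hfr.exists_norm_le
  by_contra hb
  have houter : ∀ S > max R 0, {x : Plane | S < ‖x‖} ⊆ F.leftFace d := by
    intro S hS
    by_contra hsub
    obtain ⟨y, hy, hyU⟩ := not_subset.1 hsub
    have : ∃ x ∈ F.leftFace d, S < ‖x‖ := by
      by_contra hcon
      push Not at hcon
      exact hb (isBounded_iff_forall_norm_le.2 ⟨S, hcon⟩)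
    obtain ⟨x, hxU, hx⟩ := this
    have hS0 : 0 ≤ S := (le_max_right _ _).trans hS.le
    have hnf : ∀ z, S < ‖z‖ → z ∉ frontier (F.leftFace d) := fun z hz hzf => by
      linarith [hR z hzf, le_max_left R 0]
    obtain ⟨z, -, hz1, hz2⟩ := isPreconnected_compl_closedBall S hS0 _ _ hU.isOpen
      isClosed_closure.isOpen_compl (fun z hz => by
        by_cases h : z ∈ closure (F.leftFace d)
        · left
          by_contra h'
          exact hnf z hz ⟨h, by rwa [hU.isOpen.interior_eq]⟩
        · exact Or.inr h) ⟨x, hx, hxU⟩ ⟨y, hy, fun h => hnf y hy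
          ⟨h, by rwa [hU.isOpen.interior_eq]⟩⟩
    exact hz2 (subset_closure hz1)
  obtain ⟨g, hg⟩ := F.exists_ne_zero
  apply hg
  apply hP.eq_zero_of_leftFace_vadd (d := d)
  set S := max R 0 + 1
  have hSp : 0 < S := by positivity
  have hS := houter S (by simp [S])
  -- Far enough out that the point and its translate back by the period both lie in the exterior
  -- region.
  obtain ⟨x, hx⟩ : ∃ x : Plane, S + ‖F.period g‖ < ‖x‖ := by
    refine ⟨((S + ‖F.period g‖ + 1) / ‖F.period g‖) • F.period g, ?_⟩
    have hp := norm_pos_iff.2 (F.period_ne_zero hg)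
    rw [norm_smul, Real.norm_of_nonneg (by positivity), div_mul_cancel₀ _ hp.ne']
    linarith
  have h1 : x ∈ F.leftFace d := hS (by show S < ‖x‖; linarith [norm_nonneg (F.period g)])
  have h2 : x ∈ F.leftFace (g +ᵥ d) := by
    rw [F.leftFace_vadd hF]
    refine ⟨x - F.period g, hS ?_, by simp⟩
    show S < ‖x - F.period g‖
    linarith [norm_sub_norm_le x (F.period g)]
  exact (F.isFace_leftFace hF _).eq_of_mem hU h2 h1

/-! ### Pointed vertices -/

/-- At a vertex of degree one the walk would turn back and revisit a vertex after two steps, while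
boundary cycles have at least three distinct vertices. -/
theorem rot_ne (hP : F.IsPseudoTriangulation) (d : F.graph.Dart) : F.rot d ≠ d := by
  intro h
  have hF := hP.nonCrossing
  have h1 : F.nxt hF d.symm = d := by
    have := F.nxt_rot_symm hF d
    rwa [h] at this
  obtain ⟨k, hk, -⟩ := hP.exists_faceCycle d.symm
  have h3 := hk.three_le
  have := hk.fst_inj 2 (by omega) 0 (by omega) (by
    show (F.nxt hF (F.nxt hF d.symm)).fst = d.symm.fst
    rw [h1, F.nxt_fst]; rfl)
  omega

/-- There is exactly one reflex angle at every vertex. -/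
theorem existsUnique_reflex (hP : F.IsPseudoTriangulation) (v : V) : ∃ d : F.graph.Dart, d.fst = v ∧
    det2 (F.vec d) (F.vec (F.rot d)) < 0 ∧
    ∀ d' : F.graph.Dart, d'.fst = v → d' ≠ d → 0 < det2 (F.vec d') (F.vec (F.rot d')) := by
  have hF := hP.nonCrossing
  obtain ⟨w, hw⟩ := hP.pointed v
  have hw' : ∀ d : F.graph.Dart, d.fst = v → 0 < inner ℝ w (F.vec d) := by
    rintro d rfl; exact hw _ d.adj
  obtain ⟨u, hu⟩ := F.exists_adj v
  have hw0 : w ≠ 0 := by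
    rintro rfl
    have := hw u hu
    simp at this
  have hwn := norm_pos_iff.2 hw0
  -- The tangent of the angle with the pointing direction orders the edges at `v`; the reflex angle
  -- follows the last of them.
  let s : F.graph.Dart → ℝ := fun d => det2 w (F.vec d) / inner ℝ w (F.vec d)
  have hs : ∀ d d' : F.graph.Dart, d.fst = v → d'.fst = v →
      (0 < det2 (F.vec d) (F.vec d') ↔ s d < s d') := by
    intro d d' hd hd'
    have h1 := hw' d hd
    have h2 := hw' d' hd'
    have h3 : inner ℝ w (F.vec d) * det2 w (F.vec d') - det2 w (F.vec d) * inner ℝ w (F.vec d') =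
        ‖w‖ ^ 2 * det2 (F.vec d) (F.vec d') := by
      rw [normSq_eq, inner_eq, inner_eq]; simp only [det2]; ring
    simp only [s]
    rw [div_lt_div_iff₀ h1 h2, ← mul_pos_iff_of_pos_left (by positivity : 0 < ‖w‖ ^ 2), ← h3]
    constructor <;> intro h <;> linarith
  have heq : ∀ d d' : F.graph.Dart, d.fst = v → d'.fst = v →
      det2 (F.vec d) (F.vec d') = 0 → d = d' := by
    intro d d' hd hd' h
    obtain ⟨r, hr⟩ := exists_smul_of_det2_eq_zero (F.vec_ne_zero d) h
    have h2 := hw' d' hd'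
    rw [hr, inner_smul_right] at h2
    exact hF.eq_of_parallel (hd.trans hd'.symm) (pos_of_mul_pos_left h2 (hw' d hd).le) hr
  obtain ⟨d, hd, hmax⟩ := Set.exists_max_image _ s (F.finite_outDarts v) ⟨⟨(v, u), hu⟩, rfl⟩
  have hd' : d.fst = v := hd
  refine ⟨d, hd', ?_, ?_⟩
  · rcases lt_trichotomy (det2 (F.vec d) (F.vec (F.rot d))) 0 with h | h | h
    · exact h
    · exact absurd (heq _ _ hd' ((F.rot_fst d).trans hd') h).symm (hP.rot_ne d)
    · have h1 := (hs _ _ hd' ((F.rot_fst d).trans hd')).1 h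
      exact absurd (hmax _ ((F.rot_fst d).trans hd')) (not_le.2 h1)
  · intro d' hd'' hne
    have hfst : d.fst = d'.fst := hd'.trans hd''.symm
    refine F.det2_rot_pos hfst ?_
    rcases lt_trichotomy (det2 (F.vec d') (F.vec d)) 0 with h | h | h
    · rw [det2_swap, neg_lt_zero, hs _ _ hd' hd''] at h
      exact absurd (hmax _ hd'') (not_le.2 h)
    · exact absurd (heq _ _ hd'' hd' h) hne
    · exact h

end IsPseudoTriangulation

end PeriodicFramework
end PeriodicRigidity
end

noncomputable section
namespace PeriodicRigidity

/-! ### Functions on a finite set with a permutation -/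

section Permutation

variable {D : Type*} (ν : Equiv.Perm D)

/-- The cycles of a permutation, including the trivial ones. -/
abbrev Cycle : Type _ := Quotient (Equiv.Perm.SameCycle.setoid ν)

/-- The cycle of an element. -/
def cycleMk (δ : D) : Cycle ν := Quotient.mk _ δ

theorem cycleMk_eq {δ δ' : D} : cycleMk ν δ = cycleMk ν δ' ↔ ν.SameCycle δ δ' := Quotient.eq

@[simp] theorem cycleMk_apply (δ : D) : cycleMk ν (ν δ) = cycleMk ν δ :=
  (cycleMk_eq ν).2 (Equiv.Perm.SameCycle.refl ν δ).apply_left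

theorem cycleMk_surj (o : Cycle ν) : ∃ δ, cycleMk ν δ = o := Quotient.exists_rep o

theorem eq_comp_cycleMk {E : Type*} {f : D → E} (h : ∀ δ, f (ν δ) = f δ) :
    ∃ c : Cycle ν → E, ∀ δ, f δ = c (cycleMk ν δ) := by
  refine ⟨Quotient.lift f ?_, fun δ => rfl⟩
  rintro δ δ' ⟨i, rfl⟩
  have h' : ∀ δ, f (ν⁻¹ δ) = f δ := fun δ => by rw [← h (ν⁻¹ δ)]; simp
  symm
  induction i using Int.induction_on with
  | zero => rfl
  | succ i ih => rw [add_comm, zpow_add, Equiv.Perm.mul_apply, zpow_one, h, ih]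
  | pred i ih => rw [sub_eq_neg_add, zpow_add, Equiv.Perm.mul_apply, zpow_neg_one, h', ih]

variable [Fintype D]

instance : Finite (Cycle ν) := Finite.of_surjective _ (cycleMk_surj ν)
instance : Fintype (Cycle ν) := Fintype.ofFinite _

open Classical in
/-- The sums of a function over the cycles of a permutation. -/
def cycleSum : (D → ℝ) →ₗ[ℝ] (Cycle ν → ℝ) where
  toFun f o := ∑ δ with cycleMk ν δ = o, f δ
  map_add' f g := by ext o; simp [Finset.sum_add_distrib]
  map_smul' r f := by ext o; simp [Finset.mul_sum]

open Classical in
theorem cycleSum_apply (f : D → ℝ) (o : Cycle ν) :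
    cycleSum ν f o = ∑ δ with cycleMk ν δ = o, f δ := rfl

theorem sum_cycleSum (f : D → ℝ) : ∑ o, cycleSum ν f o = ∑ δ, f δ := by
  classical
  simp only [cycleSum_apply]
  exact Finset.sum_fiberwise _ _ _

theorem cycleSum_comp (f : D → ℝ) : cycleSum ν (fun δ => f (ν δ)) = cycleSum ν f := by
  classical
  ext o
  simp only [cycleSum_apply, Finset.sum_filter]
  rw [← Equiv.sum_comp ν (fun δ => if cycleMk ν δ = o then f δ else 0)]
  simp

theorem cycleSum_surjective : Function.Surjective (cycleSum ν) := by
  classical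
  intro c
  refine ⟨fun δ => if δ = (cycleMk_surj ν (cycleMk ν δ)).choose then c (cycleMk ν δ) else 0, ?_⟩
  ext o
  rw [cycleSum_apply, Finset.sum_eq_single (cycleMk_surj ν o).choose]
  · have h := (cycleMk_surj ν o).choose_spec
    rw [h, if_pos rfl]
  · intro δ hδ hne
    rw [(Finset.mem_filter.1 hδ).2, if_neg hne]
  · intro h
    exact absurd (Finset.mem_filter.2 ⟨Finset.mem_univ (cycleMk_surj ν o).choose,
      (cycleMk_surj ν o).choose_spec⟩) h

theorem finrank_ker_cycleSum :
    Module.finrank ℝ (LinearMap.ker (cycleSum ν)) + Fintype.card (Cycle ν) = Fintype.card D := by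
  have := LinearMap.finrank_range_add_finrank_ker (cycleSum ν)
  rw [LinearMap.range_eq_top.2 (cycleSum_surjective ν), finrank_top] at this
  simp only [Module.finrank_fintype_fun_eq_card] at this
  omega

/-- By dimensions: the difference operator maps into the kernel of `cycleSum`, and its own kernel,
the functions constant on cycles, is small enough for it to fill that kernel. -/
theorem exists_sub_eq {f : D → ℝ} (hf : cycleSum ν f = 0) : ∃ h : D → ℝ, ∀ δ, h (ν δ) - h δ = f δ := by
  let T : (D → ℝ) →ₗ[ℝ] (D → ℝ) :=
    { toFun := fun h δ => h (ν δ) - h δ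
      map_add' := fun a b => by ext δ; simp only [Pi.add_apply]; ring
      map_smul' := fun r a => by ext δ; simp only [Pi.smul_apply, smul_eq_mul, RingHom.id_apply]; ring }
  have hle : LinearMap.range T ≤ LinearMap.ker (cycleSum ν) := by
    rintro _ ⟨h, rfl⟩
    have : T h = (fun δ => h (ν δ)) - h := rfl
    rw [LinearMap.mem_ker, this, map_sub, cycleSum_comp, sub_self]
  have hker : Module.finrank ℝ (LinearMap.ker T) ≤ Fintype.card (Cycle ν) := by
    let L : (Cycle ν → ℝ) →ₗ[ℝ] (D → ℝ) := LinearMap.funLeft ℝ ℝ (cycleMk ν)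
    have h1 : LinearMap.ker T ≤ LinearMap.range L := by
      intro h hh
      obtain ⟨c, hc⟩ := eq_comp_cycleMk ν (f := h) (fun δ => sub_eq_zero.1 (congrFun hh δ))
      exact ⟨c, funext fun δ => (hc δ).symm⟩
    refine (Submodule.finrank_mono h1).trans ((LinearMap.finrank_range_le L).trans ?_)
    simp
  have h1 := LinearMap.finrank_range_add_finrank_ker T
  have h2 := finrank_ker_cycleSum ν
  simp only [Module.finrank_fintype_fun_eq_card] at h1
  have h3 : LinearMap.range T = LinearMap.ker (cycleSum ν) :=
    Submodule.eq_of_le_of_finrank_le hle (by omega)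
  obtain ⟨h, hh⟩ : f ∈ LinearMap.range T := by rw [h3]; exact hf
  exact ⟨h, fun δ => congrFun hh δ⟩

end Permutation

namespace PeriodicFramework

variable {V Γ : Type*} [AddCommGroup Γ] [AddAction Γ V] (F : PeriodicFramework V Γ)

/-! ### The quotient of a periodic framework -/

/-- The orbit of a vertex. -/
def vmk (_F : PeriodicFramework V Γ) (v : V) : VertexOrbit Γ V := Quotient.mk _ v

theorem vmk_eq {v v' : V} : F.vmk v = F.vmk v' ↔ ∃ g : Γ, g +ᵥ v' = v := by
  unfold vmk
  rw [Quotient.eq]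
  exact AddAction.orbitRel_apply

theorem vmk_vadd (g : Γ) (v : V) : F.vmk (g +ᵥ v) = F.vmk v := F.vmk_eq.2 ⟨g, rfl⟩

theorem vmk_surj (q : VertexOrbit Γ V) : ∃ v, F.vmk v = q := Quotient.exists_rep q

/-- An invariant function of directed edges, as a function of their orbits. -/
def liftDart {E : Type*} (f : F.graph.Dart → E) (hf : ∀ (g : Γ) d, f (g +ᵥ d) = f d) :
    F.DartOrbit → E :=
  Quotient.lift f (by rintro _ d ⟨g, rfl⟩; exact hf g d)

@[simp] theorem liftDart_mk {E : Type*} (f : F.graph.Dart → E)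
    (hf : ∀ (g : Γ) d, f (g +ᵥ d) = f d) (d : F.graph.Dart) :
    F.liftDart f hf (F.dmk d) = f d := rfl

/-- The initial vertex of an orbit of directed edges. -/
def srcO : F.DartOrbit → VertexOrbit Γ V :=
  F.liftDart (fun d => F.vmk d.fst) fun g d => F.vmk_vadd g d.fst

/-- The vector of an orbit of directed edges. -/
def vecO : F.DartOrbit → Plane := F.liftDart F.vec fun _ _ => F.vec_vadd _ _

/-- The reversal of orbits of directed edges. -/
def revO : F.DartOrbit → F.DartOrbit :=
  F.liftDart (fun d => F.dmk d.symm) fun g d => F.dmk_vadd g d.symm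

@[simp] theorem srcO_mk (d : F.graph.Dart) : F.srcO (F.dmk d) = F.vmk d.fst := rfl
@[simp] theorem vecO_mk (d : F.graph.Dart) : F.vecO (F.dmk d) = F.vec d := rfl
@[simp] theorem revO_mk (d : F.graph.Dart) : F.revO (F.dmk d) = F.dmk d.symm := rfl

@[simp] theorem revO_revO (δ : F.DartOrbit) : F.revO (F.revO δ) = δ := by
  obtain ⟨d, rfl⟩ := F.dmk_surj δ
  simp

@[simp] theorem vecO_revO (δ : F.DartOrbit) : F.vecO (F.revO δ) = -F.vecO δ := by
  obtain ⟨d, rfl⟩ := F.dmk_surj δ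
  simp

theorem vecO_ne_zero (δ : F.DartOrbit) : F.vecO δ ≠ 0 := by
  obtain ⟨d, rfl⟩ := F.dmk_surj δ
  exact F.vec_ne_zero d

theorem sum_revO {E : Type*} [AddCommMonoid E] (f : F.DartOrbit → E) :
    ∑ δ, f (F.revO δ) = ∑ δ, f δ :=
  Equiv.sum_comp (⟨F.revO, F.revO, F.revO_revO, F.revO_revO⟩ : Equiv.Perm F.DartOrbit) f

/-- The walk around the faces of the quotient. -/
def nxtO (hF : F.NonCrossing) : Equiv.Perm F.DartOrbit where
  toFun := F.liftDart (fun d => F.dmk (F.nxt hF d))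
    fun g d => by rw [F.nxt_vadd, F.dmk_vadd]
  invFun := F.liftDart (fun d => F.dmk ((F.nxt hF).symm d)) fun g d => by
    rw [← F.dmk_vadd g ((F.nxt hF).symm d)]
    congr 1
    rw [Equiv.symm_apply_eq, F.nxt_vadd, Equiv.apply_symm_apply]
  left_inv δ := by
    obtain ⟨d, rfl⟩ := F.dmk_surj δ
    simp
  right_inv δ := by
    obtain ⟨d, rfl⟩ := F.dmk_surj δ
    simp

@[simp] theorem nxtO_mk (hF : F.NonCrossing) (d : F.graph.Dart) :
    F.nxtO hF (F.dmk d) = F.dmk (F.nxt hF d) := rfl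

theorem nxtO_iterate_mk (hF : F.NonCrossing) (n : ℕ) (d : F.graph.Dart) :
    (F.nxtO hF)^[n] (F.dmk d) = F.dmk ((F.nxt hF)^[n] d) := by
  induction n with
  | zero => rfl
  | succ n ih => rw [Function.iterate_succ_apply', ih, nxtO_mk, Function.iterate_succ_apply']

@[simp] theorem srcO_nxtO (hF : F.NonCrossing) (δ : F.DartOrbit) :
    F.srcO (F.nxtO hF δ) = F.srcO (F.revO δ) := by
  obtain ⟨d, rfl⟩ := F.dmk_surj δ
  simp [SimpleGraph.Dart.symm_toProd]

/-- The orbits of faces, as cycles of orbits of directed edges. -/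
abbrev FaceOrbit (hF : F.NonCrossing) : Type _ := Cycle (F.nxtO hF)

theorem sameCycle_iff (hF : F.NonCrossing) {δ δ' : F.DartOrbit} :
    (F.nxtO hF).SameCycle δ δ' ↔ ∃ n : ℕ, (F.nxtO hF)^[n] δ = δ' := by
  constructor
  · intro h
    obtain ⟨n, -, hn⟩ := h.exists_pow_eq' 
    exact ⟨n, by rw [← hn, Equiv.Perm.iterate_eq_pow]⟩
  · rintro ⟨n, rfl⟩
    exact ⟨n, by rw [Equiv.Perm.iterate_eq_pow, zpow_natCast]⟩

variable {F}

theorem FaceCycle.iterate_mod {hF : F.NonCrossing} {d : F.graph.Dart} {k : ℕ}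
    (h : FaceCycle hF d k) (n : ℕ) : (F.nxt hF)^[n % k] d = (F.nxt hF)^[n] d :=
  Function.IsPeriodicPt.iterate_mod_apply h.closed n

namespace IsPseudoTriangulation

/-- No nonzero period preserves a face, so a boundary cycle does not shrink in the quotient and sums
over it may be computed upstairs. -/
theorem dmk_iterate_inj (hP : F.IsPseudoTriangulation) {d : F.graph.Dart} {k : ℕ}
    (h : FaceCycle hP.nonCrossing d k) {i j : ℕ} (hi : i < k) (hj : j < k)
    (hij : F.dmk ((F.nxt hP.nonCrossing)^[i] d) = F.dmk ((F.nxt hP.nonCrossing)^[j] d)) :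
    i = j := by
  obtain ⟨g, hg⟩ := F.dmk_eq.1 hij
  have hF := hP.nonCrossing
  have hg0 : g = 0 := by
    apply hP.eq_zero_of_leftFace_vadd (d := (F.nxt hF)^[j] d)
    rw [hg, F.leftFace_iterate, F.leftFace_iterate]
  rw [hg0, zero_vadd] at hg
  exact h.iterate_inj hi hj hg.symm

open Classical in
theorem filter_cycleMk (hP : F.IsPseudoTriangulation) {d : F.graph.Dart} {k : ℕ}
    (h : FaceCycle hP.nonCrossing d k) :
    (Finset.univ.filter fun δ => cycleMk (F.nxtO hP.nonCrossing) δ =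
      cycleMk (F.nxtO hP.nonCrossing) (F.dmk d)) =
    (Finset.range k).image fun i => F.dmk ((F.nxt hP.nonCrossing)^[i] d) := by
  ext δ
  simp only [Finset.mem_filter, Finset.mem_univ, true_and, Finset.mem_image, Finset.mem_range]
  rw [eq_comm, cycleMk_eq, F.sameCycle_iff]
  constructor
  · rintro ⟨n, rfl⟩
    have := h.three_le
    refine ⟨n % k, Nat.mod_lt _ (by omega), ?_⟩
    rw [h.iterate_mod, F.nxtO_iterate_mk]
  · rintro ⟨i, -, rfl⟩
    exact ⟨i, F.nxtO_iterate_mk _ _ _⟩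

theorem cycleSum_eq (hP : F.IsPseudoTriangulation) {d : F.graph.Dart} {k : ℕ}
    (h : FaceCycle hP.nonCrossing d k) (f : F.DartOrbit → ℝ) :
    cycleSum (F.nxtO hP.nonCrossing) f (cycleMk _ (F.dmk d)) =
      ∑ i ∈ Finset.range k, f (F.dmk ((F.nxt hP.nonCrossing)^[i] d)) := by
  classical
  rw [cycleSum_apply, hP.filter_cycleMk h, Finset.sum_image]
  intro i hi j hj hij
  exact hP.dmk_iterate_inj h (Finset.mem_range.1 hi) (Finset.mem_range.1 hj) hij

/-- The edge vectors around a face add up to zero. -/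
theorem cycleSum_vecO (hP : F.IsPseudoTriangulation) (l : Plane →ₗ[ℝ] ℝ) :
    cycleSum (F.nxtO hP.nonCrossing) (fun δ => l (F.vecO δ)) = 0 := by
  ext o
  obtain ⟨δ, rfl⟩ := cycleMk_surj _ o
  obtain ⟨d, rfl⟩ := F.dmk_surj δ
  obtain ⟨k, hk, -⟩ := hP.exists_faceCycle d
  have h : ∀ i, F.vecO (F.dmk ((F.nxt hP.nonCrossing)^[i] d)) =
      F.placement ((F.nxt hP.nonCrossing)^[i + 1] d).fst -
        F.placement ((F.nxt hP.nonCrossing)^[i] d).fst := by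
    intro i
    rw [Function.iterate_succ_apply', F.nxt_fst]
    rfl
  simp only [hP.cycleSum_eq hk, h, map_sub]
  rw [Finset.sum_range_sub (fun i => l (F.placement ((F.nxt hP.nonCrossing)^[i] d).fst)), hk.closed]
  simp

/-- The number of corners of the faces of the quotient, one face at a time. -/
theorem cycleSum_corner (hP : F.IsPseudoTriangulation) (o : F.FaceOrbit hP.nonCrossing) :
    cycleSum (F.nxtO hP.nonCrossing)
      (fun δ => if 0 < det2 (F.vecO δ) (F.vecO (F.nxtO hP.nonCrossing δ)) then 1 else 0) o = 3 := by
  classical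
  obtain ⟨δ, rfl⟩ := cycleMk_surj _ o
  obtain ⟨d, rfl⟩ := F.dmk_surj δ
  obtain ⟨k, hk, hc⟩ := hP.exists_faceCycle d
  rw [hP.cycleSum_eq hk, Finset.sum_boole]
  simp only [nxtO_mk, vecO_mk]
  simp only [IsCorner] at hc
  have h3 : ((3 : ℕ) : ℝ) = 3 := by norm_num
  rw [← h3, ← hc]
  congr!

theorem sum_corner (hP : F.IsPseudoTriangulation) :
    ∑ δ, (if 0 < det2 (F.vecO δ) (F.vecO (F.nxtO hP.nonCrossing δ)) then (1 : ℝ) else 0) =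
      3 * Fintype.card (F.FaceOrbit hP.nonCrossing) := by
  rw [← sum_cycleSum (F.nxtO hP.nonCrossing)]
  simp only [hP.cycleSum_corner]
  simp [mul_comm]

/-- Pointedness excludes straight angles, so an angle that is not a corner is the one reflex angle
at its vertex. -/
theorem det2_nxt_neg (hP : F.IsPseudoTriangulation) {d : F.graph.Dart}
    (h : ¬ 0 < det2 (F.vec d) (F.vec (F.nxt hP.nonCrossing d))) :
    det2 (F.vec d) (F.vec (F.nxt hP.nonCrossing d)) < 0 ∧
    ∀ d' : F.graph.Dart, d'.fst = d.snd → d' ≠ F.nxt hP.nonCrossing d →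
      0 < det2 (F.vec d') (F.vec (F.rot d')) := by
  obtain ⟨d₀, h1, h2, h3⟩ := hP.existsUnique_reflex d.snd
  have h4 : F.nxt hP.nonCrossing d = d₀ := by
    by_contra hne
    have := h3 _ (F.nxt_fst _ d) hne
    exact h ((F.isCorner_iff hP.nonCrossing d).2 this)
  rw [h4]
  refine ⟨?_, h3⟩
  have : F.rot d₀ = d.symm := by rw [← h4, F.rot_nxt]
  rw [this, vec_symm, det2_neg_right, det2_swap] at h2
  simpa using h2

/-- Each non-corner is matched with the vertex where its directed edge ends; there is one reflex
angle per vertex. -/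
theorem card_not_corner (hP : F.IsPseudoTriangulation) :
    Nat.card {δ : F.DartOrbit // ¬ 0 < det2 (F.vecO δ) (F.vecO (F.nxtO hP.nonCrossing δ))} =
      Nat.card (VertexOrbit Γ V) := by
  have hF := hP.nonCrossing
  refine Nat.card_eq_of_bijective (fun δ => F.srcO (F.revO δ.1)) ⟨?_, ?_⟩
  · rintro ⟨δ, h⟩ ⟨δ', h'⟩ heq
    obtain ⟨d, rfl⟩ := F.dmk_surj δ
    obtain ⟨d', rfl⟩ := F.dmk_surj δ'
    obtain ⟨g, hg⟩ := F.vmk_eq.1 heq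
    have hg' : g +ᵥ d'.snd = d.snd := hg
    rw [Subtype.mk.injEq, ← F.dmk_vadd g d']
    congr 1
    apply (F.nxt hF).injective
    by_contra hne
    have h1 := (hP.det2_nxt_neg h).2 (F.nxt hF (g +ᵥ d')) (by rw [F.nxt_fst, vadd_snd, hg'])
      (Ne.symm hne)
    apply h'
    have := (F.isCorner_iff hF _).2 h1
    rw [IsCorner, F.nxt_vadd] at this
    simpa using this
  · intro q
    obtain ⟨v, rfl⟩ := F.vmk_surj q
    obtain ⟨d, rfl, h2, -⟩ := hP.existsUnique_reflex v
    refine ⟨⟨F.dmk (F.rot d).symm, ?_⟩, ?_⟩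
    · rw [nxtO_mk, F.nxt_rot_symm, vecO_mk, vecO_mk, vec_symm, det2_neg_left, det2_swap, neg_neg]
      exact h2.not_gt
    · show F.srcO (F.revO (F.dmk _)) = _
      rw [revO_mk, SimpleGraph.Dart.symm_symm, srcO_mk, F.rot_fst]

/-- Directed edges are in bijection with angles; three corners are counted per face and one reflex
angle per vertex. -/
theorem card_eq (hP : F.IsPseudoTriangulation) : 2 * Nat.card (EdgeOrbit Γ F.graph) =
    3 * Fintype.card (F.FaceOrbit hP.nonCrossing) + Nat.card (VertexOrbit Γ V) := by
  classical
  have h1 := hP.sum_corner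
  rw [Finset.sum_boole] at h1
  have h2 := hP.card_not_corner
  rw [Nat.card_eq_fintype_card, Fintype.card_subtype] at h2
  have h3 := Finset.card_filter_add_card_filter_not (s := (Finset.univ : Finset F.DartOrbit))
    (fun δ => 0 < det2 (F.vecO δ) (F.vecO (F.nxtO hP.nonCrossing δ)))
  rw [Finset.card_univ, F.card_dartOrbit] at h3
  have h4 : (Finset.univ.filter fun δ =>
    0 < det2 (F.vecO δ) (F.vecO (F.nxtO hP.nonCrossing δ))).card =
      3 * Fintype.card (F.FaceOrbit hP.nonCrossing) := by exact_mod_cast h1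
  omega

end IsPseudoTriangulation

end PeriodicFramework
end PeriodicRigidity
end

noncomputable section
namespace PeriodicRigidity

/-! ### The turning angles of the faces -/

/-- The angle from `w` to a vector in the open half-plane around `w`. -/
def halfAngle (w e : Plane) : ℝ := Complex.arg ((starRingEnd ℂ) (toC w) * toC e)

theorem conj_toC_mul (w e : Plane) :
    (starRingEnd ℂ) (toC w) * toC e = ⟨inner ℝ w e, det2 w e⟩ := by
  apply Complex.ext
  · simp [toC, inner_eq]
  · simp [toC, det2]; ring

theorem toC_ne_zero {x : Plane} (h : x ≠ 0) : toC x ≠ 0 := fun h' => h (toC_eq_zero.1 h')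

theorem toC_neg (x : Plane) : toC (-x) = -toC x := by
  apply Complex.ext <;> simp [toC]

theorem abs_halfAngle_lt {w e : Plane} (h : 0 < inner ℝ w e) : |halfAngle w e| < Real.pi / 2 := by
  rw [halfAngle, Complex.abs_arg_lt_pi_div_two_iff, conj_toC_mul]
  exact Or.inl h

theorem tan_halfAngle (w e : Plane) : Real.tan (halfAngle w e) = det2 w e / inner ℝ w e := by
  rw [halfAngle, Complex.tan_arg, conj_toC_mul]

theorem exp_halfAngle {w e : Plane} (hw : w ≠ 0) (he : e ≠ 0) :
    Complex.exp (halfAngle w e * Complex.I) =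
      ((starRingEnd ℂ) (toC w) * toC e) / (‖toC w‖ * ‖toC e‖) := by
  have h := Complex.norm_mul_exp_arg_mul_I ((starRingEnd ℂ) (toC w) * toC e)
  have hw' : (‖toC w‖ : ℂ) ≠ 0 := by exact_mod_cast norm_ne_zero_iff.2 (toC_ne_zero hw)
  have he' : (‖toC e‖ : ℂ) ≠ 0 := by exact_mod_cast norm_ne_zero_iff.2 (toC_ne_zero he)
  rw [norm_mul, Complex.norm_conj] at h
  rw [halfAngle, eq_div_iff (mul_ne_zero hw' he'), mul_comm]
  push_cast at h
  exact h

theorem halfAngle_lt {w e e' : Plane} (h : 0 < inner ℝ w e) (h' : 0 < inner ℝ w e')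
    (hd : 0 < det2 e e') : halfAngle w e < halfAngle w e' := by
  have h1 := abs_lt.1 (abs_halfAngle_lt h)
  have h2 := abs_lt.1 (abs_halfAngle_lt h')
  rw [← Real.strictMonoOn_tan.lt_iff_lt ⟨h1.1, h1.2⟩ ⟨h2.1, h2.2⟩, tan_halfAngle, tan_halfAngle,
    div_lt_div_iff₀ h h', ← sub_pos]
  have h3 : det2 w e' * inner ℝ w e - det2 w e * inner ℝ w e' = ‖w‖ ^ 2 * det2 e e' := by
    rw [normSq_eq, inner_eq, inner_eq]; simp only [det2]; ring
  rw [h3]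
  have : 0 < ‖w‖ ^ 2 := by
    have : w ≠ 0 := by rintro rfl; simp at h
    have := norm_pos_iff.2 this
    positivity
  positivity

namespace PeriodicFramework

variable {V Γ : Type*} [AddCommGroup Γ] [AddAction Γ V] {F : PeriodicFramework V Γ}

namespace IsPseudoTriangulation

theorem exists_pointing (hP : F.IsPseudoTriangulation) :
    ∃ w : VertexOrbit Γ V → Plane, ∀ δ : F.DartOrbit, 0 < inner ℝ (w (F.srcO δ)) (F.vecO δ) := by
  have h : ∀ q : VertexOrbit Γ V, ∃ w : Plane, ∀ δ : F.DartOrbit, F.srcO δ = q →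
      0 < inner ℝ w (F.vecO δ) := by
    intro q
    obtain ⟨v, rfl⟩ := F.vmk_surj q
    obtain ⟨w, hw⟩ := hP.pointed v
    refine ⟨w, fun δ hδ => ?_⟩
    obtain ⟨d, rfl⟩ := F.dmk_surj δ
    obtain ⟨g, hg⟩ := F.vmk_eq.1 hδ.symm
    have h := hw (g +ᵥ d.snd) (by rw [← hg]; exact (g +ᵥ d).adj)
    rw [← hg] at h
    have h' : 0 < inner ℝ w (F.vec (g +ᵥ d)) := h
    rwa [F.vec_vadd] at h'
  choose w hw using h
  exact ⟨w, fun δ => hw _ δ rfl⟩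

/-- Each face turns once around, which bounds the number of faces. -/
theorem card_faceOrbit_le (hP : F.IsPseudoTriangulation) :
    Fintype.card (F.FaceOrbit hP.nonCrossing) ≤ Nat.card (VertexOrbit Γ V) := by
  classical
  set ν := F.nxtO hP.nonCrossing with hν
  obtain ⟨w, hw⟩ := hP.exists_pointing
  have hw0 : ∀ δ : F.DartOrbit, w (F.srcO δ) ≠ 0 := by
    intro δ h
    have := hw δ
    rw [h] at this
    simp at this
  let c : F.DartOrbit → ℝ := fun δ => if 0 < det2 (F.vecO δ) (F.vecO (ν δ)) then 1 else 0
  let α : F.DartOrbit → ℝ := fun δ => halfAngle (w (F.srcO δ)) (F.vecO δ)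
  -- The turning angle at the end of `δ`, with both edges measured from the same pointing direction;
  -- the last term compensates the reversal of `δ`, with the sign that keeps a corner below π and a
  -- reflex angle below 0.
  let θ : F.DartOrbit → ℝ := fun δ => α (ν δ) - α (F.revO δ) + Real.pi * (2 * c δ - 1)
  have hα : ∀ δ, |α δ| < Real.pi / 2 := fun δ => abs_halfAngle_lt (hw δ)
  have hθ : ∀ δ, θ δ ≤ Real.pi * c δ ∧ (c δ = 1 → θ δ < Real.pi) := by
    intro δ
    have h1 := abs_lt.1 (hα (ν δ))
    have h2 := abs_lt.1 (hα (F.revO δ))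
    by_cases h : 0 < det2 (F.vecO δ) (F.vecO (ν δ))
    · have hc : c δ = 1 := if_pos h
      have h3 : α (ν δ) < α (F.revO δ) := by
        have h4 := hw (ν δ)
        simp only [α]
        rw [F.srcO_nxtO] at h4 ⊢
        refine halfAngle_lt h4 (hw _) ?_
        rw [F.vecO_revO, det2_neg_right, det2_swap]
        simpa using h
      simp only [θ, hc]
      exact ⟨by linarith, fun _ => by linarith⟩
    · have hc : c δ = 0 := if_neg h
      simp only [θ, hc]
      exact ⟨by linarith, fun h => by norm_num at h⟩
  let u : F.DartOrbit → ℂ := fun δ => toC (F.vecO δ) / ‖toC (F.vecO δ)‖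
  have hn0 : ∀ δ : F.DartOrbit, (‖toC (F.vecO δ)‖ : ℂ) ≠ 0 := fun δ => by
    exact_mod_cast norm_ne_zero_iff.2 (toC_ne_zero (F.vecO_ne_zero δ))
  have hu0 : ∀ δ, u δ ≠ 0 := fun δ => div_ne_zero (toC_ne_zero (F.vecO_ne_zero δ)) (hn0 δ)
  have hexp : ∀ δ, Complex.exp (θ δ * Complex.I) * u δ = u (ν δ) := by
    intro δ
    have hpi : Complex.exp ((Real.pi * (2 * c δ - 1) : ℝ) * Complex.I) = -1 := by
      by_cases h : 0 < det2 (F.vecO δ) (F.vecO (ν δ))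
      · have hc : c δ = 1 := if_pos h
        rw [hc]
        norm_num
      · have hc : c δ = 0 := if_neg h
        rw [hc]
        norm_num [Complex.exp_neg]
    have h1 : Complex.exp (θ δ * Complex.I) * Complex.exp (α (F.revO δ) * Complex.I) =
        -Complex.exp (α (ν δ) * Complex.I) := by
      rw [← mul_neg_one, ← hpi, ← Complex.exp_add, ← Complex.exp_add]
      congr 1
      simp only [θ]
      push_cast
      ring
    simp only [α] at h1
    rw [exp_halfAngle (hw0 _) (F.vecO_ne_zero _), exp_halfAngle (hw0 _) (F.vecO_ne_zero _),
      F.vecO_revO, toC_neg, norm_neg, F.srcO_nxtO] at h1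
    have hW := toC_ne_zero (hw0 (F.revO δ))
    have hWn : (‖toC (w (F.srcO (F.revO δ)))‖ : ℂ) ≠ 0 := by
      exact_mod_cast norm_ne_zero_iff.2 hW
    have hWc : (starRingEnd ℂ) (toC (w (F.srcO (F.revO δ)))) ≠ 0 := by simpa using hW
    have h2 := hn0 δ
    have h3 := hn0 (ν δ)
    simp only [u]
    field_simp at h1 ⊢
    linear_combination -h1
  -- Around a face the edge direction returns to itself, so the sum is a multiple of 2π; three
  -- corners keep it below 3π.
  have hcycle : ∀ o, cycleSum ν θ o ≤ 2 * Real.pi := by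
    intro o
    have hc3 : cycleSum ν c o = 3 := hP.cycleSum_corner o
    obtain ⟨δ, rfl⟩ := cycleMk_surj _ o
    obtain ⟨d, rfl⟩ := F.dmk_surj δ
    obtain ⟨k, hk, -⟩ := hP.exists_faceCycle d
    rw [hP.cycleSum_eq hk] at hc3 ⊢
    set D : ℕ → F.DartOrbit := fun i => F.dmk ((F.nxt hP.nonCrossing)^[i] d) with hD
    have hDs : ∀ i, D (i + 1) = ν (D i) := fun i => by
      simp only [hD, Function.iterate_succ_apply', hν, nxtO_mk]
    have h1 : ∀ n, Complex.exp ((∑ i ∈ Finset.range n, θ (D i) : ℝ) * Complex.I) * u (D 0) =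
        u (D n) := by
      intro n
      induction n with
      | zero => simp
      | succ n ih =>
        rw [hDs, ← hexp, ← ih, Finset.sum_range_succ, ← mul_assoc, ← Complex.exp_add]
        congr 2
        push_cast
        ring
    have h2 := h1 k
    have h3 : D k = D 0 := by simp only [hD]; rw [hk.closed]; rfl
    rw [h3, mul_eq_right₀ (hu0 _), Complex.exp_eq_one_iff] at h2
    obtain ⟨n, hn⟩ := h2
    have h4 : ∑ i ∈ Finset.range k, θ (D i) = n * (2 * Real.pi) := by
      have h5 : ((∑ i ∈ Finset.range k, θ (D i) : ℝ) : ℂ) * Complex.I =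
          ((n * (2 * Real.pi) : ℝ) : ℂ) * Complex.I := by
        rw [hn]; push_cast; ring
      exact_mod_cast mul_right_cancel₀ Complex.I_ne_zero h5
    have h6 : ∑ i ∈ Finset.range k, θ (D i) < 3 * Real.pi := by
      rw [mul_comm, ← hc3, Finset.mul_sum]
      obtain ⟨i, hi, hci⟩ : ∃ i ∈ Finset.range k, c (D i) = 1 := by
        by_contra hcon
        push Not at hcon
        have : ∀ i ∈ Finset.range k, c (D i) = 0 := by
          intro i hi
          by_contra h
          apply hcon i hi
          by_cases h' : 0 < det2 (F.vecO (D i)) (F.vecO (ν (D i)))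
          · exact if_pos h'
          · exact absurd (if_neg h') h
        rw [Finset.sum_eq_zero this] at hc3
        norm_num at hc3
      refine Finset.sum_lt_sum (fun i _ => (hθ _).1) ⟨i, hi, ?_⟩
      rw [hci, mul_one]
      exact (hθ _).2 hci
    have hpi := Real.pi_pos
    rw [h4] at h6 ⊢
    have h7 : (n : ℝ) < 2 := by nlinarith
    have h8 : n ≤ 1 := by
      have : n < 2 := by exact_mod_cast h7
      omega
    have h9 : (n : ℝ) ≤ 1 := by exact_mod_cast h8
    nlinarith
  -- In the total the local angles cancel, because the face walk and the reversal both permute the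
  -- directed edge orbits.
  have htot : ∑ δ, θ δ = Real.pi * (2 * (3 * Fintype.card (F.FaceOrbit hP.nonCrossing)) -
      Fintype.card F.DartOrbit) := by
    have h1 : ∑ δ, c δ = 3 * Fintype.card (F.FaceOrbit hP.nonCrossing) := hP.sum_corner
    simp only [θ, Finset.sum_add_distrib, Finset.sum_sub_distrib, ← Finset.mul_sum]
    rw [Equiv.sum_comp ν α, F.sum_revO α, h1]
    simp
  have hle : ∑ δ, θ δ ≤ Fintype.card (F.FaceOrbit hP.nonCrossing) * (2 * Real.pi) := by
    rw [← sum_cycleSum ν]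
    refine (Finset.sum_le_sum fun o _ => hcycle o).trans ?_
    simp only [Finset.sum_const, Finset.card_univ, nsmul_eq_mul]
    exact le_rfl
  have hcard := hP.card_eq
  rw [← F.card_dartOrbit] at hcard
  have hcard' : (Fintype.card F.DartOrbit : ℝ) =
    3 * Fintype.card (F.FaceOrbit hP.nonCrossing) + Nat.card (VertexOrbit Γ V) := by
    exact_mod_cast hcard
  -- What remains is 6f − (3f + n) ≤ 2f.
  rw [htot, hcard'] at hle
  have : (Fintype.card (F.FaceOrbit hP.nonCrossing) : ℝ) ≤ Nat.card (VertexOrbit Γ V) := by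
    nlinarith [Real.pi_pos]
  exact_mod_cast this

theorem card_edgeOrbit_le (hP : F.IsPseudoTriangulation) :
    Nat.card (EdgeOrbit Γ F.graph) ≤ 2 * Nat.card (VertexOrbit Γ V) := by
  have h1 := hP.card_faceOrbit_le
  have h2 := hP.card_eq
  omega

end IsPseudoTriangulation

end PeriodicFramework
end PeriodicRigidity
end

/-! ### Piecewise affine lifts and their duality with angular velocities. -/

noncomputable section
namespace PeriodicRigidity

/-! ### Piecewise linear functions on pseudo-triangulations -/

theorem eventually_norm_sub_lt {D u : Plane} (h : 0 < inner ℝ D u) :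
    ∀ᶠ t : ℝ in 𝓝[>] 0, ‖D - t • u‖ < ‖D‖ := by
  have h1 : ∀ᶠ t : ℝ in 𝓝[>] 0, t * ‖u‖ ^ 2 < 2 * inner ℝ D u := by
    refine nhdsWithin_le_nhds ?_
    have : ContinuousAt (fun t : ℝ => t * ‖u‖ ^ 2) 0 := by fun_prop
    exact this.eventually_lt continuousAt_const (by simpa using h)
  filter_upwards [h1, eventually_mem_nhdsWithin] with t ht ht0
  have ht0' : 0 < t := ht0
  refine lt_of_pow_lt_pow_left₀ 2 (norm_nonneg _) ?_
  rw [@norm_sub_sq_real, inner_smul_right, norm_smul, mul_pow, Real.norm_of_nonneg ht0'.le]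
  nlinarith

theorem eventually_lt_of_pos {a : ℝ} (h : 0 < a) : ∀ᶠ t : ℝ in 𝓝[>] 0, t < a :=
  nhdsWithin_le_nhds (Iio_mem_nhds h)

theorem eq_zero_of_inner_eq_zero {g a b : Plane} (hd : det2 a b ≠ 0) (ha : inner ℝ g a = 0)
    (hb : inner ℝ g b = 0) : g = 0 := by
  rw [inner_eq] at ha hb
  simp only [det2] at hd
  apply plane_ext
  · apply mul_left_cancel₀ hd
    simp only [PiLp.zero_apply, mul_zero]
    linear_combination b 1 * ha - a 1 * hb
  · apply mul_left_cancel₀ hd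
    simp only [PiLp.zero_apply, mul_zero]
    linear_combination a 0 * hb - b 0 * ha

theorem eq_smul_perp {D e : Plane} (he : e ≠ 0) (h : inner ℝ D e = 0) :
    D = (inner ℝ D (perp e) / ‖e‖ ^ 2) • perp e := by
  have hp := sq_pos_of_ne he
  rw [inner_eq] at h
  rw [normSq_eq, inner_eq]
  apply plane_ext
  · simp only [perp_zero_coord, perp_one_coord, PiLp.smul_apply, smul_eq_mul]
    field_simp
    linear_combination e 0 * h
  · simp only [perp_zero_coord, perp_one_coord, PiLp.smul_apply, smul_eq_mul]
    field_simp
    linear_combination e 1 * h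

namespace PeriodicFramework

variable {V Γ : Type*} [AddCommGroup Γ] [AddAction Γ V] (F : PeriodicFramework V Γ)

theorem seg_vadd (g : Γ) (d : F.graph.Dart) {x : Plane} :
    x + F.period g ∈ F.seg (g +ᵥ d) ↔ x ∈ F.seg d := by
  rw [F.mem_seg_iff, F.mem_seg_iff, vec_vadd, vadd_fst, F.placement_vadd]
  refine exists_congr fun s => and_congr_right fun _ => ?_
  rw [add_right_comm, add_left_inj]

theorem isCompact_seg (d : F.graph.Dart) : IsCompact (F.seg d) := by
  unfold seg
  rw [segment_eq_image_lineMap]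
  exact isCompact_Icc.image (AffineMap.lineMap_continuous)

/-- Modulo the periods the first family is a finite union of segments, hence compact, and the second
is closed by local finiteness; so the distance is attained. -/
theorem exists_closest (A B : Set F.graph.Dart) (hA : ∀ (g : Γ), ∀ d ∈ A, g +ᵥ d ∈ A)
    (hB : ∀ (g : Γ), ∀ d ∈ B, g +ᵥ d ∈ B) (hA0 : A.Nonempty) (hB0 : B.Nonempty) :
    ∃ x₀ y₀, (∃ d ∈ A, x₀ ∈ F.seg d) ∧ (∃ d ∈ B, y₀ ∈ F.seg d) ∧
      ∀ d ∈ A, ∀ x ∈ F.seg d, ∀ d' ∈ B, ∀ y ∈ F.seg d', dist x₀ y₀ ≤ dist x y := by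
  let rep : F.DartOrbit → F.graph.Dart := fun q => (F.dmk_surj q).choose
  have hrep : ∀ d, ∃ g : Γ, g +ᵥ rep (F.dmk d) = d := fun d =>
    F.dmk_eq.1 (F.dmk_surj (F.dmk d)).choose_spec.symm
  let K : Set Plane := ⋃ q ∈ {q | rep q ∈ A}, F.seg (rep q)
  let Y : Set Plane := ⋃ d ∈ B, F.seg d
  have hK : IsCompact K := (Set.toFinite _).isCompact_biUnion fun q _ => F.isCompact_seg _
  have hY : IsClosed Y := F.isClosed_biUnion_seg B
  have hKm : ∀ d ∈ A, ∀ x ∈ F.seg d, ∃ g : Γ, x + F.period g ∈ K := by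
    intro d hd x hx
    obtain ⟨g, hg⟩ := hrep d
    have h1 : rep (F.dmk d) = -g +ᵥ d := by rw [← hg, neg_vadd_vadd, hg]
    refine ⟨-g, mem_biUnion (x := F.dmk d) ?_ ?_⟩
    · show rep (F.dmk d) ∈ A
      rw [h1]; exact hA _ _ hd
    · rw [h1]; exact (F.seg_vadd _ _).2 hx
  have hK0 : K.Nonempty := by
    obtain ⟨d, hd⟩ := hA0
    obtain ⟨g, hg⟩ := hKm d hd _ (F.placement_mem_seg_left d)
    exact ⟨_, hg⟩
  have hY0 : Y.Nonempty := by
    obtain ⟨d, hd⟩ := hB0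
    exact ⟨_, mem_biUnion hd (F.placement_mem_seg_left d)⟩
  obtain ⟨x₀, hx₀, hmin⟩ := hK.exists_isMinOn hK0 (Metric.continuous_infDist_pt Y).continuousOn
  obtain ⟨y₀, hy₀, hy⟩ := hY.exists_infDist_eq_dist hY0 x₀
  refine ⟨x₀, y₀, ?_, ?_, ?_⟩
  · obtain ⟨q, hq, h⟩ := mem_iUnion₂.1 hx₀
    exact ⟨_, hq, h⟩
  · obtain ⟨d, hd, h⟩ := mem_iUnion₂.1 hy₀
    exact ⟨d, hd, h⟩
  · intro d hd x hx d' hd' y hy'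
    obtain ⟨g, hg⟩ := hKm d hd x hx
    rw [← hy]
    have h1 : Metric.infDist x₀ Y ≤ Metric.infDist (x + F.period g) Y := hmin hg
    refine h1.trans ?_
    rw [← dist_add_right x y (F.period g)]
    exact Metric.infDist_le_dist_of_mem (mem_biUnion (hB g d' hd') ((F.seg_vadd g d').2 hy'))

/-- The straight path from `z` to `y` has to leave the face through its frontier, at a point no
farther from `y`. -/
theorem exists_seg_closer (hF : F.NonCrossing) {d : F.graph.Dart} {z y : Plane}
    (hz : z ∈ F.leftFace d) (hy : y ∈ F.realization) :
    ∃ d', F.leftFace d' = F.leftFace d ∧ ∃ x ∈ F.seg d', dist x y ≤ dist z y := by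
  have hU := F.isFace_leftFace hF d
  have hyU : y ∉ F.leftFace d := fun h => hU.subset h hy
  have hpre : IsPreconnected (segment ℝ z y) := (convex_segment z y).isPreconnected
  obtain ⟨x, hx, hxf⟩ : ∃ x ∈ segment ℝ z y, x ∈ frontier (F.leftFace d) := by
    by_contra hcon
    push Not at hcon
    have hcl : ∀ x ∈ segment ℝ z y, x ∈ closure (F.leftFace d) → x ∈ F.leftFace d := by
      intro x hx hxc
      by_contra h
      exact hcon x hx ⟨hxc, by rwa [hU.isOpen.interior_eq]⟩
    obtain ⟨x, -, hx1, hx2⟩ := hpre _ _ hU.isOpen isClosed_closure.isOpen_compl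
      (fun x hx => by
        by_cases h : x ∈ closure (F.leftFace d)
        · exact Or.inl (hcl x hx h)
        · exact Or.inr h)
      ⟨z, left_mem_segment _ _ _, hz⟩
      ⟨y, right_mem_segment _ _ _, fun h => hyU (hcl y (right_mem_segment _ _ _) h)⟩
    exact hx2 (subset_closure hx1)
  obtain ⟨d', hd', hxd⟩ := F.exists_dart_of_mem_frontier hF hU hxf
  refine ⟨d', hd', x, hxd, ?_⟩
  rw [segment_eq_image'] at hx
  obtain ⟨s, ⟨hs0, hs1⟩, rfl⟩ := hx
  have h1 : z + s • (y - z) - y = (1 - s) • (z - y) := by module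
  rw [dist_eq_norm, dist_eq_norm, h1, norm_smul, Real.norm_of_nonneg (by linarith)]
  exact mul_le_of_le_one_left (norm_nonneg _) (by linarith)

theorem dist_add_smul (x y u : Plane) (t : ℝ) : dist (x + t • u) y = ‖(y - x) - t • u‖ := by
  rw [dist_comm, dist_eq_norm, sub_sub]

/-- From a reflex angle of a face one can get closer to any other point of the framework. -/
theorem exists_closer_of_reflex (hF : F.NonCrossing) {d : F.graph.Dart}
    (hd : det2 (F.vec d) (F.vec (F.rot d)) < 0) {y : Plane} (hy : y ∈ F.realization)
    (hne : y ≠ F.placement d.fst) :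
    ∃ d', F.leftFace d' = F.leftFace d ∧ ∃ x ∈ F.seg d', dist x y < dist (F.placement d.fst) y := by
  set D := y - F.placement d.fst with hD
  have hdist : dist (F.placement d.fst) y = ‖D‖ := by rw [dist_comm, dist_eq_norm]
  have hedge : ∀ d' : F.graph.Dart, d'.fst = d.fst → 0 < inner ℝ D (F.vec d') →
      ∃ x ∈ F.seg d', dist x y < dist (F.placement d.fst) y := by
    intro d' h1 h
    obtain ⟨t, ht, ht1, ht0⟩ := ((eventually_norm_sub_lt h).and
      ((eventually_lt_of_pos one_pos).and
        eventually_mem_nhdsWithin)).exists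
    refine ⟨F.placement d'.fst + t • F.vec d', F.mem_seg_iff.2 ⟨t, ⟨le_of_lt ht0, ht1.le⟩, rfl⟩, ?_⟩
    rw [h1, dist_add_smul, hdist]
    exact ht
  by_cases h1 : 0 < inner ℝ D (F.vec d)
  · exact ⟨d, rfl, hedge d rfl h1⟩
  by_cases h2 : 0 < inner ℝ D (F.vec (F.rot d))
  · obtain ⟨x, hx, h⟩ := hedge _ (F.rot_fst d) h2
    exact ⟨(F.rot d).symm, F.leftFace_rot_symm hF d, x, by rwa [F.seg_symm], h⟩
  -- If neither side of the reflex angle leads closer, then the direction opposite to their sum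
  -- does: the two inner products are not both zero, as the sides are independent.
  have h3 : 0 < inner ℝ D (-(F.vec d + F.vec (F.rot d))) := by
    rw [inner_neg_right, inner_add_right]
    rcases eq_or_lt_of_le (not_lt.1 h1) with h1' | h1'
    · rcases eq_or_lt_of_le (not_lt.1 h2) with h2' | h2'
      · exact absurd (eq_zero_of_inner_eq_zero hd.ne h1' h2') (sub_ne_zero.2 hne)
      · linarith
    · linarith
  obtain ⟨t, ht, htU⟩ := ((eventually_norm_sub_lt h3).and (F.eventually_reflex hF hd)).exists
  obtain ⟨d', hd', x, hx, hle⟩ := F.exists_seg_closer hF htU hy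
  refine ⟨d', hd', x, hx, hle.trans_lt ?_⟩
  rw [dist_add_smul, hdist]
  exact ht

/-- The direction from a closest point in the interior of an edge. -/
theorem eq_neg_perp_of_closest (hF : F.NonCrossing) {d : F.graph.Dart} {x y : Plane}
    (hx : x ∈ F.oseg d) (hy : y ∈ F.realization)
    (hmin : ∀ d', F.leftFace d' = F.leftFace d → ∀ z ∈ F.seg d', dist x y ≤ dist z y) :
    ∃ c ≥ (0 : ℝ), y - x = -(c • perp (F.vec d)) := by
  set D := y - x with hD
  have hdist : dist x y = ‖D‖ := by rw [dist_comm, dist_eq_norm]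
  obtain ⟨s, ⟨hs0, hs1⟩, hs⟩ := F.mem_oseg_iff.1 hx
  -- Sliding along the edge either way, or stepping into the face on its left, must not bring the
  -- point closer; only the normal to the right remains.
  have h1 : inner ℝ D (F.vec d) ≤ 0 := by
    by_contra! h
    obtain ⟨t, ht, ht1, ht0⟩ := ((eventually_norm_sub_lt h).and
      ((eventually_lt_of_pos (sub_pos.2 hs1)).and
        eventually_mem_nhdsWithin)).exists
    have ht0' : 0 < t := ht0
    have := hmin d rfl (x + t • F.vec d) (F.mem_seg_iff.2 ⟨s + t, ⟨by linarith, by linarith⟩, by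
      rw [hs]; module⟩)
    rw [dist_add_smul, hdist] at this
    exact absurd ht (not_lt.2 this)
  have h2 : 0 ≤ inner ℝ D (F.vec d) := by
    by_contra! h
    rw [← neg_pos, ← inner_neg_right] at h
    obtain ⟨t, ht, ht1, ht0⟩ := ((eventually_norm_sub_lt h).and
      ((eventually_lt_of_pos hs0).and
        eventually_mem_nhdsWithin)).exists
    have ht0' : 0 < t := ht0
    have := hmin d rfl (x + t • -F.vec d) (F.mem_seg_iff.2 ⟨s - t, ⟨by linarith, by linarith⟩, by
      rw [hs]; module⟩)
    rw [dist_add_smul, hdist] at this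
    exact absurd ht (not_lt.2 this)
  have h3 : inner ℝ D (perp (F.vec d)) ≤ 0 := by
    by_contra! h
    obtain ⟨t, ht, htU⟩ := ((eventually_norm_sub_lt h).and (F.eventually_leftFace hF d hx)).exists
    obtain ⟨d', hd', z, hz, hle⟩ := F.exists_seg_closer hF htU hy
    have := hmin d' hd' z hz
    rw [dist_add_smul] at hle
    rw [hdist] at this
    linarith
  refine ⟨-(inner ℝ D (perp (F.vec d)) / ‖F.vec d‖ ^ 2), ?_, ?_⟩
  · rw [ge_iff_le, neg_nonneg]
    exact div_nonpos_of_nonpos_of_nonneg h3 (by positivity)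
  · rw [neg_smul, neg_neg]
    exact eq_smul_perp (F.vec_ne_zero d) (le_antisymm h1 h2)

variable {F}

namespace IsPseudoTriangulation

/-- A function of the vertices that is affine on each face, along the face on the left of `d`. -/
theorem affine_of_leftFace (hP : F.IsPseudoTriangulation) {G : F.graph.Dart → Plane} {Y : V → ℝ}
    (hG : ∀ d, G (F.nxt hP.nonCrossing d) = G d)
    (hY : ∀ d, Y d.snd - Y d.fst = inner ℝ (G d) (F.vec d)) {d d' : F.graph.Dart}
    (h : F.leftFace d' = F.leftFace d) : G d' = G d ∧
      Y d'.fst - Y d.fst = inner ℝ (G d) (F.placement d'.fst - F.placement d.fst) := by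
  obtain ⟨k, hk, -⟩ := hP.exists_faceCycle d
  obtain ⟨i, -, rfl⟩ := hk.exists_index d' h
  clear h
  induction i with
  | zero => simp
  | succ i ih =>
    rw [Function.iterate_succ_apply', hG, F.nxt_fst]
    refine ⟨ih.1, ?_⟩
    have h1 := hY ((F.nxt hP.nonCrossing)^[i] d)
    rw [ih.1] at h1
    rw [← sub_add_sub_cancel, h1, ih.2, ← inner_add_right, vec, sub_add_sub_cancel]

/-- The face with the reflex angle at a maximum is flat. -/
theorem eq_zero_of_reflex (hP : F.IsPseudoTriangulation) {G : F.graph.Dart → Plane} {Y : V → ℝ}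
    (hG : ∀ d, G (F.nxt hP.nonCrossing d) = G d)
    (hY : ∀ d, Y d.snd - Y d.fst = inner ℝ (G d) (F.vec d)) {d : F.graph.Dart}
    (hmax : ∀ v, Y v ≤ Y d.fst) (hd : det2 (F.vec d) (F.vec (F.rot d)) < 0) : G d = 0 := by
  have hF := hP.nonCrossing
  by_contra hg
  have h1 : inner ℝ (G d) (F.vec d) ≤ 0 := by
    rw [← hY]; linarith [hmax d.snd]
  have h2 : inner ℝ (G d) (F.vec (F.rot d)) ≤ 0 := by
    have h3 := hY (F.rot d).symm
    have h4 : G (F.rot d).symm = G d := by rw [← hG (F.rot d).symm, F.nxt_rot_symm]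
    rw [h4, vec_symm, inner_neg_right] at h3
    have h5 : (F.rot d).symm.snd = d.fst := F.rot_fst d
    rw [h5] at h3
    linarith [hmax (F.rot d).symm.fst]
  obtain ⟨t, ht, ht0⟩ := ((F.eventually_reflex hF hd).and eventually_mem_nhdsWithin).exists
  have ht0' : 0 < t := ht0
  have hU := F.isFace_leftFace hF d
  -- Behind the reflex vertex the affine function of the face is at least the maximum of `Y`, and
  -- some vertex of the bounded face does at least as well. Hence both slopes at the reflex vertex
  -- vanish.
  have hz : ∃ d', F.leftFace d' = F.leftFace d ∧ inner ℝ (G d) (F.placement d.fst +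
      t • -(F.vec d + F.vec (F.rot d))) ≤ inner ℝ (G d) (F.placement d'.fst) := by
    obtain ⟨d', hd', h | h⟩ := F.exists_vertex_inner_ge hF hU (hP.isBounded_leftFace d) hg
      (subset_closure ht)
    · exact ⟨d', hd', h⟩
    · exact ⟨F.nxt hF d', by rw [F.leftFace_nxt, hd'], by rwa [F.nxt_fst]⟩
  obtain ⟨d', hd', h⟩ := hz
  have h3 := (hP.affine_of_leftFace hG hY hd').2
  rw [inner_sub_right] at h3
  rw [inner_add_right, inner_smul_right, inner_neg_right, inner_add_right] at h
  have h4 := hmax d'.fst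
  have h5 : inner ℝ (G d) (F.vec d) + inner ℝ (G d) (F.vec (F.rot d)) = 0 := by nlinarith
  exact hg (eq_zero_of_inner_eq_zero hd.ne (by linarith) (by linarith))

/-- The edges of the flat faces at a given height. -/
def flat (G : F.graph.Dart → Plane) (Y : V → ℝ) (M : ℝ) : Set F.graph.Dart :=
  {d | G d = 0 ∧ Y d.fst = M}

theorem flat_of_leftFace (hP : F.IsPseudoTriangulation) {G : F.graph.Dart → Plane} {Y : V → ℝ}
    (hG : ∀ d, G (F.nxt hP.nonCrossing d) = G d)
    (hY : ∀ d, Y d.snd - Y d.fst = inner ℝ (G d) (F.vec d)) {M : ℝ} {d d' : F.graph.Dart}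
    (hd : d ∈ flat G Y M) (h : F.leftFace d' = F.leftFace d) : d' ∈ flat G Y M := by
  obtain ⟨h1, h2⟩ := hP.affine_of_leftFace hG hY h
  rw [hd.1, inner_zero_left, hd.2] at h2
  exact ⟨h1.trans hd.1, by linarith⟩

theorem flat_snd {G : F.graph.Dart → Plane} {Y : V → ℝ}
    (hY : ∀ d, Y d.snd - Y d.fst = inner ℝ (G d) (F.vec d)) {M : ℝ} {d : F.graph.Dart}
    (hd : d ∈ flat G Y M) : Y d.snd = M := by
  have := hY d
  rw [hd.1, inner_zero_left, hd.2] at this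
  linarith

theorem exists_flat_closer (hP : F.IsPseudoTriangulation) {G : F.graph.Dart → Plane} {Y : V → ℝ}
    (hG : ∀ d, G (F.nxt hP.nonCrossing d) = G d)
    (hY : ∀ d, Y d.snd - Y d.fst = inner ℝ (G d) (F.vec d)) {M : ℝ}
    (hM : ∀ v, Y v ≤ M) {v : V} (hv : Y v = M) {y : Plane} (hy : y ∈ F.realization)
    (hne : y ≠ F.placement v) :
    ∃ d ∈ flat G Y M, ∃ x ∈ F.seg d, dist x y < dist (F.placement v) y := by
  have hF := hP.nonCrossing
  obtain ⟨d, rfl, hd, -⟩ := hP.existsUnique_reflex v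
  have h0 := hP.eq_zero_of_reflex hG hY (fun u => (hM u).trans hv.ge) hd
  obtain ⟨d', hd', x, hx, h⟩ := F.exists_closer_of_reflex hF hd hy hne
  exact ⟨d', hP.flat_of_leftFace hG hY ⟨h0, hv⟩ hd', x, hx, h⟩

/-- If `M` and `m` differed, the edges of flat faces at height `M` and those at height `m` would be
nonempty disjoint periodic families with a closest pair of points. Neither point is a vertex, since
the flat face with the reflex angle there allows a closer approach. So both are inner points of
edges, which are then antiparallel; sliding both points along keeps the distance until one of them
reaches a vertex, a contradiction. -/
theorem eq_of_affine (hP : F.IsPseudoTriangulation) {G : F.graph.Dart → Plane} {Y : V → ℝ}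
    (hG : ∀ d, G (F.nxt hP.nonCrossing d) = G d)
    (hY : ∀ d, Y d.snd - Y d.fst = inner ℝ (G d) (F.vec d))
    (hGp : ∀ (g : Γ) d, G (g +ᵥ d) = G d) (hYp : ∀ (g : Γ) v, Y (g +ᵥ v) = Y v)
    {M m : ℝ} (hM : ∀ v, Y v ≤ M) (hm : ∀ v, m ≤ Y v) {a b : V} (ha : Y a = M) (hb : Y b = m) :
    M = m := by
  have hF := hP.nonCrossing
  by_contra hne
  let G' : F.graph.Dart → Plane := fun d => -G d
  let Y' : V → ℝ := fun v => -Y v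
  have hG' : ∀ d, G' (F.nxt hF d) = G' d := fun d => by simp only [G', hG]
  have hY' : ∀ d, Y' d.snd - Y' d.fst = inner ℝ (G' d) (F.vec d) := fun d => by
    simp only [G', Y', inner_neg_left, ← hY]; ring
  have hm' : ∀ v, Y' v ≤ -m := fun v => neg_le_neg (hm v)
  have hflat0 : ∀ {G : F.graph.Dart → Plane} {Y : V → ℝ}
    (_ : ∀ d, G (F.nxt hP.nonCrossing d) = G d)
    (_ : ∀ d, Y d.snd - Y d.fst = inner ℝ (G d) (F.vec d)) {M : ℝ} (_ : ∀ v, Y v ≤ M) {v : V}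
      (_ : Y v = M), (flat G Y M).Nonempty := by
    intro G Y hG hY M hM v hv
    obtain ⟨d, rfl, hd, -⟩ := hP.existsUnique_reflex v
    exact ⟨d, hP.eq_zero_of_reflex hG hY (fun u => (hM u).trans hv.ge) hd, hv⟩
  set A := flat G Y M with hA
  set B := flat G' Y' (-m) with hB
  obtain ⟨x₀, y₀, ⟨d₀, hd₀, hx₀⟩, ⟨d₁, hd₁, hy₀⟩, hmin⟩ := F.exists_closest A B
    (fun g d hd => ⟨(hGp g d).trans hd.1, (hYp g _).trans hd.2⟩)
    (fun g d hd => ⟨(congrArg Neg.neg (hGp g d)).trans hd.1, (congrArg Neg.neg (hYp g _)).trans hd.2⟩)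
    (hflat0 hG hY hM ha) (hflat0 hG' hY' hm' (congrArg Neg.neg hb))
  have hdisj : ∀ x, ∀ d ∈ A, ∀ d' ∈ B, x ∈ F.seg d → x ∉ F.seg d' := by
    intro x d hd d' hd' hx hx'
    have h1 := hd.2
    have h2 := flat_snd hY hd
    have h3 : Y d'.fst = m := neg_injective hd'.2
    have h4 : Y d'.snd = m := neg_injective (flat_snd hY' hd')
    have key : ∀ w, (w = d.fst ∨ w = d.snd) → (w = d'.fst ∨ w = d'.snd) → False := by
      rintro w (rfl | rfl) (h | h)
      · exact hne (by rw [← h1, ← h3, h])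
      · exact hne (by rw [← h1, ← h4, h])
      · exact hne (by rw [← h2, ← h3, h])
      · exact hne (by rw [← h2, ← h4, h])
    by_cases he : d.edge = d'.edge
    · refine key d.fst (Or.inl rfl) ?_
      rcases SimpleGraph.dart_edge_eq_iff _ _ |>.1 he with h | h
      · exact Or.inl (by rw [h])
      · exact Or.inr (by rw [h]; rfl)
    · obtain ⟨w, hw1, hw2, -⟩ := hF.seg_inter he hx hx'
      exact key w hw1 hw2
  have hpos : ∀ d ∈ A, ∀ d' ∈ B, ∀ x ∈ F.seg d, ∀ y ∈ F.seg d', y ≠ x := by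
    rintro d hd d' hd' x hx y hy rfl
    exact hdisj _ d hd d' hd' hx hy
  have hvx : ∀ d ∈ A, ∀ d' ∈ B, ∀ x ∈ F.seg d, ∀ y ∈ F.seg d', dist x y = dist x₀ y₀ →
      x ∈ F.oseg d := by
    intro d hd d' hd' x hx y hy hxy
    have key : ∀ v, Y v = M → x ≠ F.placement v := by
      rintro v hv rfl
      obtain ⟨d₂, hd₂, x₂, hx₂, hlt⟩ := hP.exists_flat_closer hG hY hM hv
        (F.seg_subset_realization _ hy) (hpos d hd d' hd' _ hx _ hy)
      rw [hxy] at hlt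
      exact absurd hlt (not_lt.2 (hmin d₂ hd₂ x₂ hx₂ d' hd' y hy))
    rcases F.mem_seg_cases hx with h | h | h
    · exact absurd h (key _ hd.2)
    · exact absurd h (key _ (flat_snd hY hd))
    · exact h
  have hvy : ∀ d ∈ A, ∀ d' ∈ B, ∀ x ∈ F.seg d, ∀ y ∈ F.seg d', dist x y = dist x₀ y₀ →
      y ∈ F.oseg d' := by
    intro d hd d' hd' x hx y hy hxy
    have key : ∀ v, Y' v = -m → y ≠ F.placement v := by
      rintro v hv rfl
      obtain ⟨d₂, hd₂, x₂, hx₂, hlt⟩ := hP.exists_flat_closer hG' hY' hm' hv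
        (F.seg_subset_realization _ hx) (hpos d hd d' hd' _ hx _ hy).symm
      rw [dist_comm x₂ x, dist_comm (F.placement v) x, hxy] at hlt
      exact absurd hlt (not_lt.2 (hmin d hd x hx d₂ hd₂ x₂ hx₂))
    rcases F.mem_seg_cases hy with h | h | h
    · exact absurd h (key _ hd'.2)
    · exact absurd h (key _ (flat_snd hY' hd'))
    · exact h
  have hxo := hvx d₀ hd₀ d₁ hd₁ x₀ hx₀ y₀ hy₀ rfl
  have hyo := hvy d₀ hd₀ d₁ hd₁ x₀ hx₀ y₀ hy₀ rfl
  obtain ⟨c, hc, hcD⟩ := F.eq_neg_perp_of_closest hF hxo (F.seg_subset_realization _ hy₀)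
    fun d' hd' z hz => hmin d' (hP.flat_of_leftFace hG hY hd₀ hd') z hz d₁ hd₁ y₀ hy₀
  obtain ⟨c', hc', hcD'⟩ := F.eq_neg_perp_of_closest hF hyo (F.seg_subset_realization _ hx₀)
    fun d' hd' z hz => by
      rw [dist_comm, dist_comm z]
      exact hmin d₀ hd₀ x₀ hx₀ d' (hP.flat_of_leftFace hG' hY' hd₁ hd') z hz
  have hne0 : y₀ - x₀ ≠ 0 := sub_ne_zero.2 (hpos d₀ hd₀ d₁ hd₁ _ hx₀ _ hy₀)
  have hc0 : 0 < c := by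
    refine lt_of_le_of_ne hc fun h => hne0 ?_
    rw [hcD, ← h, zero_smul, neg_zero]
  have hc0' : 0 < c' := by
    refine lt_of_le_of_ne hc' fun h => hne0 ?_
    rw [← neg_sub, hcD', ← h, zero_smul, neg_zero, neg_zero]
  -- Each edge is normal to the connecting segment and has its own flat face on the far side, so the
  -- two point in opposite directions.
  have hpar : c • F.vec d₀ = -(c' • F.vec d₁) := by
    have h1 : perp (c • F.vec d₀) = perp (-(c' • F.vec d₁)) := by
      rw [perp_neg, perp_smul, perp_smul, ← neg_inj, ← hcD, neg_neg, ← neg_sub, hcD', neg_neg]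
    have h2 := congrArg perp h1
    rw [perp_perp, perp_perp] at h2
    exact neg_injective h2
  obtain ⟨s, ⟨hs0, hs1⟩, hs⟩ := F.mem_oseg_iff.1 hxo
  obtain ⟨s', ⟨hs0', hs1'⟩, hs'⟩ := F.mem_oseg_iff.1 hyo
  set r := c' / c with hr
  have hrpos : 0 < r := by positivity
  have hvec : F.vec d₀ = -(r • F.vec d₁) := by
    have : F.vec d₀ = c⁻¹ • (c • F.vec d₀) := by rw [smul_smul, inv_mul_cancel₀ hc0.ne', one_smul]
    rw [this, hpar, smul_neg, smul_smul, hr, div_eq_inv_mul]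
  -- The first time at which one of the two points, moving together in the direction of `d₀`,
  -- reaches the end of `d₀` or the start of `d₁`.
  set τ := min (1 - s) (s' / r) with hτ
  have hτ0 : 0 < τ := lt_min (by linarith) (by positivity)
  have hτ1 : s + τ ≤ 1 := by linarith [min_le_left (1 - s) (s' / r)]
  have hτ2 : τ * r ≤ s' := by
    rw [← le_div_iff₀ hrpos]; exact min_le_right _ _
  have hx1 : x₀ + τ • F.vec d₀ = F.placement d₀.fst + (s + τ) • F.vec d₀ := by rw [hs]; module
  have hy1 : y₀ + τ • F.vec d₀ = F.placement d₁.fst + (s' - τ * r) • F.vec d₁ := by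
    rw [hs', hvec]; module
  have hx2 : x₀ + τ • F.vec d₀ ∈ F.seg d₀ :=
    F.mem_seg_iff.2 ⟨s + τ, ⟨by linarith, hτ1⟩, hx1⟩
  have hy2 : y₀ + τ • F.vec d₀ ∈ F.seg d₁ :=
    F.mem_seg_iff.2 ⟨s' - τ * r, ⟨by linarith, by nlinarith⟩, hy1⟩
  have hd2 : dist (x₀ + τ • F.vec d₀) (y₀ + τ • F.vec d₀) = dist x₀ y₀ := dist_add_right _ _ _
  have hx3 := hvx d₀ hd₀ d₁ hd₁ _ hx2 _ hy2 hd2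
  have hy3 := hvy d₀ hd₀ d₁ hd₁ _ hx2 _ hy2 hd2
  have huniq : ∀ (d : F.graph.Dart) (a b : ℝ),
      F.placement d.fst + a • F.vec d = F.placement d.fst + b • F.vec d → a = b := by
    intro d a b h
    exact smul_left_injective ℝ (F.vec_ne_zero d) (add_left_cancel h)
  obtain ⟨s₂, ⟨h20, h21⟩, h2⟩ := F.mem_oseg_iff.1 hx3
  obtain ⟨s₃, ⟨h30, h31⟩, h3⟩ := F.mem_oseg_iff.1 hy3
  rw [hx1] at h2
  rw [hy1] at h3
  have h2' := huniq _ _ _ h2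
  have h3' := huniq _ _ _ h3
  rcases min_choice (1 - s) (s' / r) with h | h
  · rw [← hτ] at h; linarith
  · rw [← hτ] at h
    have : τ * r = s' := by rw [h]; field_simp
    linarith

/-- A periodic function of the vertices that is affine on every face is constant. -/
theorem eq_const_of_affine (hP : F.IsPseudoTriangulation)
    (φ : F.FaceOrbit hP.nonCrossing → Plane) (y : VertexOrbit Γ V → ℝ)
    (h : ∀ δ, y (F.srcO (F.revO δ)) - y (F.srcO δ) = inner ℝ (φ (cycleMk _ δ)) (F.vecO δ)) :
    (∀ q q', y q = y q') ∧ φ = 0 := by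
  have hF := hP.nonCrossing
  let G : F.graph.Dart → Plane := fun d => φ (cycleMk _ (F.dmk d))
  let Y : V → ℝ := fun v => y (F.vmk v)
  have hG : ∀ d, G (F.nxt hP.nonCrossing d) = G d := fun d => by
    simp only [G, ← F.nxtO_mk hP.nonCrossing, cycleMk_apply]
  have hY : ∀ d, Y d.snd - Y d.fst = inner ℝ (G d) (F.vec d) := fun d => h (F.dmk d)
  have := F.finite_vertexOrbit
  have hne : Nonempty (VertexOrbit Γ V) := F.connected.nonempty.map F.vmk
  obtain ⟨qM, hM⟩ := Finite.exists_max y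
  obtain ⟨qm, hm⟩ := Finite.exists_min y
  obtain ⟨a, ha⟩ := F.vmk_surj qM
  obtain ⟨b, hb⟩ := F.vmk_surj qm
  have hMm := hP.eq_of_affine hG hY (fun g d => by simp only [G, F.dmk_vadd])
    (fun g v => by simp only [Y, F.vmk_vadd]) (fun v => hM _) (fun v => hm _)
    (congrArg y ha) (congrArg y hb)
  have hconst : ∀ q q', y q = y q' := fun q q' =>
    le_antisymm (by linarith [hM q, hm q']) (by linarith [hM q', hm q])
  refine ⟨hconst, ?_⟩
  ext1 o
  obtain ⟨δ, rfl⟩ := cycleMk_surj _ o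
  have h1 := h δ
  have h2 := h (F.nxtO hF δ)
  rw [hconst _ (F.srcO δ), sub_self] at h1
  rw [hconst _ (F.srcO (F.nxtO hF δ)), sub_self, cycleMk_apply] at h2
  refine eq_zero_of_inner_eq_zero (a := F.vecO δ) (b := F.vecO (F.nxtO hF δ)) ?_ h1.symm h2.symm
  obtain ⟨d, rfl⟩ := F.dmk_surj δ
  by_cases hc : 0 < det2 (F.vec d) (F.vec (F.nxt hF d))
  · exact hc.ne'
  · exact (hP.det2_nxt_neg hc).1.ne

end IsPseudoTriangulation

end PeriodicFramework
end PeriodicRigidity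
end

noncomputable section
namespace PeriodicRigidity

/-! ### Functionals vanishing on a subspace of codimension one -/

theorem exists_combination {E : Type*} [AddCommGroup E] [Module ℝ E] [FiniteDimensional ℝ E]
    {R Z : Submodule ℝ E} (hRZ : R ≤ Z) (hdim : Module.finrank ℝ Z ≤ Module.finrank ℝ R + 1)
    {u v : E} (hu : u ∈ Z) (hv : v ∈ Z) : ∃ a b : ℝ, (a ≠ 0 ∨ b ≠ 0) ∧ a • u + b • v ∈ R := by
  by_cases h : u ∈ R
  · exact ⟨1, 0, Or.inl one_ne_zero, by simpa using h⟩
  have h1 : R ⊔ ℝ ∙ u ≤ Z := sup_le hRZ ((Submodule.span_singleton_le_iff_mem _ _).2 hu)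
  have h2 : Module.finrank ℝ R < Module.finrank ℝ (R ⊔ ℝ ∙ u : Submodule ℝ E) := by
    refine Submodule.finrank_lt_finrank_of_lt (lt_of_le_of_ne le_sup_left fun he => h ?_)
    rw [he]
    exact Submodule.mem_sup_right (Submodule.mem_span_singleton_self u)
  have h3 : R ⊔ ℝ ∙ u = Z := Submodule.eq_of_le_of_finrank_le h1 (by omega)
  rw [← h3] at hv
  obtain ⟨r, hr, w, hw, hrw⟩ := Submodule.mem_sup.1 hv
  obtain ⟨c, rfl⟩ := Submodule.mem_span_singleton.1 hw
  refine ⟨-c, 1, Or.inr one_ne_zero, ?_⟩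
  rw [← hrw, one_smul, neg_smul, add_comm r, neg_add_cancel_left]
  exact hr

/-- Functionals on `Z` that vanish on `R` are functionals on a quotient of dimension at most one, so
any two are dependent; a vector where one of them is nonzero supplies the coefficients. -/
theorem exists_combination_functional {E : Type*} [AddCommGroup E] [Module ℝ E]
    [FiniteDimensional ℝ E] {R Z : Submodule ℝ E} (hRZ : R ≤ Z)
    (hdim : Module.finrank ℝ Z ≤ Module.finrank ℝ R + 1) {l l' : E →ₗ[ℝ] ℝ}
    (hl : ∀ x ∈ R, l x = 0) (hl' : ∀ x ∈ R, l' x = 0) :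
    ∃ a b : ℝ, (a ≠ 0 ∨ b ≠ 0) ∧ ∀ x ∈ Z, a * l x + b * l' x = 0 := by
  by_cases h : ∃ z ∈ Z, l z ≠ 0 ∨ l' z ≠ 0
  · obtain ⟨z, hz, hlz⟩ := h
    refine ⟨l' z, -l z, by rw [neg_ne_zero]; exact hlz.symm, fun x hx => ?_⟩
    obtain ⟨a, b, hab, hR⟩ := exists_combination hRZ hdim hz hx
    have h1 := hl _ hR
    have h2 := hl' _ hR
    simp only [map_add, map_smul, smul_eq_mul] at h1 h2
    have hb : b ≠ 0 := by
      rintro rfl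
      have ha : a ≠ 0 := by simpa using hab
      rcases hlz with h | h
      · exact h (by simpa [ha] using h1)
      · exact h (by simpa [ha] using h2)
    apply mul_left_cancel₀ hb
    linear_combination l' z * h1 - l z * h2
  · push Not at h
    exact ⟨1, 0, Or.inl one_ne_zero, fun x hx => by simp [(h x hx).1]⟩

namespace PeriodicFramework

variable {V Γ : Type*} [AddCommGroup Γ] [AddAction Γ V] (F : PeriodicFramework V Γ)

/-! ### Angular velocities of the edges -/

/-- The variation of the vectors of the edges. -/
def varO (x : displacements V Γ) : F.DartOrbit → Plane :=
  F.liftDart (fun d => x.1.1 d.snd - x.1.1 d.fst) fun g d => by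
    rw [vadd_snd, vadd_fst, x.2, x.2, add_sub_add_right_eq_sub]

@[simp] theorem varO_mk (x : displacements V Γ) (d : F.graph.Dart) :
    F.varO x (F.dmk d) = x.1.1 d.snd - x.1.1 d.fst := rfl

theorem varO_revO (x : displacements V Γ) (δ : F.DartOrbit) :
    F.varO x (F.revO δ) = -F.varO x δ := by
  obtain ⟨d, rfl⟩ := F.dmk_surj δ
  rw [revO_mk, varO_mk, varO_mk, neg_sub]; rfl

theorem mem_infinitesimalMotions {x : displacements V Γ} :
    x ∈ F.infinitesimalMotions ↔ ∀ u v, F.graph.Adj u v → F.stretch x u v = 0 := by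
  rw [infinitesimalMotions, LinearMap.mem_ker]
  constructor
  · intro h u v huv
    exact congrFun h (Quotient.mk _ ⟨s(u, v), huv⟩)
  · intro h
    ext β
    induction β using Quotient.inductionOn with
    | h e =>
      obtain ⟨e, he⟩ := e
      induction e with
      | h u v => exact h u v he

/-- The angular velocity of an edge. -/
def spin (x : displacements V Γ) (δ : F.DartOrbit) : ℝ :=
  inner ℝ (F.varO x δ) (perp (F.vecO δ)) / ‖F.vecO δ‖ ^ 2

theorem varO_eq {x : displacements V Γ} (hx : x ∈ F.infinitesimalMotions) (δ : F.DartOrbit) :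
    F.varO x δ = F.spin x δ • perp (F.vecO δ) := by
  refine eq_smul_perp (F.vecO_ne_zero δ) ?_
  obtain ⟨d, rfl⟩ := F.dmk_surj δ
  rw [real_inner_comm]
  exact F.mem_infinitesimalMotions.1 hx _ _ d.adj

theorem spin_revO (x : displacements V Γ) (δ : F.DartOrbit) :
    F.spin x (F.revO δ) = F.spin x δ := by
  simp [spin, varO_revO, perp_neg]

/-- Affine functions on the faces and values at the vertices, compared along the edges. -/
def liftMap (hF : F.NonCrossing) :
    (F.FaceOrbit hF → Plane) × (VertexOrbit Γ V → ℝ) →ₗ[ℝ] (F.DartOrbit → ℝ) where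
  toFun p δ := inner ℝ (p.1 (cycleMk _ δ)) (F.vecO δ) -
    (p.2 (F.srcO (F.revO δ)) - p.2 (F.srcO δ))
  map_add' p q := by
    ext δ
    simp only [Prod.fst_add, Prod.snd_add, Pi.add_apply, inner_add_left]; ring
  map_smul' r p := by
    ext δ
    simp only [Prod.smul_fst, Prod.smul_snd, Pi.smul_apply, inner_smul_left, smul_eq_mul,
      RingHom.id_apply, conj_trivial]; ring

variable {F}

namespace IsPseudoTriangulation

/-- Along one face the gradient is constant and the edge vectors add up to zero, while the
differences of heights telescope. -/
theorem range_liftMap_le (hP : F.IsPseudoTriangulation) :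
    LinearMap.range (F.liftMap hP.nonCrossing) ≤ LinearMap.ker (cycleSum (F.nxtO hP.nonCrossing)) := by
  classical
  rintro _ ⟨⟨φ, y⟩, rfl⟩
  rw [LinearMap.mem_ker]
  have h1 : F.liftMap hP.nonCrossing (φ, y) =
      (fun δ => inner ℝ (φ (cycleMk _ δ)) (F.vecO δ)) -
        ((fun δ => y (F.srcO (F.nxtO hP.nonCrossing δ))) - (fun δ => y (F.srcO δ))) := by
    ext δ
    simp [liftMap]
  rw [h1, map_sub, map_sub, cycleSum_comp _ (fun δ => y (F.srcO δ)), sub_self, sub_zero]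
  ext o
  have h2 := congrFun (hP.cycleSum_vecO (innerₛₗ ℝ (φ o))) o
  rw [cycleSum_apply] at h2 ⊢
  refine Eq.trans (Finset.sum_congr rfl fun δ hδ => ?_) h2
  rw [(Finset.mem_filter.1 hδ).2]; rfl

/-- The kernel of `cycleSum` has dimension 2m − f = 2f + n. The source of `liftMap` has the same
dimension 2f + n, and its kernel is at most the line of constant heights. -/
theorem finrank_ker_le (hP : F.IsPseudoTriangulation) :
    Module.finrank ℝ (LinearMap.ker (cycleSum (F.nxtO hP.nonCrossing))) ≤
      Module.finrank ℝ (LinearMap.range (F.liftMap hP.nonCrossing)) + 1 := by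
  have := F.finite_vertexOrbit
  have := Fintype.ofFinite (VertexOrbit Γ V)
  have h1 : _ + Fintype.card (F.FaceOrbit hP.nonCrossing) = _ :=
    finrank_ker_cycleSum (F.nxtO hP.nonCrossing)
  have h2 := LinearMap.finrank_range_add_finrank_ker (F.liftMap hP.nonCrossing)
  have h3 : Module.finrank ℝ (LinearMap.ker (F.liftMap hP.nonCrossing)) ≤ 1 := by
    have hle : LinearMap.ker (F.liftMap hP.nonCrossing) ≤ ℝ ∙ ((0 : F.FaceOrbit hP.nonCrossing →
        Plane), (fun _ => 1 : VertexOrbit Γ V → ℝ)) := by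
      rintro ⟨φ, y⟩ h
      obtain ⟨hy, hφ⟩ := hP.eq_const_of_affine φ y fun δ => by
        have := congrFun h δ
        simp only [liftMap, LinearMap.coe_mk, AddHom.coe_mk, Pi.zero_apply] at this
        linarith
      obtain ⟨v⟩ := F.connected.nonempty
      refine Submodule.mem_span_singleton.2 ⟨y (F.vmk v), ?_⟩
      ext1
      · simp [hφ]
      · ext q
        simpa using hy _ _
    exact (Submodule.finrank_mono hle).trans ((finrank_span_le_card _).trans (by simp))
  have h4 := hP.card_eq
  rw [← F.card_dartOrbit, Nat.card_eq_fintype_card] at h4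
  have h5 : Module.finrank ℝ ((F.FaceOrbit hP.nonCrossing → Plane) × (VertexOrbit Γ V → ℝ)) =
      2 * Fintype.card (F.FaceOrbit hP.nonCrossing) + Fintype.card (VertexOrbit Γ V) := by
    rw [Module.finrank_prod, Module.finrank_pi_fintype]
    simp [mul_comm]
  omega

/-- The functional on functions of directed edges given by the angular velocities. -/
def spinFunctional (F : PeriodicFramework V Γ) (x : displacements V Γ) :
    (F.DartOrbit → ℝ) →ₗ[ℝ] ℝ where
  toFun f := ∑ δ, F.spin x δ * f δ
  map_add' f g := by simp [mul_add, Finset.sum_add_distrib]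
  map_smul' r f := by simp [Finset.mul_sum, mul_left_comm]

theorem spinFunctional_apply (x : displacements V Γ) (f : F.DartOrbit → ℝ) :
    spinFunctional F x f = ∑ δ, F.spin x δ * f δ := rfl

theorem inner_eq_spin {x : displacements V Γ} (hx : x ∈ F.infinitesimalMotions) (w : Plane)
    (δ : F.DartOrbit) :
    F.spin x δ * inner ℝ w (F.vecO δ) = inner ℝ (perp w) (F.varO x δ) := by
  rw [F.varO_eq hx, inner_smul_right, inner_eq, inner_eq]
  simp only [perp_zero_coord, perp_one_coord]
  ring

theorem cycleSum_varO (hP : F.IsPseudoTriangulation) (x : displacements V Γ) (l : Plane →ₗ[ℝ] ℝ) :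
    cycleSum (F.nxtO hP.nonCrossing) (fun δ => l (F.varO x δ)) = 0 := by
  ext o
  obtain ⟨δ, rfl⟩ := cycleMk_surj _ o
  obtain ⟨d, rfl⟩ := F.dmk_surj δ
  obtain ⟨k, hk, -⟩ := hP.exists_faceCycle d
  have h : ∀ i, F.varO x (F.dmk ((F.nxt hP.nonCrossing)^[i] d)) =
      x.1.1 ((F.nxt hP.nonCrossing)^[i + 1] d).fst -
        x.1.1 ((F.nxt hP.nonCrossing)^[i] d).fst := by
    intro i
    rw [Function.iterate_succ_apply', F.nxt_fst]
    rfl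
  simp only [hP.cycleSum_eq hk, h, map_sub]
  rw [Finset.sum_range_sub (fun i => l (x.1.1 ((F.nxt hP.nonCrossing)^[i] d).fst)), hk.closed]
  simp

/-- Angular velocity times a slope is the variation of the edge paired with a rotated gradient,
which telescopes around a face. The terms with vertex heights cancel because an edge and its
reversal have the same angular velocity. -/
theorem spinFunctional_liftMap (hP : F.IsPseudoTriangulation) {x : displacements V Γ}
    (hx : x ∈ F.infinitesimalMotions) :
    ∀ f ∈ LinearMap.range (F.liftMap hP.nonCrossing), spinFunctional F x f = 0 := by
  classical
  rintro _ ⟨⟨φ, y⟩, rfl⟩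
  have h1 : ∑ δ, F.spin x δ * inner ℝ (φ (cycleMk _ δ)) (F.vecO δ) = 0 := by
    rw [← sum_cycleSum (F.nxtO hP.nonCrossing)]
    refine Finset.sum_eq_zero fun o _ => ?_
    have h2 := congrFun (hP.cycleSum_varO x (innerₛₗ ℝ (perp (φ o)))) o
    rw [cycleSum_apply] at h2 ⊢
    refine Eq.trans (Finset.sum_congr rfl fun δ hδ => ?_) h2
    rw [inner_eq_spin hx, (Finset.mem_filter.1 hδ).2]; rfl
  have h2 : ∑ δ, F.spin x δ * y (F.srcO (F.revO δ)) = ∑ δ, F.spin x δ * y (F.srcO δ) := by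
    rw [← F.sum_revO fun δ => F.spin x δ * y (F.srcO δ)]
    simp only [F.spin_revO]
  rw [spinFunctional_apply]
  simp only [liftMap, LinearMap.coe_mk, AddHom.coe_mk, mul_sub, Finset.sum_sub_distrib]
  rw [h1, h2]
  simp

/-- Except at the reflex angle, the rotation moves counter-clockwise inside a half-plane; so the
edge of largest angle violating the claim would have a successor violating it too. -/
theorem eq_of_rot_invariant (hP : F.IsPseudoTriangulation) {E : Type*} {H : F.graph.Dart → E}
    (hrot : ∀ d, H (F.rot d) = H d) {d d' : F.graph.Dart} (h : d.fst = d'.fst) : H d = H d' := by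
  obtain ⟨d₀, h0, -, hd₀⟩ := hP.existsUnique_reflex d.fst
  obtain ⟨w, hw⟩ := hP.pointed d.fst
  have key : ∀ d' : F.graph.Dart, d'.fst = d.fst → H d' = H d₀ := by
    intro d' hd'
    by_contra hne
    obtain ⟨d₁, ⟨h1, h1'⟩, hmax⟩ := Set.exists_max_image {d₁ | d₁ ∈ F.outDarts d.fst ∧ H d₁ ≠ H d₀}
      (fun d₁ => halfAngle w (F.vec d₁))
      ((F.finite_outDarts d.fst).subset fun _ h => h.1) ⟨d', hd', hne⟩
    have h1f : d₁.fst = d.fst := h1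
    have h2 : d₁ ≠ d₀ := fun h => h1' (by rw [h])
    have h3 := hd₀ d₁ h1f h2
    have hw' : ∀ d' : F.graph.Dart, d'.fst = d.fst → 0 < inner ℝ w (F.vec d') := by
      intro d' h
      have := hw d'.snd (by rw [← h]; exact d'.adj)
      rwa [← h] at this
    have h4 := halfAngle_lt (hw' _ h1f) (hw' _ ((F.rot_fst d₁).trans h1f)) h3
    refine absurd (hmax (F.rot d₁) ⟨(F.rot_fst d₁).trans h1f, ?_⟩) (not_le.2 h4)
    rwa [hrot]
  rw [key d rfl, key d' h.symm]

theorem eq_of_invariant (hP : F.IsPseudoTriangulation) {E : Type*} {H : F.graph.Dart → E}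
    (hnxt : ∀ d, H (F.nxt hP.nonCrossing d) = H d) (hsymm : ∀ d, H d.symm = H d)
    (d d' : F.graph.Dart) : H d = H d' := by
  have hrot : ∀ d, H (F.rot d) = H d := fun d => by
    rw [← hsymm, ← hnxt, F.nxt_rot_symm]
  have hreach : ∀ u v, F.graph.Reachable u v → ∀ d d' : F.graph.Dart, d.fst = u → d'.fst = v →
      H d = H d' := by
    rintro u v ⟨p⟩
    induction p with
    | nil => exact fun d d' h h' => hP.eq_of_rot_invariant hrot (h.trans h'.symm)
    | cons hadj p ih =>
      intro d d' h h'
      let e : F.graph.Dart := ⟨(_, _), hadj⟩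
      rw [hP.eq_of_rot_invariant hrot (d' := e) h, ← hsymm e]
      exact ih e.symm d' rfl h'
  exact hreach _ _ (F.connected.preconnected d.fst d'.fst) d d' rfl rfl

theorem isTrivial_of_spin (x : displacements V Γ) (c : ℝ)
    (h : ∀ δ, F.varO x δ = c • perp (F.vecO δ)) : F.IsTrivial x := by
  obtain ⟨v₀⟩ := F.connected.nonempty
  have hreach : ∀ u v, F.graph.Reachable u v →
      x.1.1 v - x.1.1 u = c • perp (F.placement v - F.placement u) := by
    rintro u v ⟨p⟩
    induction p with
    | nil => simp [perp_zero]
    | cons hadj p ih =>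
      have h1 := h (F.dmk ⟨(_, _), hadj⟩)
      simp only [varO_mk, vecO_mk, vec] at h1
      rw [← sub_add_sub_cancel, ih, h1, ← smul_add, ← perp_add, sub_add_sub_cancel]
  refine ⟨x.1.1 v₀ - c • perp (F.placement v₀), c, fun v => ?_, fun g => ?_⟩
  · have := hreach v₀ v (F.connected.preconnected _ _)
    rw [perp_sub, smul_sub] at this
    rw [sub_add_eq_add_sub, add_sub_assoc, ← this]
    abel
  · have := hreach v₀ (g +ᵥ v₀) (F.connected.preconnected _ _)
    rwa [F.placement_vadd, add_sub_cancel_left, x.2, add_sub_cancel_left] at this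

/-- Up to trivial motions there is at most one infinitesimal motion. -/
theorem exists_combination_isTrivial (hP : F.IsPseudoTriangulation) {x x' : displacements V Γ}
    (hx : x ∈ F.infinitesimalMotions) (hx' : x' ∈ F.infinitesimalMotions) :
    ∃ a b : ℝ, (a ≠ 0 ∨ b ≠ 0) ∧ F.IsTrivial (a • x + b • x') := by
  classical
  obtain ⟨a, b, hab, h⟩ := exists_combination_functional hP.range_liftMap_le hP.finrank_ker_le
    (hP.spinFunctional_liftMap hx) (hP.spinFunctional_liftMap hx')
  refine ⟨a, b, hab, ?_⟩
  set ν := F.nxtO hP.nonCrossing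
  let η : F.DartOrbit → ℝ := fun δ => a * F.spin x δ + b * F.spin x' δ
  have hη : ∀ f ∈ LinearMap.ker (cycleSum ν), ∑ δ, η δ * f δ = 0 := by
    intro f hf
    have := h f hf
    simp only [spinFunctional_apply, Finset.mul_sum, ← Finset.sum_add_distrib] at this
    rw [← this]
    exact Finset.sum_congr rfl fun δ _ => by simp only [η]; ring
  have hν : ∀ δ, η (ν δ) = η δ := by
    intro δ
    -- The test function is the indicator of `ν δ` minus that of `δ`, which has zero sum around
    -- every face.
    have h1 := hη (Pi.single (ν δ) 1 - fun δ' => (Pi.single (ν δ) 1 : F.DartOrbit → ℝ) (ν δ')) (by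
      rw [LinearMap.mem_ker, map_sub, cycleSum_comp, sub_self])
    simp only [Pi.sub_apply, mul_sub, Finset.sum_sub_distrib, Pi.single_apply,
      EmbeddingLike.apply_eq_iff_eq] at h1
    simpa [sub_eq_zero] using h1
  have hrev : ∀ δ, η (F.revO δ) = η δ := fun δ => by simp only [η, F.spin_revO]
  obtain ⟨v⟩ := F.connected.nonempty
  obtain ⟨u, hu⟩ := F.exists_adj v
  refine isTrivial_of_spin _ (η (F.dmk ⟨(v, u), hu⟩)) fun δ => ?_
  obtain ⟨d, rfl⟩ := F.dmk_surj δ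
  rw [hP.eq_of_invariant (H := fun d => η (F.dmk d)) (fun d => hν (F.dmk d))
    (fun d => hrev (F.dmk d)) ⟨(v, u), hu⟩ d]
  have h1 : F.varO (a • x + b • x') (F.dmk d) = a • F.varO x (F.dmk d) + b • F.varO x' (F.dmk d) := by
    simp only [varO_mk, Submodule.coe_add, Submodule.coe_smul, Prod.fst_add, Prod.smul_fst,
      Pi.add_apply, Pi.smul_apply]
    module
  rw [h1, F.varO_eq hx, F.varO_eq hx', smul_smul, smul_smul, ← add_smul]

/-! ### The expansion functional -/

/-- Each coordinate of the edge vectors has zero sum around every face, hence integrates along the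
walk. Such a choice of origins replaces an absolute position, which does not exist on the quotient.
-/
theorem exists_base (hP : F.IsPseudoTriangulation) : ∃ Φ : F.DartOrbit → Plane,
    ∀ δ, Φ (F.nxtO hP.nonCrossing δ) = Φ δ - F.vecO δ := by
  have h : ∀ i : Fin 2, ∃ f : F.DartOrbit → ℝ, ∀ δ, f (F.nxtO hP.nonCrossing δ) - f δ =
      -(F.vecO δ i) := fun i => exists_sub_eq _ (hP.cycleSum_vecO (-(EuclideanSpace.proj i : Plane →L[ℝ] ℝ).toLinearMap))
  choose f hf using h
  refine ⟨fun δ => !₂[f 0 δ, f 1 δ], fun δ => plane_ext ?_ ?_⟩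
  · have := hf 0 δ
    simp
    linarith
  · have := hf 1 δ
    simp
    linarith

/-- A choice of the position of an origin relative to the initial vertex of the directed edges of
each face. -/
def base (hP : F.IsPseudoTriangulation) : F.DartOrbit → Plane := hP.exists_base.choose

theorem base_nxtO (hP : F.IsPseudoTriangulation) (δ : F.DartOrbit) :
    hP.base (F.nxtO hP.nonCrossing δ) = hP.base δ - F.vecO δ := hP.exists_base.choose_spec δ

/-- The change along the edges of a function that is affine on the faces, minus half of the squared
distance to the origin. -/
def baseO (hP : F.IsPseudoTriangulation) (δ : F.DartOrbit) : ℝ :=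
  inner ℝ (hP.base δ) (F.vecO δ) - ‖F.vecO δ‖ ^ 2 / 2

/-- Expanding the square shows that this function is the increment of −‖base‖²/2 along the walk. -/
theorem cycleSum_baseO (hP : F.IsPseudoTriangulation) :
    cycleSum (F.nxtO hP.nonCrossing) hP.baseO = 0 := by
  have h : hP.baseO = (fun δ => -‖hP.base (F.nxtO hP.nonCrossing δ)‖ ^ 2 / 2) -
      fun δ => -‖hP.base δ‖ ^ 2 / 2 := by
    ext δ
    simp only [baseO, Pi.sub_apply]
    rw [hP.base_nxtO, @norm_sub_sq_real]
    ring
  rw [h, map_sub, cycleSum_comp _ (fun δ => -‖hP.base δ‖ ^ 2 / 2), sub_self]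

open Classical in
/-- The part of the boundary of a face between two of its vertices. -/
def arc (hF : F.NonCrossing) (d : F.graph.Dart) (j : ℕ) : Finset F.DartOrbit :=
  (Finset.range j).image fun i => F.dmk ((F.nxt hF)^[i] d)

open Classical in
/-- A crease along the chord of a face. -/
def crease (hF : F.NonCrossing) (d : F.graph.Dart) (j : ℕ) (δ : F.DartOrbit) : Plane :=
  if δ ∈ arc hF d j then perp (F.placement ((F.nxt hF)^[j] d).fst - F.placement d.fst) else 0

theorem sum_arc (hP : F.IsPseudoTriangulation) {d : F.graph.Dart} {k j : ℕ}
    (hk : FaceCycle hP.nonCrossing d k) (hj : j < k) (f : F.DartOrbit → ℝ) :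
    ∑ δ ∈ arc hP.nonCrossing d j, f δ =
      ∑ i ∈ Finset.range j, f (F.dmk ((F.nxt hP.nonCrossing)^[i] d)) := by
  classical
  rw [arc, Finset.sum_image]
  intro i hi i' hi' h
  have h1 := Finset.mem_range.1 hi
  have h2 := Finset.mem_range.1 hi'
  exact hP.dmk_iterate_inj hk (h1.trans hj) (h2.trans hj) h

theorem sum_range_sub_fst (hF : F.NonCrossing) {E : Type*} [AddCommGroup E] (u : V → E)
    (d : F.graph.Dart) (j : ℕ) : ∑ i ∈ Finset.range j, (u ((F.nxt hF)^[i] d).snd -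
      u ((F.nxt hF)^[i] d).fst) = u ((F.nxt hF)^[j] d).fst - u d.fst := by
  refine Eq.trans ?_ (Finset.sum_range_sub (fun i => u ((F.nxt hF)^[i] d).fst) j)
  refine Finset.sum_congr rfl fun i _ => ?_
  rw [Function.iterate_succ_apply', F.nxt_fst]

/-- The edges of the arc add up to the chord, and the gradient put on the arc is perpendicular to
the chord. -/
theorem cycleSum_crease (hP : F.IsPseudoTriangulation) {d : F.graph.Dart} {k j : ℕ}
    (hk : FaceCycle hP.nonCrossing d k) (hj : j < k) :
    cycleSum (F.nxtO hP.nonCrossing)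
      (fun δ => inner ℝ (crease hP.nonCrossing d j δ) (F.vecO δ)) = 0 := by
  classical
  have hF := hP.nonCrossing
  set w := perp (F.placement ((F.nxt hF)^[j] d).fst - F.placement d.fst) with hw
  have htot : ∑ δ ∈ arc hF d j, inner ℝ w (F.vecO δ) = 0 := by
    rw [hP.sum_arc hk hj, ← inner_sum]
    have := sum_range_sub_fst hF F.placement d j
    simp only [vecO_mk, vec]
    rw [this, hw, inner_perp, det2_self]
  ext o
  rw [cycleSum_apply, Finset.sum_filter]
  have h1 : ∀ δ, (if cycleMk (F.nxtO hF) δ = o then inner ℝ (crease hF d j δ) (F.vecO δ) else 0) =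
      if δ ∈ arc hF d j then
        (if cycleMk (F.nxtO hF) (F.dmk d) = o then inner ℝ w (F.vecO δ) else 0) else 0 := by
    intro δ
    by_cases hδ : δ ∈ arc hF d j
    · have h2 : cycleMk (F.nxtO hF) δ = cycleMk (F.nxtO hF) (F.dmk d) := by
        obtain ⟨i, -, rfl⟩ := Finset.mem_image.1 hδ
        rw [eq_comm, cycleMk_eq, F.sameCycle_iff]
        exact ⟨i, F.nxtO_iterate_mk hF i d⟩
      rw [h2, crease, if_pos hδ, if_pos hδ]
    · rw [crease, if_neg hδ, if_neg hδ]
      simp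
  simp only [h1]
  rw [Finset.sum_ite_mem, Finset.univ_inter]
  by_cases ho : cycleMk (F.nxtO hF) (F.dmk d) = o
  · simp only [if_pos ho, htot]; rfl
  · simp [if_neg ho]

/-- On the arc the pairing turns into the variations of the edges paired with the twice rotated
chord; they add up to the variation of the chord, and the double rotation gives the minus sign. -/
theorem spinFunctional_crease (hP : F.IsPseudoTriangulation) {d : F.graph.Dart} {k j : ℕ}
    (hk : FaceCycle hP.nonCrossing d k) (hj : j < k) {x : displacements V Γ}
    (hx : x ∈ F.infinitesimalMotions) :
    spinFunctional F x (fun δ => inner ℝ (crease hP.nonCrossing d j δ) (F.vecO δ)) =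
      -F.stretch x d.fst ((F.nxt hP.nonCrossing)^[j] d).fst := by
  classical
  have hF := hP.nonCrossing
  set w := perp (F.placement ((F.nxt hF)^[j] d).fst - F.placement d.fst) with hw
  have h1 : ∀ δ, F.spin x δ * inner ℝ (crease hF d j δ) (F.vecO δ) =
      if δ ∈ arc hF d j then inner ℝ (perp w) (F.varO x δ) else 0 := by
    intro δ
    by_cases hδ : δ ∈ arc hF d j
    · rw [crease, if_pos hδ, if_pos hδ, inner_eq_spin hx]
    · rw [crease, if_neg hδ, if_neg hδ]; simp
  rw [spinFunctional_apply]
  simp only [h1]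
  rw [Finset.sum_ite_mem, Finset.univ_inter, hP.sum_arc hk hj, ← inner_sum]
  have := sum_range_sub_fst hF x.1.1 d j
  simp only [varO_mk]
  rw [this, hw, perp_perp, inner_neg_left]; rfl

/-- The expansion of an infinitesimal motion. -/
def expansion (hP : F.IsPseudoTriangulation) (x : displacements V Γ) : ℝ :=
  spinFunctional F x hP.baseO

/-- Every chord of a face is the crease of a piecewise linear function, up to a multiple of the
squared distance to the origin. -/
theorem exists_crease_lift (hP : F.IsPseudoTriangulation) {d : F.graph.Dart} {k j : ℕ}
    (hk : FaceCycle hP.nonCrossing d k) (hj : j < k) :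
    ∃ (κ t : ℝ) (φ : F.FaceOrbit hP.nonCrossing → Plane) (y : VertexOrbit Γ V → ℝ),
      (κ ≠ 0 ∨ t ≠ 0) ∧
      (∀ δ, y (F.srcO (F.revO δ)) - y (F.srcO δ) = inner ℝ (κ • hP.base δ +
        t • crease hP.nonCrossing d j δ + φ (cycleMk _ δ)) (F.vecO δ) - κ * ‖F.vecO δ‖ ^ 2 / 2) ∧
      ∀ x ∈ F.infinitesimalMotions, κ * hP.expansion x =
        t * F.stretch x d.fst ((F.nxt hP.nonCrossing)^[j] d).fst := by
  obtain ⟨κ, t, h0, ⟨φ, y⟩, h⟩ := exists_combination hP.range_liftMap_le hP.finrank_ker_le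
    (LinearMap.mem_ker.2 hP.cycleSum_baseO) (LinearMap.mem_ker.2 (hP.cycleSum_crease hk hj))
  refine ⟨κ, t, -φ, -y, h0, fun δ => ?_, fun x hx => ?_⟩
  · have := congrFun h δ
    simp only [liftMap, LinearMap.coe_mk, AddHom.coe_mk, Pi.add_apply, Pi.smul_apply, smul_eq_mul,
      baseO] at this
    simp only [inner_add_left, inner_smul_left, Pi.neg_apply, inner_neg_left, conj_trivial]
    linarith
  · have h1 := hP.spinFunctional_liftMap hx _ ⟨(φ, y), h⟩
    rw [map_add, map_smul, map_smul, hP.spinFunctional_crease hk hj hx, smul_eq_mul,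
      smul_eq_mul] at h1
    rw [expansion]
    linarith

end IsPseudoTriangulation

end PeriodicFramework
end PeriodicRigidity
end

/-! ### Chords of faces, and the sign of the crease in a lift. -/

noncomputable section
namespace PeriodicRigidity
namespace PeriodicFramework

variable {V Γ : Type*} [AddCommGroup Γ] [AddAction Γ V] (F : PeriodicFramework V Γ)

/-! ### Insertion of a chord of a face -/

section Insert

variable {a b : V} (hab : F.placement a ≠ F.placement b)

/-- A directed edge after the insertion of an edge orbit. -/
def ins (d : F.graph.Dart) : (F.insertEdge a b hab).graph.Dart := ⟨d.toProd, Or.inl d.adj⟩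

/-- The inserted edge, directed from `a` to `b`. -/
def chord : (F.insertEdge a b hab).graph.Dart := ⟨(a, b), F.insertEdge_adj a b hab⟩

theorem ins_injective : Function.Injective (F.ins hab) := fun _ _ h =>
  F.dart_ext (congrArg (fun d => d.fst) h) (congrArg (fun d => d.snd) h)

theorem ins_symm (d : F.graph.Dart) : (F.ins hab d).symm = F.ins hab d.symm := rfl

theorem dart_insert_cases (D : (F.insertEdge a b hab).graph.Dart) : (∃ d, D = F.ins hab d) ∨
    (∃ g : Γ, D = g +ᵥ F.chord hab) ∨ ∃ g : Γ, D = g +ᵥ (F.chord hab).symm := by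
  obtain ⟨⟨u, v⟩, h⟩ := D
  have h' : F.graph.Adj u v ∨ (SimpleGraph.fromEdgeSet (pairOrbit Γ a b)).Adj u v := h
  rw [SimpleGraph.fromEdgeSet_adj] at h'
  rcases h' with h' | ⟨⟨g, h'⟩, -⟩
  · exact Or.inl ⟨⟨(u, v), h'⟩, rfl⟩
  · rcases Sym2.eq_iff.1 h' with ⟨rfl, rfl⟩ | ⟨rfl, rfl⟩
    · exact Or.inr (Or.inl ⟨g, rfl⟩)
    · exact Or.inr (Or.inr ⟨g, rfl⟩)

theorem chord_ne_ins (hadj : ¬ F.graph.Adj a b) (d : F.graph.Dart) :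
    F.ins hab d ≠ F.chord hab := fun h => by
  apply hadj
  have h1 : d.fst = a := congrArg (fun d => d.fst) h
  have h2 : d.snd = b := congrArg (fun d => d.snd) h
  rw [← h1, ← h2]
  exact d.adj

theorem chord_symm_ne_ins (hadj : ¬ F.graph.Adj a b) (d : F.graph.Dart) :
    F.ins hab d ≠ (F.chord hab).symm := fun h => by
  refine F.chord_ne_ins hab hadj d.symm ?_
  rw [← F.ins_symm, h, SimpleGraph.Dart.symm_symm]

theorem realization_subset_insert : F.realization ⊆ (F.insertEdge a b hab).realization := by
  rintro x ⟨u, v, h, hx⟩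
  exact ⟨u, v, Or.inl h, hx⟩

variable {hab} in
-- An old edge that comes first among all edges, old and inserted, also comes first among the old
-- ones.
theorem nxt_eq_of_nxt_ins (hF : F.NonCrossing) (h1 : (F.insertEdge a b hab).NonCrossing)
    {d c : F.graph.Dart} (h : (F.insertEdge a b hab).nxt h1 (F.ins hab d) = F.ins hab c) :
    F.nxt hF d = c := by
  have h2 : (F.insertEdge a b hab).rot (F.ins hab c) = F.ins hab d.symm := by
    rw [← h, rot_nxt, F.ins_symm]
  have hfst : d.symm.fst = c.fst := by
    have := (F.insertEdge a b hab).rot_fst (F.ins hab c)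
    rw [h2] at this
    exact this
  apply F.rot_injective hF
  rw [F.rot_nxt]
  symm
  refine hF.eq_of_ang_eq ((F.rot_fst c).trans hfst.symm) (F.vec_ne_zero c) (le_antisymm ?_ ?_)
  · exact F.ang_rot_le hfst
  · have := (F.insertEdge a b hab).ang_rot_le (d := F.ins hab c) (d' := F.ins hab (F.rot c))
      (F.rot_fst c)
    rwa [h2] at this

theorem leftFace_ins_subset (hF : F.NonCrossing) (h1 : (F.insertEdge a b hab).NonCrossing)
    (d : F.graph.Dart) : (F.insertEdge a b hab).leftFace (F.ins hab d) ⊆ F.leftFace d := by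
  have hd : F.mid d ∈ (F.insertEdge a b hab).oseg (F.ins hab d) := F.mid_mem d
  obtain ⟨t, ht1, ht2⟩ := ((F.eventually_leftFace hF d (F.mid_mem d)).and
    ((F.insertEdge a b hab).eventually_leftFace h1 _ hd)).exists
  have hU := (F.insertEdge a b hab).isFace_leftFace h1 (F.ins hab d)
  exact (F.isFace_leftFace hF d).subset_of_isPreconnected hU.isPreconnected
    (hU.subset.trans (compl_subset_compl.2 (F.realization_subset_insert hab))) ht1 ht2

variable {F hab}

theorem oseg_chord_subset (h1 : (F.insertEdge a b hab).NonCrossing) (hadj : ¬ F.graph.Adj a b) :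
    (F.insertEdge a b hab).oseg (F.chord hab) ⊆ F.realizationᶜ := by
  intro x hx hxF
  obtain ⟨d, hd⟩ := F.mem_realization.1 hxF
  have hd' : x ∈ (F.insertEdge a b hab).seg (F.ins hab d) := hd
  have h2 := h1.edge_eq_of_mem_oseg hx hd'
  rcases SimpleGraph.dart_edge_eq_iff _ _ |>.1 h2 with h | h
  · exact F.chord_ne_ins hab hadj d h
  · exact F.chord_symm_ne_ins hab hadj d h

theorem IsPseudoTriangulation.exists_leftFace_eq (hP : F.IsPseudoTriangulation) {U : Set Plane}
    (hU : F.IsFace U) : ∃ d, F.leftFace d = U := by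
  obtain ⟨k, c, hc, -⟩ := hP.pseudoTriangle U hU
  exact ⟨_, hc.leftFace_eq hP.nonCrossing hU 0⟩

/-- The faces on both sides of an inserted edge lie in one face. -/
theorem IsPseudoTriangulation.exists_face_chord (hP : F.IsPseudoTriangulation)
    (h1 : (F.insertEdge a b hab).NonCrossing) (hadj : ¬ F.graph.Adj a b) :
    ∃ c, (F.insertEdge a b hab).leftFace (F.chord hab) ⊆ F.leftFace c ∧
      (F.insertEdge a b hab).leftFace (F.chord hab).symm ⊆ F.leftFace c := by
  set F1 := F.insertEdge a b hab with hF1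
  have hm := F1.mid_mem (F.chord hab)
  have hmF := oseg_chord_subset h1 hadj hm
  have hU := F.isFace_component hmF
  obtain ⟨c, hc⟩ := hP.exists_leftFace_eq hU
  have key : ∀ D : F1.graph.Dart, F1.mid (F.chord hab) ∈ F1.oseg D →
      F1.leftFace D ⊆ F.leftFace c := by
    intro D hD
    have hcont : Tendsto (fun t : ℝ => F1.mid (F.chord hab) + t • perp (F1.vec D)) (𝓝[>] 0)
        (𝓝 (F1.mid (F.chord hab))) := by
      refine tendsto_nhdsWithin_of_tendsto_nhds ?_
      have : Continuous fun t : ℝ => F1.mid (F.chord hab) + t • perp (F1.vec D) := by fun_prop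
      simpa using this.tendsto 0
    have h2 : ∀ᶠ t : ℝ in 𝓝[>] 0, F1.mid (F.chord hab) + t • perp (F1.vec D) ∈ F.leftFace c := by
      rw [hc]
      exact hcont (hU.isOpen.mem_nhds (mem_connectedComponentIn hmF))
    obtain ⟨t, ht1, ht2⟩ := (h2.and (F1.eventually_leftFace h1 D hD)).exists
    have hD' := F1.isFace_leftFace h1 D
    exact (F.isFace_leftFace hP.nonCrossing c).subset_of_isPreconnected hD'.isPreconnected
      (hD'.subset.trans (compl_subset_compl.2 (F.realization_subset_insert hab))) ht1 ht2
  refine ⟨c, key _ hm, key _ ?_⟩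
  rw [F1.oseg_symm]
  exact hm

/-- An inserted edge as a chord of a face. -/
structure IsChord (hP : F.IsPseudoTriangulation) (h1 : (F.insertEdge a b hab).NonCrossing)
    (d : F.graph.Dart) (k j : ℕ) : Prop where
  cycle : FaceCycle hP.nonCrossing d k
  pos : 0 < j
  lt : j < k
  fst_eq : d.fst = a
  iterate_fst : ((F.nxt hP.nonCrossing)^[j] d).fst = b
  nxt_chord_symm : (F.insertEdge a b hab).nxt h1 (F.chord hab).symm = F.ins hab d
  nxt_chord : (F.insertEdge a b hab).nxt h1 (F.chord hab) =
    F.ins hab ((F.nxt hP.nonCrossing)^[j] d)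
  nxt_ins : ∀ i, i + 1 < k → i + 1 ≠ j →
    (F.insertEdge a b hab).nxt h1 (F.ins hab ((F.nxt hP.nonCrossing)^[i] d)) =
      F.ins hab ((F.nxt hP.nonCrossing)^[i + 1] d)
  nxt_ins_right : ∀ i, i + 1 = j →
    (F.insertEdge a b hab).nxt h1 (F.ins hab ((F.nxt hP.nonCrossing)^[i] d)) = (F.chord hab).symm
  nxt_ins_left : ∀ i, i + 1 = k →
    (F.insertEdge a b hab).nxt h1 (F.ins hab ((F.nxt hP.nonCrossing)^[i] d)) = F.chord hab
  leftFace_right : ∀ i < j, (F.insertEdge a b hab).leftFace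
    (F.ins hab ((F.nxt hP.nonCrossing)^[i] d)) = (F.insertEdge a b hab).leftFace (F.chord hab).symm
  leftFace_left : ∀ i, j ≤ i → i < k → (F.insertEdge a b hab).leftFace
    (F.ins hab ((F.nxt hP.nonCrossing)^[i] d)) = (F.insertEdge a b hab).leftFace (F.chord hab)
  right : ∀ D, (F.insertEdge a b hab).leftFace D =
    (F.insertEdge a b hab).leftFace (F.chord hab).symm →
      D = (F.chord hab).symm ∨ ∃ i < j, D = F.ins hab ((F.nxt hP.nonCrossing)^[i] d)
  left : ∀ D, (F.insertEdge a b hab).leftFace D =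
    (F.insertEdge a b hab).leftFace (F.chord hab) →
      D = F.chord hab ∨ ∃ i, j ≤ i ∧ i < k ∧ D = F.ins hab ((F.nxt hP.nonCrossing)^[i] d)
  bounded_right : Bornology.IsBounded ((F.insertEdge a b hab).leftFace (F.chord hab).symm)
  bounded_left : Bornology.IsBounded ((F.insertEdge a b hab).leftFace (F.chord hab))

/-- After the insertion, the walks in the face of the chord use only edges of that face and the
chord in both directions. The walk from `a` follows the old cycle until it first leaves it; this
happens at `b`, where it takes the chord back to `a`. The rest of the old cycle returns to `a` along
the other side, and `not_both_sides` shows that the two sides are different faces. -/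
theorem IsPseudoTriangulation.exists_isChord (hP : F.IsPseudoTriangulation)
    (h1 : (F.insertEdge a b hab).NonCrossing) (hadj : ¬ F.graph.Adj a b) :
    ∃ d k j, IsChord hP h1 d k j := by
  have hF := hP.nonCrossing
  obtain ⟨c, hc1, hc2⟩ := hP.exists_face_chord h1 hadj
  set F1 := F.insertEdge a b hab with hF1
  set e : F1.graph.Dart := F.chord hab with he
  have habne : a ≠ b := fun h => hab (by rw [h])
  have hface := F1.isFace_leftFace h1
  -- the directed edges in the face of the chord
  have hshift : ∀ (g : Γ) (D : F1.graph.Dart), F1.leftFace D ⊆ F.leftFace c →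
      F1.leftFace (g +ᵥ D) ⊆ F.leftFace c → g = 0 := by
    intro g D hD hgD
    obtain ⟨x, hx⟩ := (hface D).nonempty
    have h2 : x + F.period g ∈ F1.leftFace (g +ᵥ D) := by
      rw [F1.leftFace_vadd h1]; exact ⟨x, hx, rfl⟩
    have h3 : x + F.period g ∈ F.leftFace (g +ᵥ c) := by
      rw [F.leftFace_vadd hF]; exact ⟨x, hD hx, rfl⟩
    exact hP.eq_zero_of_leftFace_vadd
      ((F.isFace_leftFace hF _).eq_of_mem (F.isFace_leftFace hF c) h3 (hgD h2))
  have hclass : ∀ D : F1.graph.Dart, F1.leftFace D ⊆ F.leftFace c →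
      (∃ d, D = F.ins hab d ∧ F.leftFace d = F.leftFace c) ∨ D = e ∨ D = e.symm := by
    intro D hD
    rcases F.dart_insert_cases hab D with ⟨d, rfl⟩ | ⟨g, rfl⟩ | ⟨g, rfl⟩
    · left
      refine ⟨d, rfl, ?_⟩
      obtain ⟨x, hx⟩ := (hface (F.ins hab d)).nonempty
      exact (F.isFace_leftFace hF _).eq_of_mem (F.isFace_leftFace hF c)
        (F.leftFace_ins_subset hab hF h1 d hx) (hD hx)
    · right; left
      rw [hshift g _ hc1 hD, zero_vadd]
    · right; right
      rw [hshift g _ hc2 hD, zero_vadd]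
  -- The walk would turn back only if the chord were the single edge at its end, but every vertex
  -- already has an old edge.
  have hdeg : ∀ D : F1.graph.Dart, (D = e ∨ D = e.symm) → F1.nxt h1 D ≠ D.symm := by
    intro D hD h
    have h2 : F1.rot D.symm = D.symm := by
      have := F1.rot_nxt h1 D
      rwa [h] at this
    obtain ⟨u, hu⟩ := F.exists_adj D.symm.fst
    refine F1.rot_ne_self h1 (d := D.symm) (d' := F.ins hab ⟨(D.symm.fst, u), hu⟩) rfl ?_ h2
    rcases hD with rfl | rfl
    · exact F.chord_symm_ne_ins hab hadj _
    · exact fun h => F.chord_ne_ins hab hadj _ (h.trans (SimpleGraph.Dart.symm_symm _))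
  have hnxt_e : ∀ D : F1.graph.Dart, (D = e ∨ D = e.symm) →
      ∃ d, F1.nxt h1 D = F.ins hab d ∧ F.leftFace d = F.leftFace c := by
    intro D hD
    have h2 : F1.leftFace (F1.nxt h1 D) ⊆ F.leftFace c := by
      rw [F1.leftFace_nxt]
      rcases hD with rfl | rfl
      · exact hc1
      · exact hc2
    rcases hclass _ h2 with h | h
    · exact h
    · exfalso
      have h3 : F1.nxt h1 D = D ∨ F1.nxt h1 D = D.symm := by
        rcases hD with rfl | rfl
        · exact h
        · rw [SimpleGraph.Dart.symm_symm]; exact h.symm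
      rcases h3 with h3 | h3
      · have h4 := F1.nxt_fst h1 D
        rw [h3] at h4
        exact D.fst_ne_snd h4
      · exact hdeg D hD h3
  obtain ⟨d, hd, hdc⟩ := hnxt_e e.symm (Or.inr rfl)
  obtain ⟨k, hk, -⟩ := hP.exists_faceCycle d
  have hk3 := hk.three_le
  set D : ℕ → F.graph.Dart := fun i => (F.nxt hF)^[i] d with hD
  have hDs : ∀ i, D (i + 1) = F.nxt hF (D i) := fun i => Function.iterate_succ_apply' _ _ _
  have hDk : D k = d := hk.closed
  have hfst : d.fst = a := by
    have h2 := F1.nxt_fst h1 e.symm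
    rw [hd] at h2
    exact h2
  have hstep : ∀ i, F1.leftFace (F.ins hab (D i)) ⊆ F.leftFace c →
      F1.nxt h1 (F.ins hab (D i)) = F.ins hab (D (i + 1)) ∨
      F1.nxt h1 (F.ins hab (D i)) = e ∨ F1.nxt h1 (F.ins hab (D i)) = e.symm := by
    intro i hi
    rw [← F1.leftFace_nxt h1] at hi
    rcases hclass _ hi with ⟨d', h2, -⟩ | h2
    · left
      rw [h2, hDs, F.nxt_eq_of_nxt_ins hF h1 h2]
    · exact Or.inr h2
  have hsub : ∀ d', F.leftFace d' = F.leftFace c → F1.leftFace (F.ins hab d') ⊆ F.leftFace c :=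
    fun d' h => h ▸ F.leftFace_ins_subset hab hF h1 d'
  have hDc : ∀ i, F.leftFace (D i) = F.leftFace c := fun i => (F.leftFace_iterate hF d i).trans hdc
  have hstep' := fun i => hstep i (hsub _ (hDc i))
  have hindex : ∀ d', F.leftFace d' = F.leftFace c → ∃ i < k, d' = D i := fun d' h =>
    hk.exists_index d' (h.trans hdc.symm)
  have hinj : ∀ {i j}, i < k → j < k → D i = D j → i = j := fun hi hj h => hk.iterate_inj hi hj h
  -- Otherwise `d` would follow the last edge of the old cycle as well as the reversed chord.
  have hnotall : ∃ i, i < k ∧ ¬ F1.nxt h1 (F.ins hab (D i)) = F.ins hab (D (i + 1)) := by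
    by_contra hcon
    push Not at hcon
    have h2 := hcon (k - 1) (by omega)
    rw [show k - 1 + 1 = k by omega, hDk, ← hd] at h2
    exact F.chord_symm_ne_ins hab hadj _ ((F1.nxt h1).injective h2)
  classical
  obtain ⟨hl, hlne⟩ := Nat.find_spec hnotall
  have hlmin : ∀ i < Nat.find hnotall, F1.nxt h1 (F.ins hab (D i)) = F.ins hab (D (i + 1)) := by
    intro i hi
    have := Nat.find_min hnotall hi
    push Not at this
    exact this (hi.trans hl)
  set l := Nat.find hnotall with hldef
  obtain ⟨d', hd', hd'c⟩ := hnxt_e e (Or.inl rfl)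
  obtain ⟨j, hj, rfl⟩ := hindex d' hd'c
  have hjfst : (D j).fst = b := by
    have h2 := F1.nxt_fst h1 e
    rw [hd'] at h2
    exact h2
  have hj0 : j ≠ 0 := by
    rintro rfl
    exact habne (hfst.symm.trans hjfst)
  -- the walk from `a` first meets the chord at `b`
  have hle : F1.nxt h1 (F.ins hab (D l)) = e.symm := by
    rcases (hstep' l).resolve_left hlne with h | h
    · exfalso
      have hDl : (D (l + 1)).fst = a := by
        have h2 := F1.nxt_fst h1 (F.ins hab (D l))
        rw [h] at h2
        rw [hDs, F.nxt_fst]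
        exact h2.symm
      have hlk : l + 1 = k := by
        by_contra hne
        have := hk.fst_inj (l + 1) (by omega) 0 (by omega) (hDl.trans hfst.symm)
        omega
      have h3 := hlmin (j - 1) (by omega)
      rw [show j - 1 + 1 = j by omega, ← hd'] at h3
      exact F.chord_ne_ins hab hadj _ ((F1.nxt h1).injective h3)
    · exact h
  have hlj : l + 1 = j := by
    have h2 : (D (l + 1)).fst = b := by
      have h2 := F1.nxt_fst h1 (F.ins hab (D l))
      rw [hle] at h2
      rw [hDs, F.nxt_fst]
      exact h2.symm
    have hne : l + 1 ≠ k := by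
      intro h
      rw [h, hDk, hfst] at h2
      exact habne h2
    exact hk.fst_inj (l + 1) (by omega) j hj (h2.trans hjfst.symm)
  have hnxt : ∀ i, i + 1 < k → i + 1 ≠ j →
      F1.nxt h1 (F.ins hab (D i)) = F.ins hab (D (i + 1)) := by
    intro i hi hij
    rcases hstep' i with h | h | h
    · exact h
    · exfalso
      have h2 := F1.nxt_fst h1 (F.ins hab (D i))
      rw [h] at h2
      have h3 : (D (i + 1)).fst = d.fst := by
        rw [hDs, F.nxt_fst, hfst]; exact h2.symm
      have := hk.fst_inj (i + 1) hi 0 (by omega) h3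
      omega
    · exfalso
      have h2 := hinj (by omega) hl (F.ins_injective hab ((F1.nxt h1).injective (h.trans hle.symm)))
      omega
  have hlast : ∀ i, i + 1 = k → F1.nxt h1 (F.ins hab (D i)) = e := by
    intro i hi
    rcases hstep' i with h | h | h
    · exfalso
      rw [hi, hDk, ← hd] at h
      exact F.chord_symm_ne_ins hab hadj _ ((F1.nxt h1).injective h)
    · exact h
    · exfalso
      have h2 := hinj (by omega) hl (F.ins_injective hab ((F1.nxt h1).injective (h.trans hle.symm)))
      omega
  have hfaceR : ∀ i < j, F1.leftFace (F.ins hab (D i)) = F1.leftFace e.symm := by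
    intro i
    induction i with
    | zero =>
      intro _
      rw [← F1.leftFace_nxt h1 e.symm, hd]; rfl
    | succ i ih =>
      intro hi
      rw [← hnxt i (by omega) (by omega), F1.leftFace_nxt, ih (by omega)]
  have hfaceL : ∀ i, j ≤ i → i < k → F1.leftFace (F.ins hab (D i)) = F1.leftFace e := by
    intro i hji
    induction i, hji using Nat.le_induction with
    | base => intro _; rw [← hd', F1.leftFace_nxt]
    | succ i hji ih =>
      intro hi
      rw [← hnxt i (by omega) (by omega), F1.leftFace_nxt, ih (by omega)]
  have hRL : F1.leftFace e ≠ F1.leftFace e.symm := by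
    intro heq
    -- The closed polygon that first runs along the chord from `b` to `a` and then along the old
    -- cycle from `a` to `b`.
    let q : ℕ → Plane := fun n => if n = 0 then F.placement b else F.placement (D (n - 1)).fst
    have hq0 : q 0 = F.placement b := rfl
    have hqs : ∀ n, q (n + 1) = F.placement (D n).fst := fun n => by simp [q]
    have hq1 : q 1 = F.placement a := by rw [hqs 0, ← hfst]; rfl
    have hseg : ∀ n, segment ℝ (q (n + 1)) (q (n + 1 + 1)) = F1.seg (F.ins hab (D n)) := by
      intro n
      rw [hqs, hqs, hDs, F.nxt_fst]; rfl
    have hm : F1.mid e ∈ F1.oseg e.symm := by rw [F1.oseg_symm]; exact F1.mid_mem e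
    have hv : q 1 - q 0 = F1.vec e.symm := by rw [hq0, hq1]; rfl
    refine not_both_sides (q := q) (N := j) (x := F1.mid e) (by rw [hqs, hq0, hjfst]) ?_ ?_ ?_
      (hface e).isPreconnected ?_ ?_ ?_
    · rw [hq0, hq1]; exact hm
    · rw [hq0, hq1]; exact hab.symm
    · intro n hn hmem
      rw [hseg] at hmem
      have h2 := h1.edge_eq_of_mem_oseg (F1.mid_mem e) hmem
      rcases SimpleGraph.dart_edge_eq_iff _ _ |>.1 h2 with h | h
      · exact F.chord_ne_ins hab hadj _ h
      · exact F.chord_symm_ne_ins hab hadj _ h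
    · intro y hy n hn hmem
      refine (hface e).subset hy ?_
      rcases n with _ | n
      · rw [hq0, hq1] at hmem
        exact F1.seg_subset_realization e.symm hmem
      · rw [hseg] at hmem
        exact F1.seg_subset_realization _ hmem
    · rw [hv, heq]
      exact (F1.eventually_leftFace h1 e.symm hm).frequently
    · rw [hv]
      refine Filter.Eventually.frequently ?_
      filter_upwards [F1.eventually_leftFace h1 e (F1.mid_mem e)] with t ht
      rw [vec_symm, perp_neg, smul_neg, sub_neg_eq_add]
      exact ht
  refine ⟨d, k, j, hk, by omega, hj, hfst, hjfst, hd, hd', hnxt, ?_, hlast, hfaceR, hfaceL, ?_, ?_,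
    (hP.isBounded_leftFace c).subset hc2, (hP.isBounded_leftFace c).subset hc1⟩
  · intro i hi
    obtain rfl : i = l := by omega
    exact hle
  · intro D' hD'
    rcases hclass D' (by rw [hD']; exact hc2) with ⟨d', rfl, hd'⟩ | rfl | rfl
    · obtain ⟨i, hi, rfl⟩ := hindex d' hd'
      rcases lt_or_ge i j with hij | hij
      · exact Or.inr ⟨i, hij, rfl⟩
      · exact absurd ((hfaceL i hij hi).symm.trans hD') hRL
    · exact absurd hD' hRL
    · exact Or.inl rfl
  · intro D' hD'
    rcases hclass D' (by rw [hD']; exact hc1) with ⟨d', rfl, hd'⟩ | rfl | rfl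
    · obtain ⟨i, hi, rfl⟩ := hindex d' hd'
      rcases lt_or_ge i j with hij | hij
      · exact absurd (hD'.symm.trans (hfaceR i hij)) hRL
      · exact Or.inr ⟨i, hij, hi, rfl⟩
    · exact Or.inl rfl
    · exact absurd hD'.symm hRL

end Insert

end PeriodicFramework
end PeriodicRigidity
end

noncomputable section
namespace PeriodicRigidity
namespace PeriodicFramework

variable {V Γ : Type*} [AddCommGroup Γ] [AddAction Γ V] {F : PeriodicFramework V Γ}

/-! ### The direction of the crease -/

theorem inner_vec_pos {d : F.graph.Dart} (hF : F.NonCrossing) {g : Plane}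
    (hg : ∀ d', F.leftFace d' = F.leftFace d → d'.fst ≠ d.fst →
      0 < inner ℝ g (F.placement d'.fst - F.placement d.fst)) :
    0 < inner ℝ g (F.vec d) ∧ 0 < inner ℝ g (F.vec (F.rot d)) := by
  constructor
  · have := hg (F.nxt hF d) (F.leftFace_nxt hF d) (by rw [F.nxt_fst]; exact d.fst_ne_snd.symm)
    rwa [F.nxt_fst] at this
  · have h := hg (F.rot d).symm (F.leftFace_rot_symm hF d) (by
      rw [← F.rot_fst d]; exact (F.rot d).fst_ne_snd.symm)
    rw [← F.rot_fst d] at h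
    exact h

/-- An initial vertex that is extremal on a bounded face is a corner of this face. -/
theorem det2_pos_of_extremal (hF : F.NonCrossing) {d : F.graph.Dart}
    (hb : Bornology.IsBounded (F.leftFace d)) (hne : F.rot d ≠ d) {g : Plane}
    (hg : ∀ d', F.leftFace d' = F.leftFace d → d'.fst ≠ d.fst →
      0 < inner ℝ g (F.placement d'.fst - F.placement d.fst)) :
    0 < det2 (F.vec d) (F.vec (F.rot d)) := by
  obtain ⟨h1, h2⟩ := inner_vec_pos hF hg
  rcases lt_trichotomy (det2 (F.vec d) (F.vec (F.rot d))) 0 with h | h | h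
  · exfalso
    obtain ⟨t, ht, ht0⟩ := ((F.eventually_reflex hF h).and eventually_mem_nhdsWithin).exists
    have ht0' : 0 < t := ht0
    have hg0 : -g ≠ 0 := by
      rw [neg_ne_zero]
      rintro rfl
      simp at h1
    obtain ⟨d', hd', hle⟩ : ∃ d', F.leftFace d' = F.leftFace d ∧
        inner ℝ (-g) (F.placement d.fst + t • -(F.vec d + F.vec (F.rot d))) ≤
          inner ℝ (-g) (F.placement d'.fst) := by
      obtain ⟨d', hd', h | h⟩ := F.exists_vertex_inner_ge hF (F.isFace_leftFace hF d) hb hg0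
        (subset_closure ht)
      · exact ⟨d', hd', h⟩
      · exact ⟨F.nxt hF d', by rw [F.leftFace_nxt, hd'], by rwa [F.nxt_fst]⟩
    rw [inner_add_right, inner_smul_right, inner_neg_right, inner_neg_left, inner_neg_left,
      inner_neg_left, inner_add_right] at hle
    have h3 : 0 ≤ inner ℝ g (F.placement d'.fst) - inner ℝ g (F.placement d.fst) := by
      rw [← inner_sub_right]
      by_cases h : d'.fst = d.fst
      · rw [h]; simp
      · exact (hg d' hd' h).le
    nlinarith
  · exfalso
    obtain ⟨r, hr⟩ := exists_smul_of_det2_eq_zero (F.vec_ne_zero d) h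
    rw [hr, inner_smul_right] at h2
    exact hne (hF.eq_of_parallel (F.rot_fst d).symm (pos_of_mul_pos_left h2 h1.le) hr).symm
  · exact h

/-- At a reflex angle that is cut in two, the extremality on one side of the cut contradicts the
extremality on the other side. -/
theorem inner_vec_neg (hF : F.NonCrossing) {d : F.graph.Dart}
    (hb : Bornology.IsBounded (F.leftFace d)) (hb' : Bornology.IsBounded (F.leftFace (F.rot d)))
    (hne : F.rot d ≠ d) (hne' : F.rot (F.rot d) ≠ F.rot d)
    (hd : det2 (F.vec d) (F.vec (F.rot (F.rot d))) < 0) {g g' : Plane}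
    (hg : ∀ d', F.leftFace d' = F.leftFace d → d'.fst ≠ d.fst →
      0 < inner ℝ g (F.placement d'.fst - F.placement d.fst))
    (hg' : ∀ d', F.leftFace d' = F.leftFace (F.rot d) → d'.fst ≠ d.fst →
      0 < inner ℝ g' (F.placement d'.fst - F.placement d.fst)) :
    0 < inner ℝ (g - g') (F.vec d) := by
  rw [← F.rot_fst d] at hg'
  obtain ⟨h1, -⟩ := inner_vec_pos hF hg
  obtain ⟨h2, h3⟩ := inner_vec_pos hF hg'
  have h4 := det2_pos_of_extremal hF hb hne hg
  have h5 := det2_pos_of_extremal hF hb' hne' hg'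
  -- The linear relation between three vectors of the plane, paired with `g'`; the signs of the
  -- determinants force `g'` to be negative on the first edge.
  have h6 : det2 (F.vec (F.rot d)) (F.vec (F.rot (F.rot d))) * inner ℝ g' (F.vec d) -
      det2 (F.vec d) (F.vec (F.rot (F.rot d))) * inner ℝ g' (F.vec (F.rot d)) +
      det2 (F.vec d) (F.vec (F.rot d)) * inner ℝ g' (F.vec (F.rot (F.rot d))) = 0 := by
    simp only [inner_eq, det2]; ring
  rw [inner_sub_left]
  have h7 := mul_pos h4 h3
  have h8 := mul_pos (neg_pos.2 hd) h2
  have h9 : inner ℝ g' (F.vec d) < 0 := by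
    by_contra! h
    have := mul_nonneg h5.le h
    linarith
  linarith

/-- The height function of a lift, relative to a base point. -/
def height (F : PeriodicFramework V Γ) (Y : V → ℝ) (o : Plane) (v : V) : ℝ :=
  Y v + ‖F.placement v - o‖ ^ 2 / 2

/-- Expanding the squares, the inner product equals the increase of `Y` from `v` to `w` plus half
the squared distance between the two. So a minimum of `Y` makes the vertex strictly extremal
wherever the height is affine. -/
theorem inner_pos_of_height (hF : F.NonCrossing) {Y : V → ℝ} {o γ : Plane} {v w : V}
    (hmin : Y v ≤ Y w) (hne : w ≠ v)
    (h : F.height Y o w - F.height Y o v = inner ℝ γ (F.placement w - F.placement v)) :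
    0 < inner ℝ (γ - (F.placement v - o)) (F.placement w - F.placement v) := by
  have h1 : F.placement w - o = (F.placement v - o) + (F.placement w - F.placement v) := by abel
  have h2 : 0 < ‖F.placement w - F.placement v‖ :=
    norm_pos_iff.2 (sub_ne_zero.2 fun h => hne (hF.placement_injective h))
  simp only [height] at h
  rw [h1, @norm_add_sq_real] at h
  rw [inner_sub_left, ← h]
  nlinarith [pow_pos h2 2]

namespace IsPseudoTriangulation

theorem base_iterate (hP : F.IsPseudoTriangulation) (d : F.graph.Dart) (i : ℕ) :
    hP.base (F.dmk ((F.nxt hP.nonCrossing)^[i] d)) = hP.base (F.dmk d) -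
      (F.placement ((F.nxt hP.nonCrossing)^[i] d).fst - F.placement d.fst) := by
  induction i with
  | zero => simp
  | succ i ih =>
    rw [Function.iterate_succ_apply', ← F.nxtO_mk, hP.base_nxtO, ih, F.nxt_fst, vecO_mk, vec]
    abel

theorem cycleMk_iterate (hP : F.IsPseudoTriangulation) (d : F.graph.Dart) (i : ℕ) :
    cycleMk (F.nxtO hP.nonCrossing) (F.dmk ((F.nxt hP.nonCrossing)^[i] d)) =
      cycleMk (F.nxtO hP.nonCrossing) (F.dmk d) := by
  rw [eq_comm, cycleMk_eq, F.sameCycle_iff]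
  exact ⟨i, F.nxtO_iterate_mk _ i d⟩

/-- A lift with a crease. -/
def IsLift (hP : F.IsPseudoTriangulation) (C : F.DartOrbit → Plane)
    (φ : F.FaceOrbit hP.nonCrossing → Plane) (y : VertexOrbit Γ V → ℝ) : Prop :=
  ∀ δ, y (F.srcO (F.revO δ)) - y (F.srcO δ) =
    inner ℝ (hP.base δ + C δ + φ (cycleMk _ δ)) (F.vecO δ) - ‖F.vecO δ‖ ^ 2 / 2

variable {C : F.DartOrbit → Plane} {y : VertexOrbit Γ V → ℝ}

/-- Moving the origin along the walk cancels the quadratic terms, so up to the crease the height has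
one and the same gradient along the whole boundary of the face. -/
theorem height_step (hP : F.IsPseudoTriangulation) {φ : F.FaceOrbit hP.nonCrossing → Plane}
    (h : hP.IsLift C φ y) (d : F.graph.Dart) (i : ℕ) :
    F.height (fun v => y (F.vmk v)) (F.placement d.fst) ((F.nxt hP.nonCrossing)^[i + 1] d).fst -
      F.height (fun v => y (F.vmk v)) (F.placement d.fst) ((F.nxt hP.nonCrossing)^[i] d).fst =
    inner ℝ (hP.base (F.dmk d) + φ (cycleMk _ (F.dmk d)) +
      C (F.dmk ((F.nxt hP.nonCrossing)^[i] d)))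
      (F.placement ((F.nxt hP.nonCrossing)^[i + 1] d).fst -
        F.placement ((F.nxt hP.nonCrossing)^[i] d).fst) := by
  have h1 := h (F.dmk ((F.nxt hP.nonCrossing)^[i] d))
  rw [hP.base_iterate, hP.cycleMk_iterate] at h1
  rw [Function.iterate_succ_apply', F.nxt_fst]
  simp only [revO_mk, srcO_mk, vecO_mk, vec] at h1
  set D := (F.nxt hP.nonCrossing)^[i] d
  have h2 : D.symm.fst = D.snd := rfl
  rw [h2] at h1
  have h3 : F.placement D.snd - F.placement d.fst = (F.placement D.fst - F.placement d.fst) +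
    (F.placement D.snd - F.placement D.fst) := by abel
  simp only [height]
  rw [h3, @norm_add_sq_real]
  simp only [inner_add_left, inner_sub_left (F.placement D.fst)] at h1 ⊢
  simp only [inner_sub_left (hP.base (F.dmk d))] at h1
  simp only [inner_sub_left] at h1
  linarith

theorem height_of_forall_eq (hP : F.IsPseudoTriangulation)
    {φ : F.FaceOrbit hP.nonCrossing → Plane} (h : hP.IsLift C φ y) (d : F.graph.Dart) {c : Plane}
    {i₀ i₁ : ℕ} (hle : i₀ ≤ i₁)
    (hC : ∀ i, i₀ ≤ i → i < i₁ → C (F.dmk ((F.nxt hP.nonCrossing)^[i] d)) = c) :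
    F.height (fun v => y (F.vmk v)) (F.placement d.fst) ((F.nxt hP.nonCrossing)^[i₁] d).fst -
      F.height (fun v => y (F.vmk v)) (F.placement d.fst) ((F.nxt hP.nonCrossing)^[i₀] d).fst =
    inner ℝ (hP.base (F.dmk d) + φ (cycleMk _ (F.dmk d)) + c)
      (F.placement ((F.nxt hP.nonCrossing)^[i₁] d).fst -
        F.placement ((F.nxt hP.nonCrossing)^[i₀] d).fst) := by
  induction i₁, hle using Nat.le_induction with
  | base => simp
  | succ i hi ih =>
    have h1 := hP.height_step h d i
    rw [hC i hi (Nat.lt_succ_self i)] at h1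
    have h2 := ih fun l hl hl' => hC l hl (hl'.trans (Nat.lt_succ_self i))
    rw [← sub_add_sub_cancel, h1, h2, ← inner_add_right, sub_add_sub_cancel]

theorem crease_iterate_of_lt (hF : F.NonCrossing) {d : F.graph.Dart} {i j : ℕ} (hi : i < j) :
    crease hF d j (F.dmk ((F.nxt hF)^[i] d)) =
      perp (F.placement ((F.nxt hF)^[j] d).fst - F.placement d.fst) := by
  classical
  rw [crease, if_pos]
  exact Finset.mem_image.2 ⟨i, Finset.mem_range.2 hi, rfl⟩

theorem crease_iterate_of_le (hP : F.IsPseudoTriangulation) {d : F.graph.Dart} {i j k : ℕ}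
    (hk : FaceCycle hP.nonCrossing d k) (hi : j ≤ i) (hik : i < k) :
    crease hP.nonCrossing d j (F.dmk ((F.nxt hP.nonCrossing)^[i] d)) = 0 := by
  classical
  rw [crease, if_neg]
  intro h
  obtain ⟨l, hl, hli⟩ := Finset.mem_image.1 h
  have hl' := Finset.mem_range.1 hl
  have := hP.dmk_iterate_inj hk (by omega) hik hli
  omega

theorem exists_of_crease_ne_zero (hF : F.NonCrossing) {d d' : F.graph.Dart} {j : ℕ}
    (h : crease hF d j (F.dmk d') ≠ 0) : ∃ g : Γ, F.leftFace (g +ᵥ d') = F.leftFace d := by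
  classical
  have hmem : F.dmk d' ∈ arc hF d j := by
    by_contra hcon
    exact h (by rw [crease, if_neg hcon])
  obtain ⟨l, -, hl⟩ := Finset.mem_image.1 hmem
  obtain ⟨g, hg⟩ := F.dmk_eq.1 hl
  exact ⟨g, by rw [hg, F.leftFace_iterate]⟩

/-- The crease along a chord is downwards. -/
theorem crease_neg (hP : F.IsPseudoTriangulation) {a b : V} {hab : F.placement a ≠ F.placement b}
    {h1 : (F.insertEdge a b hab).NonCrossing} {d : F.graph.Dart} {k j : ℕ}
    (hadj : ¬ F.graph.Adj a b) (hc : IsChord hP h1 d k j) {φ : F.FaceOrbit hP.nonCrossing → Plane} {t : ℝ}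
    (h : hP.IsLift (fun δ => t • crease hP.nonCrossing d j δ) φ y) : t < 0 := by
  have hF := hP.nonCrossing
  have hk := hc.cycle
  have hk3 := hk.three_le
  have hj0 := hc.pos
  have hjk := hc.lt
  set F1 := F.insertEdge a b hab with hF1
  set D : ℕ → F.graph.Dart := fun i => (F.nxt hF)^[i] d with hD
  have hD0 : D 0 = d := rfl
  have hDk : D k = d := hk.closed
  have hDs : ∀ i, D (i + 1) = F.nxt hF (D i) := fun i => Function.iterate_succ_apply' _ _ _
  set Y : V → ℝ := fun v => y (F.vmk v) with hY
  set q : Plane := F.placement b - F.placement a with hq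
  -- the reflex angle at a minimum
  obtain ⟨β, hβ, hmin⟩ : ∃ β : F.graph.Dart, det2 (F.vec β) (F.vec (F.rot β)) < 0 ∧
      ∀ w, Y β.fst ≤ Y w := by
    have := F.finite_vertexOrbit
    have hne : Nonempty (VertexOrbit Γ V) := F.connected.nonempty.map F.vmk
    obtain ⟨q, hq⟩ := Finite.exists_min y
    obtain ⟨v, rfl⟩ := F.vmk_surj q
    obtain ⟨β, rfl, hβ, -⟩ := hP.existsUnique_reflex v
    exact ⟨β, hβ, fun w => hq _⟩
  -- If the face with this reflex angle carries no crease, the height is affine on all of it, and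
  -- the minimum would be a corner instead.
  by_cases hcut : ∃ g : Γ, F.leftFace (g +ᵥ β) = F.leftFace d
  swap
  · exfalso
    have hC : ∀ i, t • crease hF d j (F.dmk ((F.nxt hF)^[i] β)) = 0 := by
      intro i
      by_contra hne
      obtain ⟨g, hg⟩ := exists_of_crease_ne_zero hF (fun h0 => hne (by rw [h0, smul_zero]))
      refine hcut ⟨g, ?_⟩
      rw [F.leftFace_vadd hF, F.leftFace_iterate, ← F.leftFace_vadd hF] at hg
      exact hg
    refine absurd (det2_pos_of_extremal hF (hP.isBounded_leftFace β) (hP.rot_ne β)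
      (g := hP.base (F.dmk β) + φ (cycleMk _ (F.dmk β)) + 0 - (F.placement β.fst - F.placement β.fst))
      ?_) (not_lt.2 hβ.le)
    intro d' hd' hne
    obtain ⟨k', hk', -⟩ := hP.exists_faceCycle β
    obtain ⟨i, -, rfl⟩ := hk'.exists_index d' hd'
    exact inner_pos_of_height hF (hmin _) hne
      (hP.height_of_forall_eq h β (Nat.zero_le i) fun l _ _ => hC l)
  obtain ⟨g₀, hg₀⟩ := hcut
  obtain ⟨i, hi, hβi⟩ := hk.exists_index _ hg₀
  replace hβi : g₀ +ᵥ β = D i := hβi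
  have hβ' : det2 (F.vec (D i)) (F.vec (F.rot (D i))) < 0 := by
    rw [← hβi, F.rot_vadd hF, F.vec_vadd, F.vec_vadd]; exact hβ
  have hmin' : ∀ w, Y (D i).fst ≤ Y w := by
    intro w
    rw [← hβi, vadd_fst]
    simp only [hY, F.vmk_vadd]
    exact hmin w
  -- the two gradients
  set γ : Plane := hP.base (F.dmk d) + φ (cycleMk _ (F.dmk d)) with hγ
  set o := F.placement d.fst with ho
  have hoa : o = F.placement a := by rw [ho, hc.fst_eq]
  have hDj : F.placement (D j).fst = F.placement b := congrArg F.placement hc.iterate_fst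
  have hHR : ∀ l ≤ j, F.height Y o (D l).fst - F.height Y o d.fst =
      inner ℝ (γ + t • perp q) (F.placement (D l).fst - o) := by
    intro l hl
    refine hP.height_of_forall_eq h d (Nat.zero_le l) fun i _ hi => ?_
    rw [crease_iterate_of_lt hF (hi.trans_le hl), hc.iterate_fst, hc.fst_eq]
  -- The two affine pieces agree at `b`, because the jump of the gradient is perpendicular to the
  -- chord.
  have hHL : ∀ l, j ≤ l → l ≤ k → F.height Y o (D l).fst - F.height Y o d.fst =
      inner ℝ γ (F.placement (D l).fst - o) := by
    intro l hl hlk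
    have h2 := hHR j le_rfl
    rw [hDj, hoa, inner_add_left, inner_smul_left, inner_perp, det2_self, mul_zero, add_zero] at h2
    have h3 := hP.height_of_forall_eq h d (c := 0) hl fun i hi hil => by
      rw [hP.crease_iterate_of_le hk hi (by omega), smul_zero]
    rw [add_zero] at h3
    rw [← sub_add_sub_cancel, hoa, h2, ← hoa]
    refine (congrArg (· + _) h3).trans ?_
    rw [← inner_add_right]
    congr 1
    rw [← hDj]
    abel
  have hR : ∀ E, F1.leftFace E = F1.leftFace (F.chord hab).symm →
      F.height Y o E.fst - F.height Y o d.fst =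
        inner ℝ (γ + t • perp q) (F.placement E.fst - o) := by
    intro E hE
    rcases hc.right E hE with rfl | ⟨l, hl, rfl⟩
    · have h2 := hHR j le_rfl
      have h3 : (D j).fst = (F.chord hab).symm.fst := hc.iterate_fst
      rwa [h3] at h2
    · exact hHR l hl.le
  have hL : ∀ E, F1.leftFace E = F1.leftFace (F.chord hab) →
      F.height Y o E.fst - F.height Y o d.fst = inner ℝ γ (F.placement E.fst - o) := by
    intro E hE
    rcases hc.left E hE with rfl | ⟨l, hl, hlk, rfl⟩
    · have h2 := hHL k hjk.le le_rfl
      have h3 : (D k).fst = (F.chord hab).fst := by rw [hDk]; exact hc.fst_eq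
      rwa [h3] at h2
    · exact hHL l hl hlk.le
  have hpos : ∀ (E₀ : F1.graph.Dart) (γ' : Plane),
      (∀ E, F1.leftFace E = F1.leftFace E₀ → F.height Y o E.fst - F.height Y o d.fst =
        inner ℝ γ' (F.placement E.fst - o)) → E₀.fst = (D i).fst →
      ∀ E, F1.leftFace E = F1.leftFace E₀ → E.fst ≠ (D i).fst →
        0 < inner ℝ (γ' - (F.placement (D i).fst - o)) (F1.placement E.fst - F1.placement (D i).fst) := by
    intro E₀ γ' hγ' hE₀ E hE hne
    refine inner_pos_of_height hF (hmin' E.fst) hne ?_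
    have h2 := hγ' E hE
    have h3 := hγ' E₀ rfl
    rw [hE₀] at h3
    rw [← sub_sub_sub_cancel_right _ _ (F.height Y o d.fst), h2, h3, ← inner_sub_right,
      sub_sub_sub_cancel_right]
  have hrot_of : ∀ l, F.rot (D (l + 1)) = (D l).symm := fun l => by rw [hDs, F.rot_nxt]
  have hrot1_of : ∀ {E E' : F1.graph.Dart}, F1.nxt h1 E = E' → F1.rot E' = E.symm := by
    rintro E _ rfl; exact F1.rot_nxt h1 E
  rcases Nat.eq_zero_or_pos i with rfl | hi0
  · -- the chord starts at the minimum
    have hr1 : F1.rot (F.ins hab (D 0)) = F.chord hab :=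
      (hrot1_of hc.nxt_chord_symm).trans (SimpleGraph.Dart.symm_symm _)
    have hr2 : F1.rot (F.chord hab) = F.ins hab (F.rot (D 0)) := by
      rw [hrot1_of (hc.nxt_ins_left (k - 1) (by omega)), F.ins_symm]
      congr 1
      rw [← hrot_of, show k - 1 + 1 = k by omega, hDk, hD0]
    have hfst : (F.chord hab).fst = (D 0).fst := hc.fst_eq.symm
    have hfR := hc.leftFace_right 0 hj0
    have hpR := hpos (F.ins hab (D 0)) (γ + t • perp q) (fun E hE => hR E (hE.trans hfR)) rfl
    have hpL := hpos (F.chord hab) γ hL hfst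
    have hb : Bornology.IsBounded (F1.leftFace (F.ins hab (D 0))) :=
      (congrArg Bornology.IsBounded hfR).mpr hc.bounded_right
    have hne1 : F1.rot (F.ins hab (D 0)) ≠ F.ins hab (D 0) := by
      rw [hr1]; exact (F.chord_ne_ins hab hadj _).symm
    -- The gradients on the two sides differ by `t • perp q`. This difference is positive on the
    -- first edge, while the chord makes a left turn with it at the corner; so `t` is negative.
    have hkey := inner_vec_neg h1 hb (by rw [hr1]; exact hc.bounded_left) hne1
      (by rw [hr1, hr2]; exact F.chord_ne_ins hab hadj _) (by rw [hr1, hr2]; exact hβ') hpR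
      (by rw [hr1]; exact hpL)
    have hdet := det2_pos_of_extremal h1 hb hne1 hpR
    rw [hr1] at hdet
    have hdet' : 0 < det2 (F.vec (D 0)) q := hdet
    rw [sub_sub_sub_cancel_right, add_sub_cancel_left, inner_smul_left, inner_perp, det2_swap] at hkey
    simp only [conj_trivial] at hkey
    have hkey' : 0 < t * -det2 (F.vec (D 0)) q := hkey
    nlinarith
  -- The minimum at the other end of the chord: the two faces and the direction of the chord are
  -- both exchanged, so the sign stays the same.
  by_cases hij : i = j
  · subst hij
    have hr1 : F1.rot (F.ins hab (D i)) = (F.chord hab).symm := hrot1_of hc.nxt_chord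
    have hr2 : F1.rot (F.chord hab).symm = F.ins hab (F.rot (D i)) := by
      rw [hrot1_of (hc.nxt_ins_right (i - 1) (by omega)), F.ins_symm]
      congr 1
      rw [← hrot_of, show i - 1 + 1 = i by omega]
    have hfst : (F.chord hab).symm.fst = (D i).fst := hc.iterate_fst.symm
    have hfL := hc.leftFace_left i le_rfl hi
    have hpR := hpos (F.chord hab).symm (γ + t • perp q) hR hfst
    have hpL := hpos (F.ins hab (D i)) γ (fun E hE => hL E (hE.trans hfL)) rfl
    have hb : Bornology.IsBounded (F1.leftFace (F.ins hab (D i))) :=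
      (congrArg Bornology.IsBounded hfL).mpr hc.bounded_left
    have hne1 : F1.rot (F.ins hab (D i)) ≠ F.ins hab (D i) := by
      rw [hr1]; exact (F.chord_symm_ne_ins hab hadj _).symm
    have hkey := inner_vec_neg h1 hb (by rw [hr1]; exact hc.bounded_right) hne1
      (by rw [hr1, hr2]; exact F.chord_symm_ne_ins hab hadj _) (by rw [hr1, hr2]; exact hβ') hpL
      (by rw [hr1]; exact hpR)
    have hdet := det2_pos_of_extremal h1 hb hne1 hpL
    rw [hr1, vec_symm, det2_neg_right] at hdet
    have hdet' : 0 < -det2 (F.vec (D i)) q := hdet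
    rw [sub_sub_sub_cancel_right, sub_add_cancel_left, inner_neg_left, inner_smul_left, inner_perp,
      det2_swap] at hkey
    simp only [conj_trivial] at hkey
    have hkey' : 0 < -(t * -det2 (F.vec (D i)) q) := hkey
    nlinarith
  -- At any other vertex the chord does not cut the reflex angle, which then belongs to one affine
  -- piece and would have to be a corner.
  · exfalso
    have hr1 : F1.rot (F.ins hab (D i)) = F.ins hab (F.rot (D i)) := by
      have h2 := hc.nxt_ins (i - 1) (by omega) (by omega)
      rw [show i - 1 + 1 = i by omega] at h2
      rw [hrot1_of h2, F.ins_symm]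
      congr 1
      rw [← hrot_of, show i - 1 + 1 = i by omega]
    have hne1 : F1.rot (F.ins hab (D i)) ≠ F.ins hab (D i) := by
      rw [hr1]; exact fun h => hP.rot_ne _ (F.ins_injective hab h)
    have hfin : ∀ g : Plane, Bornology.IsBounded (F1.leftFace (F.ins hab (D i))) →
        (∀ E, F1.leftFace E = F1.leftFace (F.ins hab (D i)) → E.fst ≠ (D i).fst →
        0 < inner ℝ g (F1.placement E.fst - F1.placement (D i).fst)) → False := by
      intro g hb hg
      have := det2_pos_of_extremal h1 hb hne1 hg
      rw [hr1] at this
      exact absurd this (not_lt.2 hβ'.le)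
    rcases lt_or_ge i j with hij' | hij'
    · have hf := hc.leftFace_right i hij'
      exact hfin _ (hf ▸ hc.bounded_right)
        (hpos (F.ins hab (D i)) (γ + t • perp q) (fun E hE => hR E (hE.trans hf)) rfl)
    · have hf := hc.leftFace_left i hij' hi
      exact hfin _ (hf ▸ hc.bounded_left)
        (hpos (F.ins hab (D i)) γ (fun E hE => hL E (hE.trans hf)) rfl)

/-- All chords with varying length expand or contract together. -/
theorem exists_neg_expansion (hP : F.IsPseudoTriangulation) {a b : V}
    {hab : F.placement a ≠ F.placement b} (h1 : (F.insertEdge a b hab).NonCrossing)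
    (hv : F.DistanceVaries a b) :
    ∃ t < (0 : ℝ), ∀ x ∈ F.infinitesimalMotions, hP.expansion x = t * F.stretch x a b := by
  obtain ⟨x₀, hx₀, hx₀'⟩ := hv
  have hadj : ¬ F.graph.Adj a b := fun h => hx₀' (F.mem_infinitesimalMotions.1 hx₀ a b h)
  obtain ⟨d, k, j, hc⟩ := hP.exists_isChord h1 hadj
  obtain ⟨κ, t, φ, y, h0, hy, hx⟩ := hP.exists_crease_lift hc.cycle hc.lt
  rw [hc.fst_eq, hc.iterate_fst] at hx
  -- Without the quadratic part, pairing with a motion would force the varying chord to keep its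
  -- length.
  have hκ : κ ≠ 0 := by
    rintro rfl
    have ht : t ≠ 0 := by simpa using h0
    have := hx x₀ hx₀
    rw [zero_mul, eq_comm, mul_eq_zero] at this
    exact this.elim ht hx₀'
  -- Dividing by `κ` normalises the quadratic part of the lift, whatever the sign of `κ`.
  refine ⟨t / κ, hP.crease_neg hadj hc (φ := κ⁻¹ • φ) (y := κ⁻¹ • y) fun δ => ?_, fun x hxm => ?_⟩
  · have h2 := hy δ
    simp only [inner_add_left, inner_smul_left, conj_trivial, Pi.smul_apply, smul_eq_mul] at h2 ⊢
    field_simp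
    linear_combination 2 * h2
  · have := hx x hxm
    field_simp
    linarith

end IsPseudoTriangulation

end PeriodicFramework
end PeriodicRigidity
end

/-! ### Dimension counts, rigidity and stresses. -/

noncomputable section
namespace PeriodicRigidity
namespace PeriodicFramework

variable {V Γ : Type*} [AddCommGroup Γ] [AddAction Γ V] (F : PeriodicFramework V Γ)

/-! ### Dimensions -/

/-- A vertex in a given orbit. -/
def vrep (q : VertexOrbit Γ V) : V := (F.vmk_surj q).choose

theorem vmk_vrep (q : VertexOrbit Γ V) : F.vmk (F.vrep q) = q := (F.vmk_surj q).choose_spec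

theorem exists_vadd_vrep (v : V) : ∃ g : Γ, g +ᵥ F.vrep (F.vmk v) = v :=
  F.vmk_eq.1 (F.vmk_vrep (F.vmk v)).symm

/-- Values at orbit representatives and on a basis of `Γ` determine a displacement, and they are
arbitrary because the action is free: the translation from the representative to a vertex is unique.
-/
theorem exists_displacement_equiv (F : PeriodicFramework V Γ) :
    Nonempty (displacements V Γ ≃ₗ[ℝ] (VertexOrbit Γ V → Plane) × (Fin 2 → Plane)) := by
  obtain ⟨b, -⟩ := F.lattice
  let ev : displacements V Γ →ₗ[ℝ] (VertexOrbit Γ V → Plane) × (Fin 2 → Plane) :=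
    { toFun := fun x => (fun q => x.1.1 (F.vrep q), fun i => x.1.2 (b i))
      map_add' := fun x y => rfl
      map_smul' := fun r x => rfl }
  refine ⟨LinearEquiv.ofBijective ev ⟨?_, ?_⟩⟩
  · rw [← LinearMap.ker_eq_bot, LinearMap.ker_eq_bot']
    intro x hx
    have h1 : ∀ q, x.1.1 (F.vrep q) = 0 := fun q => congrFun (congrArg Prod.fst hx) q
    have h2 : ∀ i, x.1.2 (b i) = 0 := fun i => congrFun (congrArg Prod.snd hx) i
    have h3 : x.1.2 = 0 := by
      have : x.1.2.toIntLinearMap = 0 := b.ext fun i => h2 i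
      ext1 g
      exact LinearMap.congr_fun this g
    have h4 : x.1.1 = 0 := by
      ext1 v
      obtain ⟨g, hg⟩ := F.exists_vadd_vrep v
      rw [← hg, x.2, h1, h3]
      simp
    exact Subtype.ext (Prod.ext h4 h3)
  · rintro ⟨f, w⟩
    choose gv hgv using F.exists_vadd_vrep
    let π' : Γ →+ Plane := (b.constr ℤ w).toAddMonoidHom
    have hgadd : ∀ (g : Γ) (v : V), gv (g +ᵥ v) = g + gv v := by
      intro g v
      have h1 := hgv (g +ᵥ v)
      rw [F.vmk_vadd] at h1
      refine F.vadd_left_injective (v := F.vrep (F.vmk v)) ?_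
      rw [h1, add_vadd, hgv]
    refine ⟨⟨(fun v => f (F.vmk v) + π' (gv v), π'), fun g v => ?_⟩, Prod.ext ?_ ?_⟩
    · show f (F.vmk (g +ᵥ v)) + π' (gv (g +ᵥ v)) = f (F.vmk v) + π' (gv v) + π' g
      rw [F.vmk_vadd, hgadd, map_add]
      abel
    · ext1 q
      show f (F.vmk (F.vrep q)) + π' (gv (F.vrep q)) = f q
      have h1 := hgv (F.vrep q)
      rw [F.vmk_vrep] at h1
      rw [F.vmk_vrep, F.vadd_eq_self h1, map_zero, add_zero]
    · ext1 i
      exact b.constr_basis ℤ w i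

theorem finiteDimensional_displacements (F : PeriodicFramework V Γ) :
    FiniteDimensional ℝ (displacements V Γ) := by
  have := F.finite_vertexOrbit
  obtain ⟨e⟩ := F.exists_displacement_equiv
  exact e.symm.finiteDimensional

theorem finrank_displacements (F : PeriodicFramework V Γ) :
    Module.finrank ℝ (displacements V Γ) = 2 * Nat.card (VertexOrbit Γ V) + 4 := by
  have := F.finite_vertexOrbit
  have := Fintype.ofFinite (VertexOrbit Γ V)
  obtain ⟨e⟩ := F.exists_displacement_equiv
  rw [e.finrank_eq, Module.finrank_prod, Module.finrank_pi_fintype, Module.finrank_pi_fintype]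
  simp [mul_comm]

/-- The trivial motions. -/
def trivialMap : (Plane × ℝ) →ₗ[ℝ] displacements V Γ where
  toFun p := ⟨(fun v => p.1 + p.2 • perp (F.placement v),
      p.2 • (AddMonoidHom.mk' (fun g => perp (F.period g)) fun g g' => by
        rw [map_add, perp_add])), fun g v => by
    simp [F.placement_vadd, perp_add, add_assoc]⟩
  map_add' p p' := by
    refine Subtype.ext (Prod.ext ?_ ?_)
    · ext1 v
      simp [add_smul]
      abel
    · ext1 g
      simp [add_smul]
  map_smul' r p := by
    refine Subtype.ext (Prod.ext ?_ ?_)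
    · ext1 v
      simp [mul_smul]
    · ext1 g
      simp [mul_smul]

theorem isTrivial_iff {x : displacements V Γ} :
    F.IsTrivial x ↔ x ∈ LinearMap.range F.trivialMap := by
  constructor
  · rintro ⟨t, ω, h1, h2⟩
    refine ⟨(t, ω), Subtype.ext (Prod.ext ?_ ?_)⟩
    · ext1 v; exact (h1 v).symm
    · ext1 g; exact (h2 g).symm
  · rintro ⟨⟨t, ω⟩, rfl⟩
    exact ⟨t, ω, fun v => rfl, fun g => rfl⟩

theorem finrank_trivial : Module.finrank ℝ (LinearMap.range F.trivialMap) = 3 := by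
  rw [LinearMap.finrank_range_of_inj]
  · simp
  · rw [← LinearMap.ker_eq_bot, LinearMap.ker_eq_bot']
    rintro ⟨t, ω⟩ h
    obtain ⟨g, hg⟩ := F.exists_ne_zero
    have h1 : ω • perp (F.period g) = 0 :=
      congrArg (fun x : displacements V Γ => x.1.2 g) h
    have h2 : perp (F.period g) ≠ 0 := by
      rw [← norm_pos_iff, norm_perp, norm_pos_iff]
      exact F.period_ne_zero hg
    have h3 : ω = 0 := (smul_eq_zero.1 h1).resolve_right h2
    obtain ⟨v⟩ := F.connected.nonempty
    have h4 : t + ω • perp (F.placement v) = 0 :=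
      congrArg (fun x : displacements V Γ => x.1.1 v) h
    rw [h3, zero_smul, add_zero] at h4
    rw [h3, h4]; rfl

theorem IsTrivial.stretch_eq_zero {F : PeriodicFramework V Γ} {x : displacements V Γ}
    (h : F.IsTrivial x) (u v : V) : F.stretch x u v = 0 := by
  obtain ⟨t, ω, h1, -⟩ := h
  rw [stretch, h1, h1, add_sub_add_left_eq_sub, ← smul_sub, ← perp_sub, inner_smul_right,
    real_inner_comm, inner_perp, det2_self, mul_zero]

theorem range_trivialMap_le : LinearMap.range F.trivialMap ≤ F.infinitesimalMotions := by
  intro x hx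
  exact F.mem_infinitesimalMotions.2 fun u v _ => (F.isTrivial_iff.2 hx).stretch_eq_zero u v

/-- The periodic stresses are as many as the edge orbits exceed the rank. -/
theorem finrank_periodicStresses : Module.finrank ℝ F.periodicStresses +
    Module.finrank ℝ (LinearMap.range F.rigidityMap) = Nat.card (EdgeOrbit Γ F.graph) := by
  classical
  have := F.finiteDimensional_displacements
  let Ψ := F.rigidityMap.dualMap ∘ₗ (dotProductEquiv ℝ (EdgeOrbit Γ F.graph)).toLinearMap
  have hker : LinearMap.ker Ψ = F.periodicStresses := by
    ext s
    rw [LinearMap.mem_ker]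
    constructor
    · intro h x
      exact LinearMap.congr_fun h x
    · intro h
      ext x
      exact h x
  have h1 := LinearMap.finrank_range_add_finrank_ker Ψ
  have h2 : LinearMap.range Ψ = LinearMap.range F.rigidityMap.dualMap :=
    LinearMap.range_comp_of_range_eq_top _ (LinearEquiv.range _)
  rw [hker, h2, LinearMap.finrank_range_dualMap_eq_finrank_range,
    Module.finrank_fintype_fun_eq_card, ← Nat.card_eq_fintype_card] at h1
  omega

variable {F}

namespace IsPseudoTriangulation

/-- A motion that keeps a varying distance is trivial. -/
theorem isTrivial_of_stretch_eq_zero (hP : F.IsPseudoTriangulation) {a b : V}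
    (hv : F.DistanceVaries a b) {x : displacements V Γ} (hx : x ∈ F.infinitesimalMotions)
    (h : F.stretch x a b = 0) : F.IsTrivial x := by
  obtain ⟨x₀, hx₀, h0⟩ := hv
  obtain ⟨r, s, hrs, htriv⟩ := hP.exists_combination_isTrivial hx hx₀
  have h1 := htriv.stretch_eq_zero a b
  have h2 : F.stretch (r • x + s • x₀) a b = r * F.stretch x a b + s * F.stretch x₀ a b := by
    simp only [stretch, Submodule.coe_add, Submodule.coe_smul, Prod.fst_add, Prod.smul_fst,
      Pi.add_apply, Pi.smul_apply, add_sub_add_comm, ← smul_sub, inner_add_right, inner_smul_right]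
  rw [h2, h, mul_zero, zero_add] at h1
  have hs : s = 0 := (mul_eq_zero.1 h1).resolve_right h0
  have hr : r ≠ 0 := by simpa [hs] using hrs
  rw [hs, zero_smul, add_zero, isTrivial_iff] at htriv
  rw [isTrivial_iff]
  have := Submodule.smul_mem _ r⁻¹ htriv
  rwa [smul_smul, inv_mul_cancel₀ hr, one_smul] at this

theorem finrank_motions_le (hP : F.IsPseudoTriangulation) {a b : V} (hv : F.DistanceVaries a b) :
    Module.finrank ℝ F.infinitesimalMotions ≤ 4 := by
  have := F.finiteDimensional_displacements
  obtain ⟨x₀, hx₀, h0⟩ := hv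
  have hle : F.infinitesimalMotions ≤ LinearMap.range F.trivialMap ⊔ ℝ ∙ x₀ := by
    intro x hx
    obtain ⟨r, hr⟩ : ∃ r : ℝ, F.stretch x a b = r * F.stretch x₀ a b :=
      ⟨F.stretch x a b / F.stretch x₀ a b, by field_simp⟩
    have h1 : x - r • x₀ ∈ F.infinitesimalMotions := sub_mem hx (Submodule.smul_mem _ _ hx₀)
    have h2 : F.stretch (x - r • x₀) a b = F.stretch x a b - r * F.stretch x₀ a b := by
      simp only [stretch, Submodule.coe_sub, Submodule.coe_smul, Prod.fst_sub, Prod.smul_fst,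
        Pi.sub_apply, Pi.smul_apply, sub_sub_sub_comm _ _ (x.1.1 a), ← smul_sub, inner_sub_right,
        inner_smul_right]
    have h3 := hP.isTrivial_of_stretch_eq_zero ⟨x₀, hx₀, h0⟩ h1 (by rw [h2, hr, sub_self])
    rw [← sub_add_cancel x (r • x₀)]
    exact Submodule.add_mem_sup (F.isTrivial_iff.1 h3)
      (Submodule.smul_mem _ _ (Submodule.mem_span_singleton_self x₀))
  have h1 := Submodule.finrank_mono hle
  have h2 := Submodule.finrank_add_le_finrank_add_finrank (LinearMap.range F.trivialMap) (ℝ ∙ x₀)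
  have h3 : Module.finrank ℝ (ℝ ∙ x₀) ≤ 1 := (finrank_span_le_card _).trans (by simp)
  rw [F.finrank_trivial] at h2
  omega

/-- Displacements have dimension 2n + 4 and motions at most 4, so the rank is at least 2n; it is at
most m, and m ≤ 2n. -/
theorem rigidityMap_surjective (hP : F.IsPseudoTriangulation) {a b : V}
    (hv : F.DistanceVaries a b) : Function.Surjective F.rigidityMap ∧
      Nat.card (EdgeOrbit Γ F.graph) = 2 * Nat.card (VertexOrbit Γ V) := by
  have := F.finiteDimensional_displacements
  have h1 := LinearMap.finrank_range_add_finrank_ker F.rigidityMap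
  have h2 : Module.finrank ℝ (LinearMap.ker F.rigidityMap) ≤ 4 := hP.finrank_motions_le hv
  have h3 := F.finrank_displacements
  have h4 := hP.card_edgeOrbit_le
  have h5 := Submodule.finrank_le (LinearMap.range F.rigidityMap)
  rw [Module.finrank_fintype_fun_eq_card, ← Nat.card_eq_fintype_card] at h5
  refine ⟨LinearMap.range_eq_top.1 (Submodule.eq_top_of_finrank_eq ?_), by omega⟩
  rw [Module.finrank_fintype_fun_eq_card, ← Nat.card_eq_fintype_card]
  omega

end IsPseudoTriangulation

/-! ### Edge orbits after an insertion -/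

section InsertOrbit

variable (F) {a b : V} (hab : F.placement a ≠ F.placement b)

/-- The edge orbits of a framework as edge orbits after an insertion. -/
def oldOrbit : EdgeOrbit Γ F.graph → EdgeOrbit Γ (F.insertEdge a b hab).graph :=
  Quotient.map (fun e => ⟨e.1, SimpleGraph.edgeSet_mono le_sup_left e.2⟩) fun _ _ h => h

/-- The orbit of the inserted edge. -/
def newOrbit : EdgeOrbit Γ (F.insertEdge a b hab).graph :=
  Quotient.mk _ ⟨s(a, b), F.insertEdge_adj a b hab⟩

theorem rigidityMap_oldOrbit (x : displacements V Γ) (β : EdgeOrbit Γ F.graph) :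
    (F.insertEdge a b hab).rigidityMap x (F.oldOrbit hab β) = F.rigidityMap x β := by
  induction β using Quotient.inductionOn with
  | h e => rfl

theorem insertOrbit_bijective (hadj : ¬ F.graph.Adj a b) :
    Function.Bijective (fun o : Option (EdgeOrbit Γ F.graph) =>
      o.elim (F.newOrbit hab) (F.oldOrbit hab)) := by
  have hne : ∀ β, F.oldOrbit hab β ≠ F.newOrbit hab := by
    intro β h
    induction β using Quotient.inductionOn with
    | h e =>
      obtain ⟨e, he⟩ := e
      induction e with
      | h u v =>
        obtain ⟨g, hg⟩ := Quotient.exact h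
        have h1 := F.adj_vadd g u v he
        have h2 : s(g +ᵥ u, g +ᵥ v) = s(a, b) := hg
        apply hadj
        rw [← SimpleGraph.mem_edgeSet, ← h2]
        exact h1
  constructor
  · rintro (_ | β) (_ | β') h
    · rfl
    · exact absurd h.symm (hne β')
    · exact absurd h (hne β)
    · induction β using Quotient.inductionOn with
      | h e =>
        induction β' using Quotient.inductionOn with
        | h e' =>
          obtain ⟨g, hg⟩ := Quotient.exact h
          exact congrArg some (Quotient.sound ⟨g, hg⟩)
  · intro β
    induction β using Quotient.inductionOn with
    | h e =>
      obtain ⟨e, he⟩ := e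
      by_cases h : e ∈ F.graph.edgeSet
      · exact ⟨some (Quotient.mk _ ⟨e, h⟩), rfl⟩
      · refine ⟨none, Quotient.sound ?_⟩
        have he' : e ∈ (F.graph ⊔ SimpleGraph.fromEdgeSet (pairOrbit Γ a b)).edgeSet := he
        rw [SimpleGraph.edgeSet_sup, SimpleGraph.edgeSet_fromEdgeSet] at he'
        rcases he' with he' | ⟨⟨g, hg⟩, _⟩
        · exact absurd he' h
        · exact ⟨g, hg.symm⟩

theorem card_insertOrbit (hadj : ¬ F.graph.Adj a b) :
    Nat.card (EdgeOrbit Γ (F.insertEdge a b hab).graph) = Nat.card (EdgeOrbit Γ F.graph) + 1 := by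
  rw [← Nat.card_eq_of_bijective _ (F.insertOrbit_bijective hab hadj), Finite.card_option]

theorem sum_insertOrbit (hadj : ¬ F.graph.Adj a b)
    (f : EdgeOrbit Γ (F.insertEdge a b hab).graph → ℝ) :
    ∑ β, f β = f (F.newOrbit hab) + ∑ β, f (F.oldOrbit hab β) := by
  rw [← Function.Bijective.sum_comp (F.insertOrbit_bijective hab hadj), Fintype.sum_option]
  rfl

theorem mem_motions_insert {x : displacements V Γ}
    (hx : x ∈ (F.insertEdge a b hab).infinitesimalMotions) :
    x ∈ F.infinitesimalMotions ∧ F.stretch x a b = 0 := by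
  rw [mem_infinitesimalMotions] at hx
  exact ⟨F.mem_infinitesimalMotions.2 fun u v h => hx u v (Or.inl h),
    hx a b (F.insertEdge_adj a b hab)⟩

end InsertOrbit

theorem DistanceVaries.not_adj {a b : V} (h : F.DistanceVaries a b) : ¬ F.graph.Adj a b := by
  obtain ⟨x, hx, h0⟩ := h
  exact fun h => h0 (F.mem_infinitesimalMotions.1 hx a b h)

namespace IsPseudoTriangulation

/-- A motion of the enlarged framework keeps the varying distance, hence is trivial, and one orbit
is added to m = 2n. -/
theorem minimallyRigid_insertEdge (hP : F.IsPseudoTriangulation) {a b : V}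
    (hab : F.placement a ≠ F.placement b) (hv : F.DistanceVaries a b) :
    (F.insertEdge a b hab).MinimallyRigid := by
  refine ⟨fun x hx => ?_, ?_⟩
  · obtain ⟨h1, h2⟩ := F.mem_motions_insert hab hx
    exact hP.isTrivial_of_stretch_eq_zero hv h1 h2
  · rw [F.card_insertOrbit hab hv.not_adj, (hP.rigidityMap_surjective hv).2]

/-- Each pair can be inserted on its own without crossings, so `exists_neg_expansion` expresses the
same expansion as a negative multiple of either stretch. Neither vanishes, since the motion is
non-trivial. -/
theorem same_sign (hP : F.IsPseudoTriangulation) {a b c d : V}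
    {hab : F.placement a ≠ F.placement b} {hcd : F.placement c ≠ F.placement d}
    (hv : F.DistanceVaries a b) (hv' : F.DistanceVaries c d)
    (hN : (F.insertTwo a b c d hab hcd).NonCrossing) {x : displacements V Γ}
    (hx : x ∈ F.infinitesimalMotions) (hx' : ¬ F.IsTrivial x) :
    (0 < F.stretch x a b ∧ 0 < F.stretch x c d) ∨
      (F.stretch x a b < 0 ∧ F.stretch x c d < 0) := by
  have h1 : (F.insertEdge a b hab).NonCrossing := fun u v w z h h' =>
    hN u v w z (Or.inl h) (Or.inl h')
  have hle : ∀ u v, (F.insertEdge c d hcd).graph.Adj u v →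
      (F.insertTwo a b c d hab hcd).graph.Adj u v := by
    rintro u v (h | h)
    · exact Or.inl (Or.inl h)
    · exact Or.inr h
  have h2 : (F.insertEdge c d hcd).NonCrossing := fun u v w z h h' =>
    hN u v w z (hle _ _ h) (hle _ _ h')
  obtain ⟨t, ht, hE⟩ := hP.exists_neg_expansion h1 hv
  obtain ⟨t', ht', hE'⟩ := hP.exists_neg_expansion h2 hv'
  have h3 : t * F.stretch x a b = t' * F.stretch x c d := (hE x hx).symm.trans (hE' x hx)
  have h4 : F.stretch x a b ≠ 0 := fun h => hx' (hP.isTrivial_of_stretch_eq_zero hv hx h)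
  rcases lt_or_gt_of_ne h4 with h | h
  · right
    refine ⟨h, ?_⟩
    have := mul_pos_of_neg_of_neg ht h
    rw [h3] at this
    by_contra! hcon
    nlinarith
  · left
    refine ⟨h, ?_⟩
    have := mul_neg_of_neg_of_pos ht h
    rw [h3] at this
    by_contra! hcon
    nlinarith

end IsPseudoTriangulation

theorem not_adj_of_orbit_ne {a b c d : V} {hab : F.placement a ≠ F.placement b}
    {hcd : F.placement c ≠ F.placement d} (hv' : F.DistanceVaries c d)
    (hne : F.firstOrbit a b c d hab hcd ≠ F.secondOrbit a b c d hab hcd) :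
    ¬ (F.insertEdge a b hab).graph.Adj c d := by
  intro h
  have h' : F.graph.Adj c d ∨ (SimpleGraph.fromEdgeSet (pairOrbit Γ a b)).Adj c d := h
  rw [SimpleGraph.fromEdgeSet_adj] at h'
  rcases h' with h' | ⟨⟨g, h'⟩, -⟩
  · exact hv'.not_adj h'
  · exact hne (Quotient.sound ⟨g, h'.symm⟩)

namespace IsPseudoTriangulation

/-- There are 2n + 2 edge orbits, and only the three dimensions of trivial motions survive, so the
rank is 2n + 1. -/
theorem finrank_periodicStresses_insertTwo (hP : F.IsPseudoTriangulation) {a b c d : V}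
    {hab : F.placement a ≠ F.placement b} {hcd : F.placement c ≠ F.placement d}
    (hv : F.DistanceVaries a b) (hv' : F.DistanceVaries c d)
    (hne : F.firstOrbit a b c d hab hcd ≠ F.secondOrbit a b c d hab hcd) :
    Module.finrank ℝ (F.insertTwo a b c d hab hcd).periodicStresses = 1 := by
  set F2 := F.insertTwo a b c d hab hcd with hF2
  have := F.finiteDimensional_displacements
  have h1 : Nat.card (EdgeOrbit Γ F2.graph) = Nat.card (EdgeOrbit Γ F.graph) + 1 + 1 := by
    rw [← F.card_insertOrbit hab hv.not_adj]
    exact (F.insertEdge a b hab).card_insertOrbit hcd (not_adj_of_orbit_ne hv' hne)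
  have h2 := (hP.rigidityMap_surjective hv).2
  have h3 : F2.infinitesimalMotions = LinearMap.range F2.trivialMap := by
    refine le_antisymm (fun x hx => ?_) F2.range_trivialMap_le
    have h4 := (F.insertEdge a b hab).mem_motions_insert hcd hx
    have h5 := F.mem_motions_insert hab h4.1
    exact F2.isTrivial_iff.1 (hP.isTrivial_of_stretch_eq_zero hv h5.1 h5.2)
  have h4 := LinearMap.finrank_range_add_finrank_ker F2.rigidityMap
  have h5 : Module.finrank ℝ (LinearMap.ker F2.rigidityMap) = 3 := by
    rw [← F2.finrank_trivial, ← h3]; rfl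
  have h6 := F2.finrank_periodicStresses
  rw [h5, F.finrank_displacements] at h4
  omega

/-- A stress is orthogonal to the image of a motion of the pseudo-triangulation, and there only the
two inserted orbits contribute. Their stretches have the same sign, so the stress factors are
opposite unless both vanish; and then the stress is zero, since the original rigidity matrix is
surjective. -/
theorem stress_mul_neg (hP : F.IsPseudoTriangulation) {a b c d : V}
    {hab : F.placement a ≠ F.placement b} {hcd : F.placement c ≠ F.placement d}
    (hv : F.DistanceVaries a b) (hv' : F.DistanceVaries c d)
    (hN : (F.insertTwo a b c d hab hcd).NonCrossing)
    (hne : F.firstOrbit a b c d hab hcd ≠ F.secondOrbit a b c d hab hcd)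
    {s : EdgeOrbit Γ (F.insertTwo a b c d hab hcd).graph → ℝ}
    (hs : s ∈ (F.insertTwo a b c d hab hcd).periodicStresses) (hs0 : s ≠ 0) :
    s (F.firstOrbit a b c d hab hcd) * s (F.secondOrbit a b c d hab hcd) < 0 := by
  classical
  set G := F.insertEdge a b hab with hG
  have hadj' : ¬ G.graph.Adj c d := not_adj_of_orbit_ne hv' hne
  set s₁ := s (F.firstOrbit a b c d hab hcd) with hs₁
  set s₂ := s (F.secondOrbit a b c d hab hcd) with hs₂
  let s₀ : EdgeOrbit Γ F.graph → ℝ := fun β => s (G.oldOrbit hcd (F.oldOrbit hab β))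
  have hsum : ∀ x, s₂ * F.stretch x c d + (s₁ * F.stretch x a b +
      ∑ β, s₀ β * F.rigidityMap x β) = 0 := by
    intro x
    have h1 := hs x
    have h2 := G.sum_insertOrbit hcd hadj'
      (fun β => s β * (F.insertTwo a b c d hab hcd).rigidityMap x β)
    have h3 := F.sum_insertOrbit hab hv.not_adj
      (fun β => s (G.oldOrbit hcd β) * G.rigidityMap x β)
    have h5 : ∀ β, G.rigidityMap x (F.oldOrbit hab β) = F.rigidityMap x β :=
      F.rigidityMap_oldOrbit hab x
    simp only [h5] at h3
    have h4 : ∀ β, (F.insertTwo a b c d hab hcd).rigidityMap x (G.oldOrbit hcd β) =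
      G.rigidityMap x β := G.rigidityMap_oldOrbit hcd x
    simp only [h4] at h2
    rw [h3] at h2
    exact h2.symm.trans h1
  obtain ⟨x, hx, hx0⟩ := hv
  have hmot := hsum x
  have hR : F.rigidityMap x = 0 := hx
  simp only [hR, Pi.zero_apply, mul_zero, Finset.sum_const_zero, add_zero] at hmot
  have hsign := hP.same_sign ⟨x, hx, hx0⟩ hv' hN hx fun h => hx0 (h.stretch_eq_zero a b)
  have hzero : s₁ = 0 → s₂ = 0 → False := by
    intro h1 h2
    apply hs0
    have h0 : ∀ β, s₀ β = 0 := by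
      intro β
      -- A displacement that changes only the lengths in the orbit `β` isolates the stress factor
      -- there.
      obtain ⟨z, hz⟩ := (hP.rigidityMap_surjective ⟨x, hx, hx0⟩).1 (Pi.single β 1)
      have := hsum z
      rw [h1, h2, hz] at this
      simpa [Pi.single_apply] using this
    ext β
    obtain ⟨o, rfl⟩ := (G.insertOrbit_bijective hcd hadj').2 β
    rcases o with _ | β
    · exact h2
    obtain ⟨o, rfl⟩ := (F.insertOrbit_bijective hab (DistanceVaries.not_adj ⟨x, hx, hx0⟩)).2 β
    rcases o with _ | β
    · exact h1
    · exact h0 β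
  by_contra! hcon
  rcases hsign with ⟨h1, h2⟩ | ⟨h1, h2⟩
  · have h3 : s₁ * F.stretch x a b = -(s₂ * F.stretch x c d) := by linarith
    -- Multiplying the relation by `s₁` brings in the product assumed nonnegative; it forces `s₁` to
    -- vanish, and then `s₂`.
    have h4 : s₁ ^ 2 * F.stretch x a b = -(s₁ * s₂ * F.stretch x c d) := by
      linear_combination s₁ * h3
    have h5 := mul_nonneg hcon h2.le
    have h6 : s₁ = 0 := by
      by_contra hne
      have := mul_pos (pow_pos (abs_pos.2 hne) 2) h1
      rw [sq_abs] at this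
      linarith
    rw [h6, zero_mul, add_zero, mul_eq_zero] at hmot
    exact hzero h6 (hmot.resolve_right h2.ne')
  · have h4 : s₁ ^ 2 * F.stretch x a b = -(s₁ * s₂ * F.stretch x c d) := by
      linear_combination s₁ * hmot
    have h5 := mul_nonneg hcon (neg_pos.2 h2).le
    have h6 : s₁ = 0 := by
      by_contra hne
      have := mul_pos (pow_pos (abs_pos.2 hne) 2) (neg_pos.2 h1)
      rw [sq_abs] at this
      linarith
    rw [h6, zero_mul, add_zero, mul_eq_zero] at hmot
    exact hzero h6 (hmot.resolve_right h2.ne)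

end IsPseudoTriangulation

end PeriodicFramework
end PeriodicRigidity
end

theorem mainTheorem4 {V Γ : Type*} [AddCommGroup Γ] [AddAction Γ V]
    (F : PeriodicRigidity.PeriodicFramework V Γ) (hF : F.IsPseudoTriangulation) :
    (∀ (a b : V) (hab : F.placement a ≠ F.placement b), F.DistanceVaries a b →
      (F.insertEdge a b hab).NonCrossing → (F.insertEdge a b hab).MinimallyRigid) ∧
    (∀ (a b c d : V) (hab : F.placement a ≠ F.placement b) (hcd : F.placement c ≠ F.placement d),
      F.DistanceVaries a b → F.DistanceVaries c d →
      (F.insertTwo a b c d hab hcd).NonCrossing →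
      (F.firstOrbit a b c d hab hcd ≠ F.secondOrbit a b c d hab hcd →
        Module.finrank ℝ (F.insertTwo a b c d hab hcd).periodicStresses = 1 ∧
        ∀ s ∈ (F.insertTwo a b c d hab hcd).periodicStresses, s ≠ 0 →
          s (F.firstOrbit a b c d hab hcd) * s (F.secondOrbit a b c d hab hcd) < 0) ∧
      (∀ x ∈ F.infinitesimalMotions, ¬ F.IsTrivial x →
        (0 < F.stretch x a b ∧ 0 < F.stretch x c d) ∨
        (F.stretch x a b < 0 ∧ F.stretch x c d < 0))) :=
  ⟨fun _ _ hab hv _ => hF.minimallyRigid_insertEdge hab hv,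
    fun _ _ _ _ _ _ hv hv' hN =>
      ⟨fun hne => ⟨hF.finrank_periodicStresses_insertTwo hv hv' hne,
        fun _ hs hs0 => hF.stress_mul_neg hv hv' hN hne hs hs0⟩,
      fun _ hx hx' => hF.same_sign hv hv' hN hx hx'⟩⟩
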